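/- **Conventions.** Let $\mathbb D$ be the open unit disk and $\mathbb T$ its boundary. A *modulus of continuity* is a nondecreasing continuous function $\omega:[0,2]\to\mathbb R$ with $\omega(0)=0$, $\omega(1)=1$ and $t\mapsto\omega(t)/t$ nonincreasing on $(0,2]$. Put $\omega^*(t)=\inf\{u\in[0,1]:\omega(u)=t\}$ for $t\in[0,1]$ and $$\omega_\Gamma(f)=\sup_{z,w\in\Gamma,\ z\ne w}\frac{|f(z)-f(w)|}{\omega(|z-w|)}$$ for a function $f$ on $\Gamma\subseteq\overline{\mathbb D}$. Let $\Lambda_\omega$ be the set of functions $f$ analytic on $\mathbb D$ and continuous on $\overline{\mathbb D}$ with $\omega_{\overline{\mathbb D}}(f)<\infty$. Let $\psi$ be a modulus of continuity and $h:\mathbb T\to[0,\infty)$ a continuous function with nonempty zero set $E_h$, such that $\int_{\mathbb T}\log h\,|d\xi|>-\infty$ and $\psi_{\mathbb T}(h)<\infty$. Write $h(\theta)=h(e^{i\theta})$ and $\lambda(\xi)=\psi^*\big(\tfrac{h(\xi)}{2\psi_{\mathbb T}(h)}\big)$. Assume that there are constants $C_h,c_h>0$ such that for all $\theta,s$ with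 $e^{i\theta}\in\mathbb T\setminus E_h$ and $0<s\le\lambda(e^{i\theta})$, $$\lim_{\varepsilon\to0^+}\int_\varepsilon^s\frac{|h(\theta+t)-h(\theta-t)|}{t}\,dt\le C_h\,\psi(s),\qquad \frac1{h(\theta)}\int_s^{\lambda(e^{i\theta})}\frac{|h(\theta+t)h(\theta-t)-h^2(\theta)|}{t^2}\,dt\le c_h\,\frac{\psi(s)}{s}.$$ For $z\in\mathbb D$ let $$u_h(z)+iv_h(z)=\frac1{2\pi}\int_{\mathbb T}\frac{\xi+z}{\xi-z}\log h(\xi)\,|d\xi|,\qquad O_h(z)=e^{u_h(z)+iv_h(z)},\qquad O_h^\rho(z)=e^{\rho(u_h(z)+iv_h(z))}.$$ On the circle, for $\xi=e^{i\theta}\in\mathbb T\setminus E_h$, let $$v_h(\xi)=-\lim_{\varepsilon\to0^+}\frac1{2\pi}\int_{\varepsilon\le|t|\le\pi}\frac{\log h(\theta+t)}{\tan(t/2)}\,dt,\qquad O_h(\xi)=h(\xi)e^{iv_h(\xi)},\qquad O_h^\rho(\xi)=h^\rho(\xi)e^{i\rho v_h(\xi)},$$ and let $O_h=O_h^\rho=0$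 on $E_h$. (Under the above assumptions the limit exists.) For $\xi\in\mathbb T\setminus E_h$ put $$a_h(\xi)=\int_{\{\zeta\in\mathbb T:\ |\zeta-\xi|>\lambda(\xi)\}}\frac{\big|\log\frac{h(\zeta)}{h(\xi)}\big|}{|\zeta-\xi|^2}\,|d\zeta|.$$ **Theorem.** Let $\psi$ and $h$ be as above, let $\rho\ge1$ be a real number, and let $\omega$ be any modulus of continuity with $\omega(t)\ge\psi(t)$ for all $t\in[0,2]$. The following four assertions are equivalent: 1. $O_h^\rho\in\Lambda_\omega$. 2. $\omega_{\mathbb D}(|O_h^\rho|)<\infty$. 3. There is a real $\delta>0$, with $\delta h^\rho\le1$ on $\mathbb T$, such that $$\sup_{\xi\in\mathbb T\setminus E_h}\ \sup_{z\in\mathbb D_\xi}\Big|\log\frac{|O_h(z)|}{h(\xi)}\Big|<\infty,\qquad \mathbb D_\xi=\{z\in\overline{\mathbb D}:|z-\xi|\le\omega^*(\delta h^\rho(\xi))\},$$ where $|\log 0|=\infty$. 4. $\displaystyle\sup_{\xi\in\mathbb T\setminus E_h}\frac{h^\rho(\xi)}{\omega(\min\{1,a_h(\xi)^{-1}\})}<\infty.$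 -/

import Mathlib

open Set Filter Topology MeasureTheory
open scoped ENNReal

noncomputable section

namespace OuterLip

/-- A modulus of continuity: a nondecreasing continuous function on `[0,2]` with value `0` at `0`
and `1` at `1`, such that `t ↦ ω t / t` is nonincreasing on `(0,2]`.  Values of `ω` outside `[0,2]`
play no role. -/
structure IsModulus (ω : ℝ → ℝ) : Prop where
  monotoneOn : MonotoneOn ω (Icc 0 2)
  continuousOn : ContinuousOn ω (Icc 0 2)
  map_zero : ω 0 = 0
  map_one : ω 1 = 1
  antitoneOn_div : AntitoneOn (fun t => ω t / t) (Ioc 0 2)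

/-- `ω*(t) = inf {u ∈ [0,1] : ω u = t}`, meaningful for `t ∈ [0,1]`, where the set is nonempty. -/
def star (ω : ℝ → ℝ) (t : ℝ) : ℝ :=
  sInf {u : ℝ | u ∈ Icc (0 : ℝ) 1 ∧ ω u = t}

/-- `ω_Γ(f)`, the supremum over distinct `z, w ∈ Γ` of `|f z - f w| / ω |z - w|`, with values in
`[0,∞]`. On `Circle` the distance is the chordal one. -/
def seminorm {X E : Type*} [PseudoMetricSpace X] [SeminormedAddCommGroup E]
    (ω : ℝ → ℝ) (Γ : Set X) (f : X → E) : ℝ≥0∞ :=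
  ⨆ z ∈ Γ, ⨆ w ∈ Γ, ⨆ _ : z ≠ w, ENNReal.ofReal (‖f z - f w‖ / ω (dist z w))

/-- Membership in `Λ_ω`: analytic on the open unit disk, continuous on the closed disk, and
`ω`-Lipschitz on the closed disk. Values off the closed disk play no role. -/
structure MemLambda (ω : ℝ → ℝ) (f : ℂ → ℂ) : Prop where
  analytic : DifferentiableOn ℂ f (Metric.ball 0 1)
  continuousOn : ContinuousOn f (Metric.closedBall 0 1)
  lipschitz : seminorm ω (Metric.closedBall 0 1) f < ⊤

/-- `∫_𝕋 log h > -∞` for a continuous `h ≥ 0`. The first clause is needed since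
`Real.log 0 = 0` instead of `-∞`. -/
def LogIntegrable (h : Circle → ℝ) : Prop :=
  (∀ᵐ t : ℝ, h (Circle.exp t) ≠ 0) ∧
    IntervalIntegrable (fun t => Real.log (h (Circle.exp t))) volume 0 (2 * Real.pi)

/-- The harmonic function `u_h` on the open disk (Poisson integral of `log h`). -/
def u (h : Circle → ℝ) (z : ℂ) : ℝ :=
  1 / (2 * Real.pi) * ∫ t in (0 : ℝ)..(2 * Real.pi),
    ((((Circle.exp t : ℂ) + z) / ((Circle.exp t : ℂ) - z)).re * Real.log (h (Circle.exp t)))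

/-- The harmonic conjugate `v_h` of `u_h` on the open disk. -/
def v (h : Circle → ℝ) (z : ℂ) : ℝ :=
  1 / (2 * Real.pi) * ∫ t in (0 : ℝ)..(2 * Real.pi),
    ((((Circle.exp t : ℂ) + z) / ((Circle.exp t : ℂ) - z)).im * Real.log (h (Circle.exp t)))

/-- The boundary function `v_h(θ)`, a principal value, used at the points with `h(e^{iθ}) ≠ 0`.
There the limit exists as soon as `h` satisfies `SymmetryFirst` below for some modulus. -/
def vBoundary (h : Circle → ℝ) (θ : ℝ) : ℝ :=
  -limUnder (𝓝[>] (0 : ℝ)) (fun ε : ℝ => 1 / (2 * Real.pi) *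
    ((∫ t in (-Real.pi)..(-ε), Real.log (h (Circle.exp (θ + t))) / Real.tan (t / 2)) +
      ∫ t in ε..Real.pi, Real.log (h (Circle.exp (θ + t))) / Real.tan (t / 2)))

open Classical in
/-- The outer function `O_h` on the closed disk: `exp (u_h + i v_h)` inside, and on the circle
`h exp (i v_h)` off the zeros of `h` and `0` at the zeros.
For `‖z‖ = 1`, `Circle.exp z.arg` is the point `z`. -/
def outer (h : Circle → ℝ) (z : ℂ) : ℂ :=
  if ‖z‖ < 1 then Complex.exp (u h z + Complex.I * v h z)
  else if ‖z‖ = 1 ∧ h (Circle.exp z.arg) ≠ 0 then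
    h (Circle.exp z.arg) * Complex.exp (Complex.I * vBoundary h z.arg)
  else 0

open Classical in
/-- The power `O_h^ρ` on the closed disk, formed with the logarithm `u_h + i v_h` of `O_h`. -/
def outerPow (h : Circle → ℝ) (ρ : ℝ) (z : ℂ) : ℂ :=
  if ‖z‖ < 1 then Complex.exp (ρ * (u h z + Complex.I * v h z))
  else if ‖z‖ = 1 ∧ h (Circle.exp z.arg) ≠ 0 then
    ((h (Circle.exp z.arg) ^ ρ : ℝ) : ℂ) * Complex.exp (Complex.I * (ρ * vBoundary h z.arg))
  else 0

/-- The radius `ψ*(h(ξ) / (2 ψ_𝕋(h)))`. -/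
def radius (ψ : ℝ → ℝ) (h : Circle → ℝ) (ξ : Circle) : ℝ :=
  star ψ (h ξ / (2 * (seminorm ψ univ h).toReal))

/-- The first local symmetry condition:
`lim_{ε → 0} ∫_ε^s |h(θ+t) - h(θ-t)| / t dt ≤ C ψ(s)`, uniformly in `θ` and `s`. -/
def SymmetryFirst (ψ : ℝ → ℝ) (h : Circle → ℝ) : Prop :=
  ∃ C > 0, ∀ θ s : ℝ, h (Circle.exp θ) ≠ 0 → 0 < s → s ≤ radius ψ h (Circle.exp θ) →
    ∃ L : ℝ, Tendsto
      (fun ε : ℝ => ∫ t in ε..s, |h (Circle.exp (θ + t)) - h (Circle.exp (θ - t))| / t)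
      (𝓝[>] 0) (𝓝 L) ∧ L ≤ C * ψ s

/-- The second local symmetry condition:
`(1 / h(θ)) ∫_s^{ψ*(h(θ) / (2 ψ_𝕋(h)))} |h(θ+t) h(θ-t) - h(θ)²| / t² dt ≤ c ψ(s) / s`,
uniformly in `θ` and `s`. -/
def SymmetrySecond (ψ : ℝ → ℝ) (h : Circle → ℝ) : Prop :=
  ∃ c > 0, ∀ θ s : ℝ, h (Circle.exp θ) ≠ 0 → 0 < s → s ≤ radius ψ h (Circle.exp θ) →
    1 / h (Circle.exp θ) * ∫ t in s..radius ψ h (Circle.exp θ),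
      |h (Circle.exp (θ + t)) * h (Circle.exp (θ - t)) - h (Circle.exp θ) ^ 2| / t ^ 2
    ≤ c * (ψ s / s)

/-- `a_h(ξ) ∈ [0,∞]`, for `ξ` with `h ξ ≠ 0`: the integral of `|log (h ζ / h ξ)| / |ζ - ξ|²` over
the points `ζ` of the circle with `|ζ - ξ| > ψ*(h(ξ) / (2 ψ_𝕋(h)))`. -/
def a (ψ : ℝ → ℝ) (h : Circle → ℝ) (ξ : Circle) : ℝ≥0∞ :=
  ∫⁻ t in {t : ℝ | t ∈ Ico 0 (2 * Real.pi) ∧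
      radius ψ h ξ < ‖(Circle.exp t : ℂ) - (ξ : ℂ)‖},
    ENNReal.ofReal (|Real.log (h (Circle.exp t) / h ξ)| /
      ‖(Circle.exp t : ℂ) - (ξ : ℂ)‖ ^ 2)

/-- The set `𝔻_ξ = {z in the closed disk : |z - ξ| ≤ ω*(δ h(ξ)^ρ)}`. -/
def diskAt (ω : ℝ → ℝ) (h : Circle → ℝ) (ρ δ : ℝ) (ξ : Circle) : Set ℂ :=
  {z : ℂ | z ∈ Metric.closedBall 0 1 ∧ ‖z - (ξ : ℂ)‖ ≤ star ω (δ * h ξ ^ ρ)}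

/-- For some `δ > 0` (with `δ h^ρ ≤ 1`, so that `ω*(δ h^ρ)` is defined),
`|log (|O_h(z)| / h(ξ))|` is bounded uniformly in `z ∈ 𝔻_ξ` and `ξ` with `h ξ ≠ 0`.
`O_h(z) ≠ 0` is part of the bound, as `|log 0| = ∞`. -/
def LogComparable (ω : ℝ → ℝ) (h : Circle → ℝ) (ρ : ℝ) : Prop :=
  ∃ δ > 0, (∀ ξ, δ * h ξ ^ ρ ≤ 1) ∧
    ∃ M : ℝ, ∀ ξ : Circle, h ξ ≠ 0 → ∀ z ∈ diskAt ω h ρ δ ξ,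
      outer h z ≠ 0 ∧ |Real.log (‖outer h z‖ / h ξ)| ≤ M

/-- `h(ξ)^ρ / ω(min {1, 1 / a_h(ξ)})` is bounded over `ξ` with `h ξ ≠ 0`. -/
def QuotientBounded (ψ ω : ℝ → ℝ) (h : Circle → ℝ) (ρ : ℝ) : Prop :=
  ∃ C : ℝ, ∀ ξ : Circle, h ξ ≠ 0 → h ξ ^ ρ ≤ C * ω (min 1 (a ψ h ξ)⁻¹).toReal

end OuterLip

end

/-! Fix ξ = e^{iθ} with h(ξ) ≠ 0, put g(t) = log h(e^{i(θ+t)}) - log h(ξ), let d(t) be the chord and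
L the ψ-Lipschitz constant of h. For d ≤ λ(ξ) the value of h differs from h(ξ) by at most h(ξ)/2, so
|g| ≤ 2Lψ(d)/h(ξ); for d > λ(ξ) the size of g is measured by a_h(ξ). The main estimates split at
this radius.

1 ⇒ 2 is the triangle inequality. For 2 ⇒ 3, a small δ forces |O_h^ρ| to move by at most h^ρ(ξ)/2 on
𝔻_ξ. For 3 ⇒ 4 (`mul_farInt_le`), evaluate at (1-r)ξ with r = ω*(δ'h^ρ(ξ)). The Poisson integral of
g there is bounded by assumption. Since h is ψ-Lipschitz, g⁺ grows at most logarithmically in |t|/λ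
and has a bounded Poisson integral; hence so has |g| = 2g⁺ - g. Beyond λ the Poisson kernel
dominates r/d², so r a_h(ξ) ≤ N. Then r/N ≤ min(1, 1/a_h(ξ)), and ω(r) ≤ N ω(r/N) gives 4.

4 ⇒ 1 is the core, and the only implication that needs the symmetry conditions. Let τ = |ξ-ζ| with
h(ζ) ≤ h(ξ). If ω(τ) ≥ c₀h^ρ(ξ) or τ ≥ m = min(1, 1/a_h(ξ)), the sizes of the two values suffice.
Otherwise the phases are compared (`abs_vBoundary_sub_le`): |v(ζ) - v(ξ)| is at most a constant
times ψ(τ)/h(ξ) + τ a_h(ξ). The path goes radially to radius 1-τ, along the arc, and radially back.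
On the radial legs only the odd part of g matters, and the first symmetry condition controls it for
t ≤ τ. On the arc the kernel difference is an even part of order τ/(τ+d)², which sees only
g(t)+g(-t) and meets the second condition, plus a second difference of order τ²/(τ+d)³. Multiplying
by h^ρ(ξ) is harmless: h^{ρ-1} is bounded, h^ρ ≤ Qω(m), ω(m)τ ≤ ω(τ)m and m a_h ≤ 1.

A bound on the nonzero boundary points passes to the disk by the maximum principle and the Schwarz
lemma (`modulus_bound_ball_of_boundary`), and to the closed disk by taking limits in the graph. -/

noncomputable section

namespace OuterLip

open Metric

/-! ### Moduli of continuity and their generalized inverses. -/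

namespace IsModulus

variable {ω : ℝ → ℝ}

lemma mono (hω : IsModulus ω) {s t : ℝ} (hs : 0 ≤ s) (hst : s ≤ t) (ht : t ≤ 2) : ω s ≤ ω t :=
  hω.monotoneOn ⟨hs, hst.trans ht⟩ ⟨hs.trans hst, ht⟩ hst

lemma nonneg (hω : IsModulus ω) {t : ℝ} (h0 : 0 ≤ t) (h2 : t ≤ 2) : 0 ≤ ω t :=
  hω.map_zero ▸ hω.mono le_rfl h0 h2

lemma mul_le_mul (hω : IsModulus ω) {s t : ℝ} (hs : 0 ≤ s) (hst : s ≤ t) (ht : t ≤ 2) :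
    ω t * s ≤ ω s * t := by
  rcases hs.eq_or_lt with rfl | hs
  · simp [hω.map_zero]
  · have := hω.antitoneOn_div ⟨hs, hst.trans ht⟩ ⟨hs.trans_le hst, ht⟩ hst
    simp only at this
    rwa [div_le_div_iff₀ (hs.trans_le hst) hs] at this

lemma self_le (hω : IsModulus ω) {t : ℝ} (h0 : 0 ≤ t) (h1 : t ≤ 1) : t ≤ ω t := by
  have := hω.mul_le_mul h0 h1 one_le_two
  rwa [hω.map_one, one_mul, mul_one] at this

lemma pos (hω : IsModulus ω) {t : ℝ} (h0 : 0 < t) (h2 : t ≤ 2) : 0 < ω t := by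
  rcases le_total t 1 with h1 | h1
  · exact h0.trans_le (hω.self_le h0.le h1)
  · have := hω.mono zero_le_one h1 h2
    rw [hω.map_one] at this
    linarith

lemma le_two (hω : IsModulus ω) {t : ℝ} (h0 : 0 ≤ t) (h2 : t ≤ 2) : ω t ≤ 2 := by
  have h := hω.mul_le_mul zero_le_one one_le_two le_rfl
  have := hω.mono h0 h2 le_rfl
  rw [hω.map_one] at h
  linarith

/-- The growth bound `ω x ≤ ω t (1 + x / t)`. -/
lemma le_mul_one_add (hω : IsModulus ω) {x t : ℝ} (hx : 0 ≤ x) (hx2 : x ≤ 2) (ht : 0 < t)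
    (ht2 : t ≤ 2) : ω x ≤ ω t * (1 + x / t) := by
  have hp := hω.pos ht ht2
  rcases le_total x t with h | h
  · have h1 := hω.mono hx h ht2
    have : 0 ≤ ω t * (x / t) := by positivity
    linarith
  · have h1 := hω.mul_le_mul ht.le h hx2
    have : ω x ≤ ω t * (x / t) := by
      rw [← mul_div_assoc, le_div_iff₀ ht]; exact h1
    linarith

/-- Dividing the argument by `N` costs at most a factor `N`, because ω(t)/t is nonincreasing. In 3 ⇒
4 this absorbs the constant in r a_h ≤ N. -/
lemma le_mul_div (hω : IsModulus ω) {r N : ℝ} (hr : 0 ≤ r) (hr2 : r ≤ 2) (hN : 1 ≤ N) :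
    ω r ≤ N * ω (r / N) := by
  have hN0 : 0 < N := one_pos.trans_le hN
  have hle : r / N ≤ r := div_le_self hr hN
  rcases hr.eq_or_lt with rfl | hr0
  · simp [hω.map_zero]
  have := hω.mul_le_mul (div_nonneg hr hN0.le) hle hr2
  rw [← mul_div_assoc, div_le_iff₀ hN0] at this
  exact le_of_mul_le_mul_right (by linarith) hr0

lemma tendsto_zero (hω : IsModulus ω) : Tendsto ω (𝓝[>] 0) (𝓝 0) := by
  have h := hω.continuousOn 0 ⟨le_rfl, zero_le_two⟩
  rw [ContinuousWithinAt, hω.map_zero] at h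
  refine h.mono_left (nhdsWithin_le_of_mem ?_)
  filter_upwards [Ioc_mem_nhdsGT (show (0 : ℝ) < 2 by norm_num)] with x hx
  exact ⟨hx.1.le, hx.2⟩

lemma star_spec (hω : IsModulus ω) {x : ℝ} (h0 : 0 ≤ x) (h1 : x ≤ 1) :
    star ω x ∈ Icc (0 : ℝ) 1 ∧ ω (star ω x) = x := by
  have hc : ContinuousOn ω (Icc 0 1) :=
    hω.continuousOn.mono (Icc_subset_Icc_right one_le_two)
  have hne : {u : ℝ | u ∈ Icc (0 : ℝ) 1 ∧ ω u = x}.Nonempty := by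
    have := intermediate_value_Icc zero_le_one hc
    rw [hω.map_zero, hω.map_one] at this
    obtain ⟨u, hu, rfl⟩ := this ⟨h0, h1⟩
    exact ⟨u, hu, rfl⟩
  have hcl : IsClosed {u : ℝ | u ∈ Icc (0 : ℝ) 1 ∧ ω u = x} :=
    hc.preimage_isClosed_of_isClosed isClosed_Icc (isClosed_singleton (x := x))
  exact hcl.csInf_mem hne ⟨0, fun u hu => hu.1.1⟩

/-- The intermediate value theorem on `[0, u]` produces a preimage of `x` there, and `star` takes
the least one. -/
lemma star_le (hω : IsModulus ω) {x u : ℝ} (h0 : 0 ≤ x) (hu : u ∈ Icc (0 : ℝ) 1)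
    (hxu : x ≤ ω u) : star ω x ≤ u := by
  have hc : ContinuousOn ω (Icc 0 u) :=
    hω.continuousOn.mono (Icc_subset_Icc_right (hu.2.trans one_le_two))
  have := intermediate_value_Icc hu.1 hc
  rw [hω.map_zero] at this
  obtain ⟨y, hy, rfl⟩ := this ⟨h0, hxu⟩
  have hb : BddBelow {v : ℝ | v ∈ Icc (0 : ℝ) 1 ∧ ω v = ω y} := ⟨0, fun v hv => hv.1.1⟩
  exact (csInf_le hb ⟨⟨hy.1, hy.2.trans hu.2⟩, rfl⟩).trans hy.2

lemma star_pos (hω : IsModulus ω) {x : ℝ} (h0 : 0 < x) (h1 : x ≤ 1) : 0 < star ω x := by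
  obtain ⟨h, h'⟩ := hω.star_spec h0.le h1
  refine h.1.lt_of_ne fun h2 => ?_
  rw [← h2, hω.map_zero] at h'
  exact h0.ne h'

end IsModulus

/-! ### Seminorm bounds and pointwise bounds. -/

section Seminorm

variable {X E : Type*} [MetricSpace X] [SeminormedAddCommGroup E] {ω : ℝ → ℝ} {Γ : Set X}
  {f : X → E}

lemma norm_sub_le_of_seminorm_lt_top (hω : IsModulus ω) (hΓ : ∀ z ∈ Γ, ∀ w ∈ Γ, dist z w ≤ 2)
    (hf : seminorm ω Γ f < ⊤) {z w : X} (hz : z ∈ Γ) (hw : w ∈ Γ) :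
    ‖f z - f w‖ ≤ (seminorm ω Γ f).toReal * ω (dist z w) := by
  rcases eq_or_ne z w with rfl | hzw
  · simp [hω.map_zero]
  have hp := hω.pos (dist_pos.2 hzw) (hΓ z hz w hw)
  have h1 : ENNReal.ofReal (‖f z - f w‖ / ω (dist z w)) ≤ seminorm ω Γ f := by
    unfold seminorm
    exact le_iSup₂_of_le z hz (le_iSup₂_of_le w hw (le_iSup_of_le hzw le_rfl))
  rw [ENNReal.ofReal_le_iff_le_toReal hf.ne, div_le_iff₀ hp] at h1
  exact h1

lemma seminorm_lt_top (hω : IsModulus ω) (hΓ : ∀ z ∈ Γ, ∀ w ∈ Γ, dist z w ≤ 2) {K : ℝ}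
    (hf : ∀ z ∈ Γ, ∀ w ∈ Γ, ‖f z - f w‖ ≤ K * ω (dist z w)) : seminorm ω Γ f < ⊤ := by
  refine lt_of_le_of_lt ?_ (ENNReal.ofReal_lt_top (r := K))
  refine iSup₂_le fun z hz => iSup₂_le fun w hw => iSup_le fun hzw => ?_
  refine ENNReal.ofReal_le_ofReal ?_
  rw [div_le_iff₀ (hω.pos (dist_pos.2 hzw) (hΓ z hz w hw))]
  exact hf z hz w hw

/-- An `ω`-Lipschitz bound passes to points of the closure of the graph. -/
lemma modulus_bound_of_mem_closure_graph (hω : IsModulus ω)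
    (hΓ : ∀ z ∈ Γ, ∀ w ∈ Γ, dist z w ≤ 2) {K : ℝ} {A : Set X} (hA : A ⊆ Γ)
    (hf : ∀ z ∈ A, ∀ w ∈ A, ‖f z - f w‖ ≤ K * ω (dist z w))
    (hcl : ∀ z ∈ Γ, (z, f z) ∈ closure ((fun z => (z, f z)) '' A)) :
    ∀ z ∈ Γ, ∀ w ∈ Γ, ‖f z - f w‖ ≤ K * ω (dist z w) := by
  intro z hz w hw
  obtain ⟨p, hp, hpz⟩ := mem_closure_iff_seq_limit.1 (hcl z hz)
  obtain ⟨q, hq, hqw⟩ := mem_closure_iff_seq_limit.1 (hcl w hw)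
  choose x hxA hx using hp
  choose y hyA hy using hq
  have hpx : p = fun n => (x n, f (x n)) := funext fun n => (hx n).symm
  have hqy : q = fun n => (y n, f (y n)) := funext fun n => (hy n).symm
  subst hpx hqy
  rw [Prod.tendsto_iff] at hpz hqw
  -- The limit must be taken within `[0, 2]`, the only place where ω is known to be continuous.
  have hd : Tendsto (fun n => dist (x n) (y n)) atTop (𝓝[Icc 0 2] (dist z w)) :=
    tendsto_nhdsWithin_iff.2 ⟨hpz.1.dist hqw.1, Eventually.of_forall fun n =>
      ⟨dist_nonneg, hΓ _ (hA (hxA n)) _ (hA (hyA n))⟩⟩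
  have hω' := (hω.continuousOn _ ⟨dist_nonneg, hΓ z hz w hw⟩).tendsto.comp hd
  exact le_of_tendsto_of_tendsto' (hpz.2.sub hqw.2).norm (hω'.const_mul K)
    fun n => hf _ (hxA n) _ (hyA n)

lemma continuousOn_of_modulus_bound (hω : IsModulus ω)
    (hΓ : ∀ z ∈ Γ, ∀ w ∈ Γ, dist z w ≤ 2) {K : ℝ}
    (hf : ∀ z ∈ Γ, ∀ w ∈ Γ, ‖f z - f w‖ ≤ K * ω (dist z w)) : ContinuousOn f Γ := by
  intro w hw
  rw [ContinuousWithinAt, tendsto_iff_norm_sub_tendsto_zero]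
  have hd : Tendsto (fun z => dist z w) (𝓝[Γ] w) (𝓝[Icc 0 2] 0) := by
    refine tendsto_nhdsWithin_iff.2 ⟨?_, ?_⟩
    · have : Tendsto (fun z => dist z w) (𝓝 w) (𝓝 (dist w w)) :=
        tendsto_id.dist tendsto_const_nhds
      rw [dist_self] at this
      exact this.mono_left nhdsWithin_le_nhds
    · filter_upwards [self_mem_nhdsWithin] with z hz
      exact ⟨dist_nonneg, hΓ z hz w hw⟩
  have hω' := ((hω.continuousOn 0 ⟨le_rfl, zero_le_two⟩).tendsto.comp hd).const_mul K
  rw [hω.map_zero, mul_zero] at hω'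
  refine squeeze_zero' (Eventually.of_forall fun z => norm_nonneg _) ?_ hω'
  filter_upwards [self_mem_nhdsWithin] with z hz
  exact hf z hz w hw

end Seminorm

/-! ### Poisson integrals and a maximum principle through radial limits. -/

lemma continuous_poissonKernel_circleMap {z : ℂ} (hz : ‖z‖ < 1) :
    Continuous fun t : ℝ => poissonKernel 0 z (circleMap 0 1 t) := by
  unfold poissonKernel
  refine Continuous.div (by fun_prop) (by fun_prop) fun t => ?_
  have h : circleMap 0 1 t ≠ z := circleMap_ne_mem_ball (mem_ball_zero_iff.2 hz) t
  simpa [sub_eq_zero] using h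

lemma poissonKernel_circleMap_nonneg {z : ℂ} (hz : ‖z‖ < 1) (t : ℝ) :
    0 ≤ poissonKernel 0 z (circleMap 0 1 t) := by
  unfold poissonKernel
  have : ‖z‖ ^ 2 ≤ 1 := pow_le_one₀ (norm_nonneg _) hz.le
  refine div_nonneg ?_ (by positivity)
  simp; linarith

lemma integral_poissonKernel_circleMap {z : ℂ} (hz : ‖z‖ < 1) :
    ∫ t in (0 : ℝ)..(2 * Real.pi), poissonKernel 0 z (circleMap 0 1 t) = 2 * Real.pi := by
  have h := (diffContOnCl_const (c := (1 : ℂ)) (s := ball (0 : ℂ) 1)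
    (𝕜 := ℂ)).circleAverage_poissonKernel_smul (mem_ball_zero_iff.2 hz)
  rw [Real.circleAverage_def] at h
  simp only [Pi.smul_apply', Complex.real_smul, mul_one] at h
  rw [intervalIntegral.integral_ofReal] at h
  have h2 := congrArg Complex.re h
  rw [← Complex.ofReal_mul, Complex.ofReal_re, Complex.one_re] at h2
  field_simp at h2
  exact h2

/-- A bounded analytic function on the disk whose radial limits are almost everywhere bounded by
`M` is bounded by `M`. -/
lemma norm_le_of_radial_limits {g : ℂ → ℂ} (hg : DifferentiableOn ℂ g (ball 0 1)) {B M : ℝ}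
    (hB : ∀ z ∈ ball (0 : ℂ) 1, ‖g z‖ ≤ B)
    (hM : ∀ᵐ t : ℝ, ∃ l, Tendsto (fun r : ℝ => g (r * circleMap 0 1 t)) (𝓝[<] 1) (𝓝 l) ∧ ‖l‖ ≤ M)
    {z : ℂ} (hz : z ∈ ball (0 : ℂ) 1) : ‖g z‖ ≤ M := by
  have hz' : ‖z‖ < 1 := mem_ball_zero_iff.1 hz
  obtain ⟨l, hl⟩ := hM.choice
  set r : ℕ → ℝ := fun n => 1 - 1 / ((n : ℝ) + 2) with hr
  have hr0 : ∀ n, 0 ≤ r n := fun n => by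
    simp only [hr, sub_nonneg]
    rw [div_le_one (by positivity)]
    have : (0 : ℝ) ≤ n := n.cast_nonneg
    linarith
  have hr1 : ∀ n, r n < 1 := fun n => by
    simp only [hr, sub_lt_self_iff]; positivity
  have hrt : Tendsto r atTop (𝓝[<] 1) := by
    refine tendsto_nhdsWithin_iff.2 ⟨?_, Eventually.of_forall hr1⟩
    have h1 : Tendsto (fun n : ℕ => 1 / ((n : ℝ) + 2)) atTop (𝓝 0) :=
      tendsto_const_nhds.div_atTop (tendsto_atTop_add_const_right _ _ tendsto_natCast_atTop_atTop)
    simpa [hr] using h1.const_sub 1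
  have hmem : ∀ n, ∀ w ∈ closedBall (0 : ℂ) 1, (r n : ℂ) * w ∈ ball (0 : ℂ) 1 := fun n w hw => by
    rw [mem_ball_zero_iff, norm_mul, Complex.norm_real, Real.norm_of_nonneg (hr0 n)]
    rw [mem_closedBall_zero_iff] at hw
    nlinarith [hr0 n, hr1 n]
  -- The dilates w ↦ g(r_n w) are analytic up to the circle, so the Poisson formula holds for them.
  -- Dominated convergence with the constant `B` then carries it over to the radial limits.
  have hd : ∀ n, DiffContOnCl ℂ (fun w => g (r n * w)) (ball 0 1) := fun n => by
    refine DifferentiableOn.diffContOnCl_ball (U := closedBall (0 : ℂ) 1) ?_ Subset.rfl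
    exact hg.comp (by fun_prop) (hmem n)
  have hP : ∀ n, (2 * Real.pi)⁻¹ • ∫ t in (0 : ℝ)..(2 * Real.pi),
      poissonKernel 0 z (circleMap 0 1 t) • g (r n * circleMap 0 1 t) = g (r n * z) := fun n => by
    rw [← (hd n).circleAverage_poissonKernel_smul hz, Real.circleAverage_def]
    rfl
  have hlim1 : Tendsto (fun n => g (r n * z)) atTop (𝓝 (g z)) := by
    have h1 : Tendsto (fun n => (r n : ℂ) * z) atTop (𝓝 z) := by
      have := ((Complex.continuous_ofReal.tendsto 1).comp
        (tendsto_nhds_of_tendsto_nhdsWithin hrt)).mul_const z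
      simpa using this
    exact ((hg.differentiableAt (isOpen_ball.mem_nhds hz)).continuousAt.tendsto).comp h1
  have hcP := continuous_poissonKernel_circleMap hz'
  have hlim2 : Tendsto (fun n => ∫ t in (0 : ℝ)..(2 * Real.pi),
      poissonKernel 0 z (circleMap 0 1 t) • g (r n * circleMap 0 1 t)) atTop
      (𝓝 (∫ t in (0 : ℝ)..(2 * Real.pi), poissonKernel 0 z (circleMap 0 1 t) • l t)) := by
    refine intervalIntegral.tendsto_integral_filter_of_dominated_convergence
      (fun t => poissonKernel 0 z (circleMap 0 1 t) * B) ?_ ?_ ?_ ?_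
    · refine Eventually.of_forall fun n => Continuous.aestronglyMeasurable ?_
      refine hcP.smul ?_
      refine hg.continuousOn.comp_continuous (by fun_prop) fun t => hmem n _ ?_
      simp
    · refine Eventually.of_forall fun n => Eventually.of_forall fun t _ => ?_
      rw [norm_smul, Real.norm_of_nonneg (poissonKernel_circleMap_nonneg hz' t)]
      exact mul_le_mul_of_nonneg_left (hB _ (hmem n _ (by simp)))
        (poissonKernel_circleMap_nonneg hz' t)
    · exact (hcP.mul continuous_const).intervalIntegrable _ _
    · filter_upwards [hl] with t ht _
      exact (ht.1.comp hrt).const_smul _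
  have heq : g z = (2 * Real.pi)⁻¹ • ∫ t in (0 : ℝ)..(2 * Real.pi),
      poissonKernel 0 z (circleMap 0 1 t) • l t := by
    refine tendsto_nhds_unique hlim1 ?_
    simp_rw [← hP]
    exact hlim2.const_smul _
  have hbd : ‖∫ t in (0 : ℝ)..(2 * Real.pi), poissonKernel 0 z (circleMap 0 1 t) • l t‖ ≤
      ∫ t in (0 : ℝ)..(2 * Real.pi), poissonKernel 0 z (circleMap 0 1 t) * M := by
    refine intervalIntegral.norm_integral_le_of_norm_le (by positivity) ?_
      ((hcP.mul continuous_const).intervalIntegrable _ _)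
    filter_upwards [hl] with t ht _
    rw [norm_smul, Real.norm_of_nonneg (poissonKernel_circleMap_nonneg hz' t)]
    exact mul_le_mul_of_nonneg_left ht.2 (poissonKernel_circleMap_nonneg hz' t)
  rw [intervalIntegral.integral_mul_const, integral_poissonKernel_circleMap hz'] at hbd
  rw [heq, norm_smul, norm_inv, Real.norm_of_nonneg (by positivity), inv_mul_le_iff₀ (by positivity)]
  exact hbd

/-! ### From the circle to the disk. -/

section Extension

variable {ω : ℝ → ℝ} {F : ℂ → ℂ} {S : Set ℂ} {B : ℝ}

/-- Apply the maximum principle to (F - b)/(p - z), whose pole p lies at distance at least t outside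
the disk. Since ω grows at most linearly beyond t, |F(ξ) - b| ≤ Kω(t)(1 + |ξ-w|/t), and t + |ξ-w| ≤
4|p-ξ|; so the quotient is at most 4Kω(t)/t on the circle. At z the denominator is at most 3t,
whence 12 = 4·3. -/
lemma norm_sub_le_of_boundary_bound (hω : IsModulus ω) (hF : DifferentiableOn ℂ F (ball 0 1))
    (hB : ∀ z ∈ ball (0 : ℂ) 1, ‖F z‖ ≤ B) (hS1 : S ⊆ sphere 0 1)
    (hS : ∀ᵐ t : ℝ, circleMap 0 1 t ∈ S)
    (hrad : ∀ ξ ∈ S, Tendsto (fun r : ℝ => F (r * ξ)) (𝓝[<] 1) (𝓝 (F ξ)))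
    {K t : ℝ} (hK : 0 ≤ K) (ht : 0 < t) (ht2 : t ≤ 2) {b w p : ℂ} (hw : ‖w‖ ≤ 1)
    (hpw : ‖p - w‖ ≤ 2 * t) (hp : 1 + t ≤ ‖p‖)
    (hb : ∀ ξ ∈ S, ‖F ξ - b‖ ≤ K * ω (dist ξ w)) {z : ℂ} (hz : z ∈ ball (0 : ℂ) 1)
    (hzw : dist z w ≤ t) : ‖F z - b‖ ≤ 12 * K * ω t := by
  have hpz : ∀ x : ℂ, ‖x‖ ≤ 1 → t ≤ ‖p - x‖ := fun x hx => by
    have := norm_sub_norm_le p x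
    linarith
  have hωt := hω.pos ht ht2
  have hne : ∀ x : ℂ, ‖x‖ ≤ 1 → p - x ≠ 0 := fun x hx => by
    rw [← norm_pos_iff]; exact ht.trans_le (hpz x hx)
  have hz1 : ‖z‖ < 1 := mem_ball_zero_iff.1 hz
  have key : ‖(F z - b) / (p - z)‖ ≤ 4 * K * ω t / t := by
    refine norm_le_of_radial_limits (g := fun z => (F z - b) / (p - z)) (B := (B + ‖b‖) / t)
      ?_ ?_ ?_ hz
    · refine DifferentiableOn.div (by fun_prop) (by fun_prop) fun x hx => hne x ?_
      exact (mem_ball_zero_iff.1 hx).le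
    · intro x hx
      rw [norm_div]
      have h1 := hB x hx
      have h2 := norm_sub_le (F x) b
      exact div_le_div₀ (by linarith [norm_nonneg (F x), norm_nonneg b]) (by linarith) ht
        (hpz x (mem_ball_zero_iff.1 hx).le)
    · filter_upwards [hS] with s hs
      set ξ := circleMap 0 1 s
      have hξ : ‖ξ‖ = 1 := mem_sphere_zero_iff_norm.1 (hS1 hs)
      refine ⟨(F ξ - b) / (p - ξ), ?_, ?_⟩
      · refine ((hrad ξ hs).sub_const b).div ?_ (hne ξ hξ.le)
        have hc : Continuous fun r : ℝ => p - (r : ℂ) * ξ := by fun_prop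
        have := hc.tendsto 1
        simp only [Complex.ofReal_one, one_mul] at this
        exact this.mono_left nhdsWithin_le_nhds
      · have hq := hpz ξ hξ.le
        have hx2 : dist ξ w ≤ 2 := by
          rw [dist_eq_norm]; linarith [norm_sub_le ξ w]
        have h1 := hω.le_mul_one_add dist_nonneg hx2 ht ht2
        have h3 : dist ξ w ≤ ‖p - ξ‖ + 2 * t := by
          rw [dist_eq_norm, show ξ - w = (p - w) - (p - ξ) by ring]
          linarith [norm_sub_le (p - w) (p - ξ)]
        rw [norm_div, div_le_div_iff₀ (ht.trans_le hq) ht]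
        calc ‖F ξ - b‖ * t ≤ K * (ω t * (1 + dist ξ w / t)) * t := by
              gcongr; exact (hb ξ hs).trans (by gcongr)
          _ = K * ω t * (t + dist ξ w) := by field_simp
          _ ≤ K * ω t * (4 * ‖p - ξ‖) := by gcongr; linarith
          _ = 4 * K * ω t * ‖p - ξ‖ := by ring
  have h3 : ‖p - z‖ ≤ 3 * t := by
    rw [show p - z = (p - w) - (z - w) by ring]
    rw [dist_eq_norm] at hzw
    linarith [norm_sub_le (p - w) (z - w)]
  rw [norm_div, div_le_div_iff₀ (ht.trans_le (hpz z hz1.le)) ht] at key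
  refine le_of_mul_le_mul_right (key.trans ?_) ht
  calc 4 * K * ω t * ‖p - z‖ ≤ 4 * K * ω t * (3 * t) := by gcongr
    _ = 12 * K * ω t * t := by ring

lemma exists_unit_mul_norm (w : ℂ) : ∃ e : ℂ, ‖e‖ = 1 ∧ w = ‖w‖ * e := by
  refine ⟨Complex.exp (w.arg * Complex.I), Complex.norm_exp_ofReal_mul_I _, ?_⟩
  exact (Complex.norm_mul_exp_arg_mul_I w).symm

/-- A bounded analytic function which is `ω`-Lipschitz on a subset of full measure of the circle,
where its values are its radial limits, is `ω`-Lipschitz on the disk. -/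
theorem modulus_bound_ball_of_boundary (hω : IsModulus ω) (hF : DifferentiableOn ℂ F (ball 0 1))
    (hB : ∀ z ∈ ball (0 : ℂ) 1, ‖F z‖ ≤ B) (hS1 : S ⊆ sphere 0 1)
    (hS : ∀ᵐ t : ℝ, circleMap 0 1 t ∈ S)
    (hrad : ∀ ξ ∈ S, Tendsto (fun r : ℝ => F (r * ξ)) (𝓝[<] 1) (𝓝 (F ξ)))
    {K : ℝ} (hK : 0 ≤ K) (hlip : ∀ ξ ∈ S, ∀ ζ ∈ S, ‖F ξ - F ζ‖ ≤ K * ω (dist ξ ζ)) :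
    ∀ z ∈ ball (0 : ℂ) 1, ∀ w ∈ ball (0 : ℂ) 1, ‖F z - F w‖ ≤ 144 * K * ω (dist z w) := by
  have hmix : ∀ ζ ∈ S, ∀ z ∈ ball (0 : ℂ) 1, ‖F z - F ζ‖ ≤ 12 * K * ω (dist z ζ) := by
    intro ζ hζ z hz
    have hζ1 : ‖ζ‖ = 1 := mem_sphere_zero_iff_norm.1 (hS1 hζ)
    have hz1 := mem_ball_zero_iff.1 hz
    have ht : 0 < dist z ζ := by
      rw [dist_pos]; rintro rfl; linarith
    have ht2 : dist z ζ ≤ 2 := by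
      rw [dist_eq_norm]; linarith [norm_sub_le z ζ]
    refine norm_sub_le_of_boundary_bound hω hF hB hS1 hS hrad hK ht ht2 (w := ζ)
      (p := ζ + (dist z ζ : ℝ) * ζ) hζ1.le ?_ ?_ (fun ξ hξ => hlip ξ hξ ζ hζ) hz le_rfl
    · simp [hζ1, abs_of_pos ht]
      linarith
    · rw [show ζ + (dist z ζ : ℝ) * ζ = ((1 + dist z ζ : ℝ) : ℂ) * ζ by push_cast; ring]
      rw [norm_mul, Complex.norm_real, hζ1, mul_one]
      exact le_abs_self _
  intro z hz w hw
  have hw1 := mem_ball_zero_iff.1 hw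
  have hz1 := mem_ball_zero_iff.1 hz
  rcases eq_or_ne z w with rfl | hne
  · simp [hω.map_zero]
  have ht : 0 < dist z w := dist_pos.2 hne
  have ht2 : dist z w ≤ 2 := by
    rw [dist_eq_norm]; linarith [norm_sub_le z w]
  obtain ⟨e, he, hwe⟩ := exists_unit_mul_norm w
  -- The same argument with the mixed bound as boundary data, whence 144 = 12·12. The pole w + 2s e
  -- lies radially beyond w, and 1 - |w| ≤ s gives it norm at least 1 + s.
  have far : ∀ s : ℝ, 0 < s → s ≤ 2 → 1 - ‖w‖ ≤ s → ∀ x ∈ ball (0 : ℂ) 1, dist x w ≤ s →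
      ‖F x - F w‖ ≤ 144 * K * ω s := by
    intro s hs hs2 hws x hx hxw
    have := norm_sub_le_of_boundary_bound hω hF hB hS1 hS hrad (K := 12 * K) (by positivity) hs hs2
      (b := F w) (w := w) (p := w + ((2 * s : ℝ) : ℂ) * e) hw1.le ?_ ?_
      (fun ξ hξ => ?_) hx hxw
    · linarith
    · rw [add_sub_cancel_left, norm_mul, he, Complex.norm_real, mul_one,
        Real.norm_of_nonneg (by positivity)]
    · nth_rewrite 1 [hwe]
      rw [← add_mul, norm_mul, he, mul_one, ← Complex.ofReal_add, Complex.norm_real]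
      exact le_trans (by linarith) (le_abs_self _)
    · rw [norm_sub_rev, dist_comm]; exact hmix ξ hξ w hw
  rcases le_total (1 - ‖w‖) (dist z w) with h | h
  · exact far _ ht ht2 h z hz le_rfl
  · rcases h.eq_or_lt with h | h
    · exact far _ ht ht2 h.ge z hz le_rfl
    set d := 1 - ‖w‖
    have hd : 0 < d := ht.trans h
    have hd2 : d ≤ 2 := by simp only [d]; linarith [norm_nonneg w]
    have hsub : ball w d ⊆ ball (0 : ℂ) 1 := by
      refine ball_subset_ball' ?_
      simp [d]
    have hmaps : MapsTo F (ball w d) (closedBall (F w) (144 * K * ω d)) := fun x hx => by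
      rw [mem_closedBall, dist_eq_norm]
      exact far d hd hd2 le_rfl x (hsub hx) (mem_ball.1 hx).le
    -- For points closer to each other than w is to the circle, the Schwarz lemma on the disk of
    -- radius d about w gives the slope 144Kω(d)/d, and ω(d)/d ≤ ω(t)/t for t ≤ d.
    have hS := Complex.dist_le_div_mul_dist_of_mapsTo_ball (hF.mono hsub) hmaps (mem_ball.2 h)
    rw [dist_eq_norm (F z)] at hS
    refine hS.trans ?_
    have := hω.mul_le_mul ht.le h.le hd2
    rw [div_mul_eq_mul_div, div_le_iff₀ hd]
    nlinarith

end Extension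

/-! ### The chordal distance. -/

/-- The chordal distance between two points of the circle whose arguments differ by `t`. -/
def chord (t : ℝ) : ℝ := ‖Complex.exp (t * Complex.I) - 1‖

lemma chord_nonneg (t : ℝ) : 0 ≤ chord t := norm_nonneg _

lemma chord_eq (t : ℝ) : chord t = 2 * |Real.sin (t / 2)| := by
  rw [chord, mul_comm, Complex.norm_exp_I_mul_ofReal_sub_one]
  simp

lemma chord_neg (t : ℝ) : chord (-t) = chord t := by
  simp [chord_eq, neg_div]

lemma chord_sq (t : ℝ) : chord t ^ 2 = 2 - 2 * Real.cos t := by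
  rw [chord_eq, mul_pow, sq_abs, Real.sin_sq_eq_half_sub, mul_div_cancel₀ t two_ne_zero]
  ring

lemma chord_le_abs (t : ℝ) : chord t ≤ |t| := by
  rw [chord_eq]
  have := Real.abs_sin_le_abs (x := t / 2)
  rw [abs_div, abs_two] at this
  linarith

lemma chord_le_two (t : ℝ) : chord t ≤ 2 := by
  rw [chord_eq]; linarith [Real.abs_sin_le_one (t / 2)]

/-- Jordan's inequality for the sine, with 2/π weakened to 1/2. -/
lemma abs_le_two_mul_chord {t : ℝ} (ht : |t| ≤ Real.pi) : |t| ≤ 2 * chord t := by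
  have h := Real.mul_abs_le_abs_sin (x := t / 2) (by rw [abs_div, abs_two]; linarith)
  rw [chord_eq]
  rw [abs_div, abs_two] at h
  have h4 : 1 / 2 ≤ 2 / Real.pi := by
    rw [div_le_div_iff₀ two_pos Real.pi_pos]; linarith [Real.pi_le_four]
  have : 1 / 2 * (|t| / 2) ≤ 2 / Real.pi * (|t| / 2) := by gcongr
  linarith

lemma chord_pos {t : ℝ} (ht : |t| ≤ Real.pi) (h0 : t ≠ 0) : 0 < chord t := by
  linarith [abs_le_two_mul_chord ht, abs_pos.2 h0]

@[fun_prop]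
lemma continuous_chord : Continuous chord := by
  unfold chord; fun_prop

lemma chord_periodic : Function.Periodic chord (2 * Real.pi) := fun t => by
  simp only [chord]
  congr 2
  push_cast
  rw [add_mul, Complex.exp_add, Complex.exp_two_pi_mul_I, mul_one]

lemma norm_exp_sub_exp (a b : ℝ) :
    ‖Complex.exp (a * Complex.I) - Complex.exp (b * Complex.I)‖ = chord (a - b) := by
  have : Complex.exp (a * Complex.I) - Complex.exp (b * Complex.I) =
      Complex.exp (b * Complex.I) * (Complex.exp ((a - b : ℝ) * Complex.I) - 1) := by
    rw [mul_sub, ← Complex.exp_add, mul_one]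
    congr 2
    push_cast
    ring
  rw [this, norm_mul, Complex.norm_exp_ofReal_mul_I, one_mul, chord]

lemma circle_dist_eq (ξ ζ : Circle) : dist ξ ζ = ‖(ξ : ℂ) - ζ‖ := by
  rw [← dist_eq_norm]; exact rfl

lemma dist_circleExp (a b : ℝ) : dist (Circle.exp a) (Circle.exp b) = chord (a - b) := by
  rw [← norm_exp_sub_exp, circle_dist_eq, Circle.coe_exp, Circle.coe_exp]

lemma chord_add_le (a b : ℝ) : chord (a + b) ≤ chord a + chord b := by
  have h := dist_triangle (Circle.exp (a + b)) (Circle.exp b) (Circle.exp 0)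
  simpa only [dist_circleExp, sub_zero, add_sub_cancel_right] using h

lemma dist_circle_le_two (ξ ζ : Circle) : dist ξ ζ ≤ 2 := by
  rw [circle_dist_eq]
  have := norm_sub_le (ξ : ℂ) ζ
  rw [Circle.norm_coe, Circle.norm_coe] at this
  linarith

/-! ### The Herglotz kernel. -/

/-- The Herglotz kernel `(ξ + w) / (ξ - w)` at `ξ = e^{it}`. -/
def herglotz (w : ℂ) (t : ℝ) : ℂ :=
  (Complex.exp (t * Complex.I) + w) / (Complex.exp (t * Complex.I) - w)

lemma exp_sub_ne_zero {w : ℂ} (hw : ‖w‖ < 1) (t : ℝ) : Complex.exp (t * Complex.I) - w ≠ 0 := by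
  intro h
  have := Complex.norm_exp_ofReal_mul_I t
  rw [sub_eq_zero.1 h] at this
  exact hw.ne this

lemma continuous_herglotz {w : ℂ} (hw : ‖w‖ < 1) : Continuous (herglotz w) := by
  unfold herglotz
  exact Continuous.div (by fun_prop) (by fun_prop) fun t => exp_sub_ne_zero hw t

lemma herglotz_periodic (w : ℂ) : Function.Periodic (herglotz w) (2 * Real.pi) := fun t => by
  simp only [herglotz]
  push_cast
  rw [add_mul, Complex.exp_add, Complex.exp_two_pi_mul_I, mul_one]

/-- The kernel is 2ξ/(ξ-w) - 1, and Cauchy's formula for the constant 1 evaluates the mean of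
ξ/(ξ-w). -/
lemma integral_herglotz {w : ℂ} (hw : ‖w‖ < 1) :
    ∫ t in (-Real.pi)..Real.pi, herglotz w t = 2 * Real.pi := by
  have h := (diffContOnCl_const (c := (1 : ℂ)) (s := ball (0 : ℂ) |1|)
    (𝕜 := ℂ)).circleAverage_smul_div (w := w) (by simpa using hw)
  rw [Real.circleAverage_def, inv_smul_eq_iff₀ (by positivity)] at h
  have e : (-Real.pi) + 2 * Real.pi = Real.pi := by ring
  have h2 := (herglotz_periodic w).intervalIntegral_add_eq (-Real.pi) 0
  rw [e, zero_add] at h2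
  have hc : Continuous fun t : ℝ =>
      Complex.exp (t * Complex.I) / (Complex.exp (t * Complex.I) - w) :=
    Continuous.div (by fun_prop) (by fun_prop) fun t => exp_sub_ne_zero hw t
  have h3 : ∀ t, herglotz w t =
      2 * (Complex.exp (t * Complex.I) / (Complex.exp (t * Complex.I) - w)) - 1 := fun t => by
    have := exp_sub_ne_zero hw t
    rw [herglotz]
    field_simp
    ring
  simp only [circleMap, zero_add, sub_zero, Complex.ofReal_one, one_mul, smul_eq_mul, mul_one,
    Complex.real_smul] at h
  rw [h2]
  simp_rw [h3]
  rw [intervalIntegral.integral_sub ((hc.const_mul 2).intervalIntegrable _ _) (by simp),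
    intervalIntegral.integral_const_mul, h]
  simp
  ring

lemma herglotz_re {w : ℂ} (t : ℝ) :
    (herglotz w t).re = (1 - ‖w‖ ^ 2) / ‖Complex.exp (t * Complex.I) - w‖ ^ 2 := by
  have h := congrFun (poissonKernel_eq_re_herglotzRieszKernel (c := 0) (w := w))
    (Complex.exp (t * Complex.I))
  rw [poissonKernel_def, Function.comp_apply, herglotzRieszKernel_def] at h
  simp only [sub_zero, Complex.norm_exp_ofReal_mul_I, one_pow] at h
  rw [h, herglotz]

lemma herglotz_rotate (w : ℂ) (θ t : ℝ) :
    ((Circle.exp (θ + t) : ℂ) + Circle.exp θ * w) / ((Circle.exp (θ + t) : ℂ) - Circle.exp θ * w) =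
      herglotz w t := by
  have h : (Circle.exp (θ + t) : ℂ) = Circle.exp θ * Complex.exp (t * Complex.I) := by
    rw [Circle.exp_add, Circle.coe_mul, Circle.coe_exp t]
  rw [h, ← mul_add, ← mul_sub, mul_div_mul_left _ _ (Circle.coe_ne_zero _), herglotz]

/-! ### Herglotz integrals of log h, recentred at a boundary point. -/

section LogIntegrable

variable {h : Circle → ℝ}

/-- The deviation of `log h` from its value at `e^{iθ}`. -/
def logDev (h : Circle → ℝ) (θ t : ℝ) : ℝ :=
  Real.log (h (Circle.exp (θ + t))) - Real.log (h (Circle.exp θ))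

lemma circleExp_add_two_pi (t : ℝ) : Circle.exp (t + 2 * Real.pi) = Circle.exp t :=
  Circle.periodic_exp t

lemma logDev_periodic (h : Circle → ℝ) (θ : ℝ) :
    Function.Periodic (logDev h θ) (2 * Real.pi) := fun t => by
  simp only [logDev, ← add_assoc, circleExp_add_two_pi]

namespace LogIntegrable

lemma intervalIntegrable (hlog : LogIntegrable h) (a b : ℝ) :
    IntervalIntegrable (fun t => Real.log (h (Circle.exp t))) volume a b := by
  have hp : Function.Periodic (fun t => Real.log (h (Circle.exp t))) (2 * Real.pi) := fun t => by
    simp only [circleExp_add_two_pi]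
  exact hp.intervalIntegrable (t := 0) (by positivity) (by simpa using hlog.2) a b

lemma intervalIntegrable_shift (hlog : LogIntegrable h) (θ a b : ℝ) :
    IntervalIntegrable (fun t => Real.log (h (Circle.exp (θ + t)))) volume a b := by
  have := (hlog.intervalIntegrable (θ + a) (θ + b)).comp_add_left θ
  simpa using this

lemma logDev (hlog : LogIntegrable h) (θ a b : ℝ) :
    IntervalIntegrable (logDev h θ) volume a b :=
  (hlog.intervalIntegrable_shift θ a b).sub intervalIntegrable_const

lemma ae_ne_zero (hlog : LogIntegrable h) (θ : ℝ) : ∀ᵐ t : ℝ, h (Circle.exp (θ + t)) ≠ 0 :=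
  (measurePreserving_add_left volume θ).quasiMeasurePreserving.ae hlog.1

/-- Rotating the variable by θ turns the kernel at e^{iθ}w into the kernel at w; the constant log
h(e^{iθ}) splits off with the total mass 2π. All later estimates therefore involve only deviations
from the value at e^{iθ}. -/
lemma integral_herglotz_mul (hlog : LogIntegrable h) {w : ℂ} (hw : ‖w‖ < 1) (θ : ℝ) :
    ∫ t in (0 : ℝ)..(2 * Real.pi), ((Circle.exp t : ℂ) + Circle.exp θ * w) /
      ((Circle.exp t : ℂ) - Circle.exp θ * w) * (Real.log (h (Circle.exp t)) : ℂ) =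
    2 * Real.pi * Real.log (h (Circle.exp θ)) +
      ∫ t in (-Real.pi)..Real.pi, herglotz w t * (OuterLip.logDev h θ t : ℂ) := by
  set P : ℝ → ℂ := fun t => ((Circle.exp t : ℂ) + Circle.exp θ * w) /
      ((Circle.exp t : ℂ) - Circle.exp θ * w) * (Real.log (h (Circle.exp t)) : ℂ) with hP
  have hper : Function.Periodic P (2 * Real.pi) := fun t => by
    simp only [hP, circleExp_add_two_pi]
  have h1 := hper.intervalIntegral_add_eq 0 (θ + -Real.pi)
  rw [zero_add, show θ + -Real.pi + 2 * Real.pi = θ + Real.pi by ring,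
    ← intervalIntegral.integral_comp_add_left] at h1
  rw [h1]
  have h2 : ∀ t, P (θ + t) = herglotz w t * (Real.log (h (Circle.exp θ)) : ℂ) +
      herglotz w t * (OuterLip.logDev h θ t : ℂ) := fun t => by
    simp only [hP, herglotz_rotate, OuterLip.logDev]
    push_cast
    ring
  simp_rw [h2]
  have hc := continuous_herglotz hw
  have hi : IntervalIntegrable (fun t => (OuterLip.logDev h θ t : ℂ)) volume
      (-Real.pi) Real.pi := by
    have := hlog.logDev θ (-Real.pi) Real.pi
    rw [intervalIntegrable_iff] at this ⊢
    exact this.ofReal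
  rw [intervalIntegral.integral_add
    (f := fun t => herglotz w t * (Real.log (h (Circle.exp θ)) : ℂ))
    ((hc.mul continuous_const).intervalIntegrable _ _)
    (hi.continuousOn_mul hc.continuousOn), intervalIntegral.integral_mul_const,
    integral_herglotz hw]

lemma intervalIntegrable_herglotz_mul (hlog : LogIntegrable h) {w : ℂ} (hw : ‖w‖ < 1)
    (θ a b : ℝ) :
    IntervalIntegrable (fun t => herglotz w t * (OuterLip.logDev h θ t : ℂ)) volume a b := by
  have := hlog.logDev θ a b
  have hi : IntervalIntegrable (fun t => (OuterLip.logDev h θ t : ℂ)) volume a b := by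
    rw [intervalIntegrable_iff] at this ⊢
    exact this.ofReal
  exact hi.continuousOn_mul (continuous_herglotz hw).continuousOn

lemma intervalIntegrable_kernel_mul (hlog : LogIntegrable h) {z : ℂ} (hz : ‖z‖ < 1) (a b : ℝ) :
    IntervalIntegrable (fun t => ((Circle.exp t : ℂ) + z) / ((Circle.exp t : ℂ) - z) *
      (Real.log (h (Circle.exp t)) : ℂ)) volume a b := by
  have := hlog.intervalIntegrable a b
  have hi : IntervalIntegrable (fun t => (Real.log (h (Circle.exp t)) : ℂ)) volume a b := by
    rw [intervalIntegrable_iff] at this ⊢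
    exact this.ofReal
  refine hi.continuousOn_mul ?_
  simp only [Circle.coe_exp]
  exact (continuous_herglotz hz).continuousOn

/-- `u_h + i v_h` is the Herglotz integral of `log h`. -/
lemma u_add_I_mul_v (hlog : LogIntegrable h) {z : ℂ} (hz : ‖z‖ < 1) :
    (u h z : ℂ) + Complex.I * v h z = 1 / (2 * Real.pi) *
      ∫ t in (0 : ℝ)..(2 * Real.pi), ((Circle.exp t : ℂ) + z) / ((Circle.exp t : ℂ) - z) *
        (Real.log (h (Circle.exp t)) : ℂ) := by
  have hi := hlog.intervalIntegrable_kernel_mul hz 0 (2 * Real.pi)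
  have hre := Complex.reCLM.intervalIntegral_comp_comm hi
  have him := Complex.imCLM.intervalIntegral_comp_comm hi
  simp only [Complex.reCLM_apply, Complex.imCLM_apply, Complex.re_mul_ofReal,
    Complex.im_mul_ofReal] at hre him
  rw [u, v, hre, him]
  generalize (∫ t in (0 : ℝ)..(2 * Real.pi), ((Circle.exp t : ℂ) + z) /
    ((Circle.exp t : ℂ) - z) * (Real.log (h (Circle.exp t)) : ℂ)) = J
  conv_rhs => rw [← Complex.re_add_im J]
  push_cast
  ring

lemma u_add_I_mul_v_rotate (hlog : LogIntegrable h) {w : ℂ} (hw : ‖w‖ < 1) (θ : ℝ) :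
    (u h (Circle.exp θ * w) : ℂ) + Complex.I * v h (Circle.exp θ * w) =
      Real.log (h (Circle.exp θ)) + 1 / (2 * Real.pi) *
        ∫ t in (-Real.pi)..Real.pi, herglotz w t * (OuterLip.logDev h θ t : ℂ) := by
  rw [hlog.u_add_I_mul_v (by simpa using hw), hlog.integral_herglotz_mul hw θ]
  have : (Real.pi : ℂ) ≠ 0 := by simp [Real.pi_ne_zero]
  field_simp

lemma u_rotate (hlog : LogIntegrable h) {w : ℂ} (hw : ‖w‖ < 1) (θ : ℝ) :
    u h (Circle.exp θ * w) = Real.log (h (Circle.exp θ)) + 1 / (2 * Real.pi) *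
        ∫ t in (-Real.pi)..Real.pi, (herglotz w t).re * OuterLip.logDev h θ t := by
  have h1 := congrArg Complex.re (hlog.u_add_I_mul_v_rotate hw θ)
  have hre := Complex.reCLM.intervalIntegral_comp_comm
    (hlog.intervalIntegrable_herglotz_mul hw θ (-Real.pi) Real.pi)
  simp only [Complex.reCLM_apply, Complex.re_mul_ofReal] at hre
  rw [hre]
  rw [show (1 / (2 * Real.pi) : ℂ) = ((1 / (2 * Real.pi) : ℝ) : ℂ) by push_cast; rfl] at h1
  simpa using h1

/-- No constant term survives here, because the total mass of the Herglotz kernel is real. -/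
lemma v_rotate (hlog : LogIntegrable h) {w : ℂ} (hw : ‖w‖ < 1) (θ : ℝ) :
    v h (Circle.exp θ * w) = 1 / (2 * Real.pi) *
        ∫ t in (-Real.pi)..Real.pi, (herglotz w t).im * OuterLip.logDev h θ t := by
  have h1 := congrArg Complex.im (hlog.u_add_I_mul_v_rotate hw θ)
  have him := Complex.imCLM.intervalIntegral_comp_comm
    (hlog.intervalIntegrable_herglotz_mul hw θ (-Real.pi) Real.pi)
  simp only [Complex.imCLM_apply, Complex.im_mul_ofReal] at him
  rw [him]
  rw [show (1 / (2 * Real.pi) : ℂ) = ((1 / (2 * Real.pi) : ℝ) : ℂ) by push_cast; rfl] at h1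
  simpa using h1

lemma differentiableOn (hlog : LogIntegrable h) :
    DifferentiableOn ℂ (fun z => (u h z : ℂ) + Complex.I * v h z) (ball 0 1) := by
  set G : ℂ → ℂ := fun ζ => (Real.log (h (Circle.exp ζ.arg)) : ℂ) with hG
  have hGt : ∀ t : ℝ, G (circleMap 0 1 t) = (Real.log (h (Circle.exp t)) : ℂ) := fun t => by
    have : circleMap 0 1 t = (Circle.exp t : ℂ) := by simp [circleMap]
    simp only [hG, this, Circle.exp_arg]
  have hGi : CircleIntegrable G 0 1 := by
    have := hlog.intervalIntegrable 0 (2 * Real.pi)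
    simp only [CircleIntegrable, hGt]
    rw [intervalIntegrable_iff] at this ⊢
    exact this.ofReal
  refine (differentiableOn_circleAverage_herglotzRieszKernel_smul hGi).congr fun z hz => ?_
  rw [hlog.u_add_I_mul_v (mem_ball_zero_iff.1 hz), Real.circleAverage_def]
  simp only [hGt, herglotzRieszKernel_def, sub_zero, smul_eq_mul, Complex.real_smul]
  simp [circleMap]

end LogIntegrable

end LogIntegrable

/-! ### Elementary bounds for logarithms and kernels. -/

lemma abs_log_le_two_mul {x : ℝ} (hx : 1 / 2 ≤ x) : |Real.log x| ≤ 2 * |x - 1| := by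
  have h0 : 0 < x := by linarith
  have h1 := Real.log_le_sub_one_of_pos h0
  have h2 := Real.one_sub_inv_le_log_of_pos h0
  have h3 : -(2 * |x - 1|) ≤ 1 - x⁻¹ := by
    have : 1 - x⁻¹ = (x - 1) / x := by field_simp
    rw [this, le_div_iff₀ h0]
    rcases abs_cases (x - 1) with ⟨h, _⟩ | ⟨h, _⟩ <;> rw [h] <;> nlinarith
  rw [abs_le]
  exact ⟨by linarith, by linarith [le_abs_self (x - 1), abs_nonneg (x - 1)]⟩

lemma abs_log_le_four_mul {x : ℝ} (hx : 1 / 4 ≤ x) : |Real.log x| ≤ 4 * |x - 1| := by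
  have h0 : 0 < x := by linarith
  have h1 := Real.log_le_sub_one_of_pos h0
  have h2 := Real.one_sub_inv_le_log_of_pos h0
  have h3 : -(4 * |x - 1|) ≤ 1 - x⁻¹ := by
    have : 1 - x⁻¹ = (x - 1) / x := by field_simp
    rw [this, le_div_iff₀ h0]
    rcases abs_cases (x - 1) with ⟨h, _⟩ | ⟨h, _⟩ <;> rw [h] <;> nlinarith
  rw [abs_le]
  exact ⟨by linarith, by linarith [le_abs_self (x - 1), abs_nonneg (x - 1)]⟩

lemma integral_neg_pos_eq {f : ℝ → ℝ} {b : ℝ} (hb : 0 ≤ b)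
    (hf : IntervalIntegrable f volume (-b) b) :
    ∫ t in (-b)..b, f t = ∫ t in (0 : ℝ)..b, (f t + f (-t)) := by
  have h1 : IntervalIntegrable f volume (-b) 0 :=
    hf.mono_set (by rw [uIcc_of_le (by linarith), uIcc_of_le (by linarith)]
                    exact Icc_subset_Icc_right hb)
  have h2 : IntervalIntegrable f volume 0 b :=
    hf.mono_set (by rw [uIcc_of_le (by linarith), uIcc_of_le (by linarith)]
                    exact Icc_subset_Icc_left (by linarith))
  have h3 : IntervalIntegrable (fun t => f (-t)) volume 0 b := by
    have := (h1.comp_mul_left (c := -1))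
    simpa using this.symm
  rw [intervalIntegral.integral_add h2 h3, intervalIntegral.integral_comp_neg, neg_zero,
    add_comm, intervalIntegral.integral_add_adjacent_intervals h1 h2]

lemma intervalIntegrable_fold {f : ℝ → ℝ} {b : ℝ} (hb : 0 ≤ b)
    (hf : IntervalIntegrable f volume (-b) b) :
    IntervalIntegrable f volume 0 b ∧ IntervalIntegrable (fun t => f (-t)) volume 0 b := by
  have h1 : IntervalIntegrable f volume (-b) 0 :=
    hf.mono_set (by rw [uIcc_of_le (by linarith), uIcc_of_le (by linarith)]
                    exact Icc_subset_Icc_right hb)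
  refine ⟨hf.mono_set ?_, ?_⟩
  · rw [uIcc_of_le (by linarith), uIcc_of_le (by linarith)]
    exact Icc_subset_Icc_left (by linarith)
  · simpa using (h1.comp_mul_left (c := -1)).symm

lemma continuous_const_div_add_chord_pow {τ : ℝ} (hτ : 0 < τ) (c : ℝ) (n : ℕ) :
    Continuous fun t => c / (τ + chord t) ^ n :=
  Continuous.div (by fun_prop) (by fun_prop) fun t =>
    pow_ne_zero _ (by linarith [chord_nonneg t])

/-- On `[0, π]` the chord is at least t/2; after folding, the majorant 2τ/(τ+t/2)² has the primitive
-4τ/(τ+t/2), whose increment is below 4. -/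
lemma integral_div_add_chord_sq_le {τ : ℝ} (hτ : 0 < τ) :
    ∫ t in (-Real.pi)..Real.pi, τ / (τ + chord t) ^ 2 ≤ 4 := by
  have hc := continuous_const_div_add_chord_pow hτ τ 2
  rw [integral_neg_pos_eq Real.pi_pos.le (hc.intervalIntegrable _ _)]
  have hd : ∀ t ∈ uIcc 0 Real.pi, HasDerivAt (fun t : ℝ => -(4 * τ / (τ + t / 2)))
      (2 * (τ / (τ + t / 2) ^ 2)) t := by
    intro t ht
    rw [uIcc_of_le Real.pi_pos.le] at ht
    have hne : τ + t / 2 ≠ 0 := by linarith [ht.1]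
    have h1 : HasDerivAt (fun t : ℝ => τ + t / 2) (1 / 2) t :=
      ((hasDerivAt_id' t).div_const 2).const_add τ
    refine (((hasDerivAt_const t (4 * τ)).div h1 hne).neg).congr_deriv ?_
    field_simp
    ring
  have hcont : ContinuousOn (fun t : ℝ => 2 * (τ / (τ + t / 2) ^ 2)) (uIcc 0 Real.pi) := by
    refine ContinuousOn.mul continuousOn_const (ContinuousOn.div (by fun_prop) (by fun_prop) ?_)
    intro t ht
    rw [uIcc_of_le Real.pi_pos.le] at ht
    exact pow_ne_zero _ (by linarith [ht.1])
  have hint := intervalIntegral.integral_eq_sub_of_hasDerivAt hd hcont.intervalIntegrable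
  calc ∫ t in (0 : ℝ)..Real.pi, (τ / (τ + chord t) ^ 2 + τ / (τ + chord (-t)) ^ 2)
      ≤ ∫ t in (0 : ℝ)..Real.pi, 2 * (τ / (τ + t / 2) ^ 2) := by
        refine intervalIntegral.integral_mono_on Real.pi_pos.le ?_ hcont.intervalIntegrable ?_
        · exact (hc.add (hc.comp continuous_neg)).intervalIntegrable _ _
        · intro t ht
          rw [chord_neg, ← two_mul]
          have h1 := abs_le_two_mul_chord (t := t) (by rw [abs_of_nonneg ht.1]; exact ht.2)
          rw [abs_of_nonneg ht.1] at h1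
          have : 0 < τ + t / 2 := by linarith [ht.1]
          gcongr
          linarith
    _ ≤ 4 := by
        rw [hint]
        have : 0 ≤ 4 * τ / (τ + Real.pi / 2) := by positivity
        simp only [zero_div, add_zero]
        rw [mul_div_assoc, mul_div_assoc, div_self hτ.ne']
        rw [mul_div_assoc] at this
        linarith

lemma logDev_eq {h : Circle → ℝ} {θ t : ℝ} (hθ : h (Circle.exp θ) ≠ 0) (ht : h (Circle.exp (θ + t)) ≠ 0) :
    logDev h θ t = Real.log (h (Circle.exp (θ + t)) / h (Circle.exp θ)) :=
  (Real.log_div ht hθ).symm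

/-! ### Behaviour of log h within and beyond the radius. -/

/-- The standing assumptions on `ψ` and `h` which do not involve symmetry. -/
structure Setting (ψ : ℝ → ℝ) (h : Circle → ℝ) : Prop where
  modulus : IsModulus ψ
  cont : Continuous h
  nonneg : ∀ ξ, 0 ≤ h ξ
  zero : ∃ ξ, h ξ = 0
  log : LogIntegrable h
  lip : seminorm ψ univ h < ⊤

/-- The `ψ`-Lipschitz constant of `h`. -/
def lipConst (ψ : ℝ → ℝ) (h : Circle → ℝ) : ℝ := (seminorm ψ univ h).toReal

/-- The integrand of `a_h`, in the coordinate centred at `e^{iθ}`. -/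
def farDev (ψ : ℝ → ℝ) (h : Circle → ℝ) (θ t : ℝ) : ℝ :=
  {t | radius ψ h (Circle.exp θ) < chord t}.indicator (fun t => |logDev h θ t| / chord t ^ 2) t

/-- The real number `a_h(e^{iθ})`. -/
def farInt (ψ : ℝ → ℝ) (h : Circle → ℝ) (θ : ℝ) : ℝ :=
  ∫ t in (-Real.pi)..Real.pi, farDev ψ h θ t

lemma farDev_nonneg (ψ : ℝ → ℝ) (h : Circle → ℝ) (θ t : ℝ) : 0 ≤ farDev ψ h θ t :=
  indicator_nonneg (fun _ _ => by positivity) t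

lemma farInt_nonneg (ψ : ℝ → ℝ) (h : Circle → ℝ) (θ : ℝ) : 0 ≤ farInt ψ h θ :=
  intervalIntegral.integral_nonneg (by linarith [Real.pi_pos]) fun t _ => farDev_nonneg ψ h θ t

lemma farDev_of_lt {ψ : ℝ → ℝ} {h : Circle → ℝ} {θ t : ℝ}
    (ht : radius ψ h (Circle.exp θ) < chord t) :
    farDev ψ h θ t = |logDev h θ t| / chord t ^ 2 :=
  indicator_of_mem (show t ∈ {t | radius ψ h (Circle.exp θ) < chord t} from ht) _

namespace Setting

variable {ψ : ℝ → ℝ} {h : Circle → ℝ} (S : Setting ψ h)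
include S

lemma abs_sub_le (ξ ζ : Circle) : |h ξ - h ζ| ≤ lipConst ψ h * ψ (dist ξ ζ) :=
  norm_sub_le_of_seminorm_lt_top S.modulus (fun z _ w _ => dist_circle_le_two z w) S.lip
    (mem_univ ξ) (mem_univ ζ)

lemma exists_ne_zero : ∃ ξ, h ξ ≠ 0 := by
  obtain ⟨t, ht⟩ := S.log.1.exists
  exact ⟨_, ht⟩

lemma lipConst_pos : 0 < lipConst ψ h := by
  refine ENNReal.toReal_nonneg.lt_of_ne fun h0 => ?_
  obtain ⟨ξ, hξ⟩ := S.exists_ne_zero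
  obtain ⟨ζ, hζ⟩ := S.zero
  have h1 := S.abs_sub_le ξ ζ
  rw [hζ, lipConst, ← h0, zero_mul, sub_zero] at h1
  exact hξ (abs_nonpos_iff.1 h1)

/-- Compare with a zero of `h`, using ψ ≤ 2. This puts h/(2L) in `[0, 1]`, so that `radius` is a
genuine value of ψ*. -/
lemma le_two_mul_lipConst (ξ : Circle) : h ξ ≤ 2 * lipConst ψ h := by
  obtain ⟨ζ, hζ⟩ := S.zero
  have h1 := S.abs_sub_le ξ ζ
  rw [hζ, sub_zero] at h1
  have h2 := S.modulus.le_two (dist_nonneg (x := ξ) (y := ζ)) (dist_circle_le_two ξ ζ)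
  nlinarith [le_abs_self (h ξ), S.lipConst_pos]

lemma radius_spec (ξ : Circle) :
    radius ψ h ξ ∈ Icc (0 : ℝ) 1 ∧ ψ (radius ψ h ξ) = h ξ / (2 * lipConst ψ h) := by
  have hC := S.lipConst_pos
  exact S.modulus.star_spec (div_nonneg (S.nonneg ξ) (mul_pos two_pos hC).le)
    ((div_le_one (mul_pos two_pos hC)).2 (S.le_two_mul_lipConst ξ))

lemma pos {ξ : Circle} (hξ : h ξ ≠ 0) : 0 < h ξ := (S.nonneg ξ).lt_of_ne' hξ

lemma radius_pos {ξ : Circle} (hξ : h ξ ≠ 0) : 0 < radius ψ h ξ := by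
  obtain ⟨h1, h2⟩ := S.radius_spec ξ
  refine h1.1.lt_of_ne fun h0 => ?_
  rw [← h0, S.modulus.map_zero] at h2
  have := div_pos (S.pos hξ) (mul_pos two_pos S.lipConst_pos)
  exact this.ne h2

lemma lt_radius {ξ : Circle} {τ : ℝ} (hτ2 : τ ≤ 2)
    (hlt : ψ τ < h ξ / (2 * lipConst ψ h)) : τ < radius ψ h ξ := by
  obtain ⟨h1, h2⟩ := S.radius_spec ξ
  by_contra! hle
  have := S.modulus.mono h1.1 hle hτ2
  linarith

/-- Below the radius, `h` deviates from `h(e^{iθ})` by at most half of it. -/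
lemma abs_sub_le_half {θ t : ℝ} (ht : chord t ≤ radius ψ h (Circle.exp θ)) :
    |h (Circle.exp (θ + t)) - h (Circle.exp θ)| ≤ h (Circle.exp θ) / 2 := by
  obtain ⟨h1, h2⟩ := S.radius_spec (Circle.exp θ)
  have hd := S.abs_sub_le (Circle.exp (θ + t)) (Circle.exp θ)
  rw [dist_circleExp, add_sub_cancel_left] at hd
  have hC := S.lipConst_pos
  have := S.modulus.mono (chord_nonneg t) ht (h1.2.trans one_le_two)
  calc _ ≤ lipConst ψ h * ψ (chord t) := hd
    _ ≤ lipConst ψ h * (h (Circle.exp θ) / (2 * lipConst ψ h)) := by rw [← h2]; gcongr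
    _ = _ := by field_simp

lemma half_le {θ t : ℝ} (ht : chord t ≤ radius ψ h (Circle.exp θ)) :
    h (Circle.exp θ) / 2 ≤ h (Circle.exp (θ + t)) := by
  linarith [(abs_le.1 (S.abs_sub_le_half ht)).1]

lemma abs_logDev_le_abs_sub {θ t : ℝ} (hθ : h (Circle.exp θ) ≠ 0)
    (ht : chord t ≤ radius ψ h (Circle.exp θ)) :
    |logDev h θ t| ≤ 2 * |h (Circle.exp (θ + t)) - h (Circle.exp θ)| / h (Circle.exp θ) := by
  have hp := S.pos hθ
  have hh := S.half_le ht
  rw [logDev_eq hθ (by linarith)]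
  refine (abs_log_le_two_mul ?_).trans_eq ?_
  · rw [le_div_iff₀ hp]; linarith
  · rw [div_sub_one hθ, abs_div, abs_of_pos hp, mul_div_assoc]

lemma abs_logDev_le {θ t : ℝ} (hθ : h (Circle.exp θ) ≠ 0)
    (ht : chord t ≤ radius ψ h (Circle.exp θ)) :
    |logDev h θ t| ≤ 2 * lipConst ψ h * ψ (chord t) / h (Circle.exp θ) := by
  refine (S.abs_logDev_le_abs_sub hθ ht).trans ?_
  have hd := S.abs_sub_le (Circle.exp (θ + t)) (Circle.exp θ)
  rw [dist_circleExp, add_sub_cancel_left] at hd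
  have hp := S.pos hθ
  rw [mul_assoc]
  gcongr

lemma abs_logDev_le_one {θ t : ℝ} (hθ : h (Circle.exp θ) ≠ 0)
    (ht : chord t ≤ radius ψ h (Circle.exp θ)) : |logDev h θ t| ≤ 1 := by
  refine (S.abs_logDev_le_abs_sub hθ ht).trans ?_
  have hp := S.pos hθ
  rw [div_le_one hp]
  linarith [S.abs_sub_le_half ht]

lemma farDev_intervalIntegrable {θ : ℝ} (hθ : h (Circle.exp θ) ≠ 0) (a b : ℝ) :
    IntervalIntegrable (farDev ψ h θ) volume a b := by
  have hr := S.radius_pos hθ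
  have hg := S.log.logDev θ a b
  have hms : MeasurableSet {t | radius ψ h (Circle.exp θ) < chord t} :=
    (isOpen_lt continuous_const continuous_chord).measurableSet
  refine (hg.norm.mul_const ((radius ψ h (Circle.exp θ) ^ 2)⁻¹)).mono_fun ?_ ?_
  · refine AEStronglyMeasurable.indicator ?_ hms
    refine AEStronglyMeasurable.mul (f := fun t => |logDev h θ t|)
      (intervalIntegrable_iff.1 hg.norm).aestronglyMeasurable ?_
    exact ((continuous_chord.pow 2).measurable.inv).aestronglyMeasurable
  · refine Eventually.of_forall fun t => ?_
    simp only
    rw [Real.norm_of_nonneg (farDev_nonneg ψ h θ t), norm_mul, norm_norm]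
    simp only [farDev, indicator_apply, mem_ofPred_eq]
    split_ifs with ht
    · have h1 : (chord t ^ 2)⁻¹ ≤ ‖(radius ψ h (Circle.exp θ) ^ 2)⁻¹‖ := by
        rw [Real.norm_of_nonneg (by positivity)]
        gcongr
      rw [div_eq_mul_inv]
      exact mul_le_mul_of_nonneg_left h1 (abs_nonneg _)
    · positivity

/-- The two integrands agree after a rotation, except at zeros of `h`: there the convention log 0 =
0 gives 0 for the logarithm of the quotient but -log h(e^{iθ}) for the difference. Zeros form a null
set. In particular a_h is finite where `h` does not vanish. -/
lemma a_eq {θ : ℝ} (hθ : h (Circle.exp θ) ≠ 0) :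
    a ψ h (Circle.exp θ) = ENNReal.ofReal (farInt ψ h θ) := by
  set s : Set ℝ := {t | radius ψ h (Circle.exp θ) < ‖(Circle.exp t : ℂ) - (Circle.exp θ : ℂ)‖}
    with hs
  set P : ℝ → ℝ := s.indicator fun t => |Real.log (h (Circle.exp t) / h (Circle.exp θ))| /
      ‖(Circle.exp t : ℂ) - (Circle.exp θ : ℂ)‖ ^ 2 with hP
  have hch : ∀ t, ‖(Circle.exp (θ + t) : ℂ) - (Circle.exp θ : ℂ)‖ = chord t := fun t => by
    rw [Circle.coe_exp, Circle.coe_exp, norm_exp_sub_exp, add_sub_cancel_left]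
  have hsm : MeasurableSet s := by
    have : Continuous fun t : ℝ => ‖(Circle.exp t : ℂ) - (Circle.exp θ : ℂ)‖ := by
      simp only [Circle.coe_exp]; fun_prop
    exact (isOpen_lt continuous_const this).measurableSet
  have hPper : Function.Periodic P (2 * Real.pi) := fun t => by
    simp only [hP, hs, indicator_apply, mem_ofPred_eq, circleExp_add_two_pi]
  have hPf : (fun t => P (θ + t)) =ᵐ[volume] farDev ψ h θ := by
    filter_upwards [S.log.ae_ne_zero θ] with t ht
    simp only [hP, hs, farDev, indicator_apply, mem_ofPred_eq, hch, logDev_eq hθ ht]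
  have hPi1 : IntervalIntegrable (fun t => P (θ + t)) volume (-Real.pi) Real.pi :=
    (S.farDev_intervalIntegrable hθ _ _).congr_ae (ae_restrict_of_ae hPf.symm)
  have hPi2 : IntervalIntegrable P volume (θ + -Real.pi) (θ + -Real.pi + 2 * Real.pi) := by
    have := hPi1.comp_add_left (-θ)
    simp only [add_neg_cancel_left] at this
    refine cast ?_ this
    congr 1 <;> ring
  have hPi : IntervalIntegrable P volume 0 (2 * Real.pi) :=
    hPper.intervalIntegrable (by positivity) hPi2 _ _
  have hint : ∫ t in (0 : ℝ)..(2 * Real.pi), P t = farInt ψ h θ := by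
    have h1 := hPper.intervalIntegral_add_eq 0 (θ + -Real.pi)
    rw [zero_add, show θ + -Real.pi + 2 * Real.pi = θ + Real.pi by ring,
      ← intervalIntegral.integral_comp_add_left] at h1
    rw [h1, farInt]
    exact intervalIntegral.integral_congr_ae (hPf.mono fun t ht _ => ht)
  have hP0 : ∀ t, 0 ≤ P t := fun t => indicator_nonneg (fun _ _ => by positivity) t
  rw [← hint, intervalIntegral.integral_of_le (by positivity),
    ofReal_integral_eq_lintegral_ofReal
      ((intervalIntegrable_iff_integrableOn_Ioc_of_le (by positivity)).1 hPi)
      (Eventually.of_forall hP0), ← setLIntegral_congr Ico_ae_eq_Ioc]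
  have h2 : ∀ t, ENNReal.ofReal (P t) = s.indicator (fun t => ENNReal.ofReal
      (|Real.log (h (Circle.exp t) / h (Circle.exp θ))| /
        ‖(Circle.exp t : ℂ) - (Circle.exp θ : ℂ)‖ ^ 2)) t := fun t => by
    simp only [hP, indicator_apply]
    split_ifs <;> simp
  simp_rw [h2]
  rw [setLIntegral_indicator hsm, inter_comm]
  rfl

/-- Within the radius, |g| ≤ 2L(ψ(τ)/h)(1 + d/τ); the factor (τ+d)/τ lowers the cubic kernel to the
quadratic one, of mass at most 4. Beyond the radius the kernel is at most τ/d², which leaves τ times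
the far integral. -/
lemma integral_logDev_cube_le {θ τ : ℝ} (hθ : h (Circle.exp θ) ≠ 0) (hτ : 0 < τ) (hτ2 : τ ≤ 2) :
    ∫ t in (-Real.pi)..Real.pi, |logDev h θ t| * (τ ^ 2 / (τ + chord t) ^ 3) ≤
      8 * lipConst ψ h * (ψ τ / h (Circle.exp θ)) + τ * farInt ψ h θ := by
  have hp := S.pos hθ
  have hC := S.lipConst_pos
  have hψτ := S.modulus.pos hτ hτ2
  set c := 2 * lipConst ψ h * (ψ τ / h (Circle.exp θ)) with hc
  have hc0 : 0 < c := by positivity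
  have hi1 := (continuous_const_div_add_chord_pow hτ τ 2).intervalIntegrable (μ := volume)
    (-Real.pi) Real.pi
  have hi2 := S.farDev_intervalIntegrable hθ (-Real.pi) Real.pi
  have hi3 := (S.log.logDev θ (-Real.pi) Real.pi).norm.mul_continuousOn
    (continuous_const_div_add_chord_pow hτ (τ ^ 2) 3).continuousOn
  calc ∫ t in (-Real.pi)..Real.pi, |logDev h θ t| * (τ ^ 2 / (τ + chord t) ^ 3)
      ≤ ∫ t in (-Real.pi)..Real.pi, (c * (τ / (τ + chord t) ^ 2) + τ * farDev ψ h θ t) := by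
        refine intervalIntegral.integral_mono_on (by linarith [Real.pi_pos]) hi3
          ((hi1.const_mul c).add (hi2.const_mul τ)) fun t _ => ?_
        have hd := chord_nonneg t
        have hd2 := chord_le_two t
        have hs : 0 < τ + chord t := by linarith
        rcases le_or_gt (chord t) (radius ψ h (Circle.exp θ)) with hle | hlt
        · have h1 := S.abs_logDev_le hθ hle
          have h2 := S.modulus.le_mul_one_add hd hd2 hτ hτ2
          have h3 : |logDev h θ t| ≤ c * ((τ + chord t) / τ) := by
            refine h1.trans ?_
            calc 2 * lipConst ψ h * ψ (chord t) / h (Circle.exp θ)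
                ≤ 2 * lipConst ψ h * (ψ τ * (1 + chord t / τ)) / h (Circle.exp θ) := by gcongr
              _ = _ := by rw [hc]; field_simp
          have h4 := farDev_nonneg ψ h θ t
          calc |logDev h θ t| * (τ ^ 2 / (τ + chord t) ^ 3)
              ≤ c * ((τ + chord t) / τ) * (τ ^ 2 / (τ + chord t) ^ 3) := by gcongr
            _ = c * (τ / (τ + chord t) ^ 2) := by field_simp
            _ ≤ _ := le_add_of_nonneg_right (by positivity)
        · rw [farDev_of_lt hlt]
          have hr := S.radius_pos hθ
          have hdp : 0 < chord t := hr.trans hlt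
          have h1 : τ ^ 2 / (τ + chord t) ^ 3 ≤ τ / chord t ^ 2 := by
            rw [div_le_div_iff₀ (by positivity) (by positivity)]
            have : chord t ^ 2 * τ ≤ (τ + chord t) ^ 3 := by
              have h5 : 0 ≤ τ ^ 3 + 3 * τ ^ 2 * chord t + 2 * τ * chord t ^ 2 + chord t ^ 3 := by
                positivity
              nlinarith
            nlinarith
          have h2 : 0 ≤ c * (τ / (τ + chord t) ^ 2) := by positivity
          calc |logDev h θ t| * (τ ^ 2 / (τ + chord t) ^ 3)
              ≤ |logDev h θ t| * (τ / chord t ^ 2) := by gcongr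
            _ = τ * (|logDev h θ t| / chord t ^ 2) := by ring
            _ ≤ _ := le_add_of_nonneg_left h2
    _ = c * (∫ t in (-Real.pi)..Real.pi, τ / (τ + chord t) ^ 2) + τ * farInt ψ h θ := by
        rw [intervalIntegral.integral_add (hi1.const_mul c) (hi2.const_mul τ),
          intervalIntegral.integral_const_mul, intervalIntegral.integral_const_mul, farInt]
    _ ≤ c * 4 + τ * farInt ψ h θ := by
        gcongr; exact integral_div_add_chord_sq_le hτ
    _ = _ := by rw [hc]; ring

end Setting

/-! ### Improper integrals and the conjugate kernel near the circle. -/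

lemma tendsto_integral_left {f : ℝ → ℝ} {b : ℝ} (hb : 0 < b)
    (hf : IntervalIntegrable f volume 0 b) :
    Tendsto (fun ε => ∫ t in ε..b, f t) (𝓝[>] 0) (𝓝 (∫ t in (0 : ℝ)..b, f t)) := by
  have h1 : IntegrableOn f (uIcc 0 b) := by
    rw [uIcc_of_le hb.le]
    exact (intervalIntegrable_iff_integrableOn_Icc_of_le hb.le).1 hf
  have h2 := intervalIntegral.continuousOn_primitive_interval_left h1 0 left_mem_uIcc
  refine h2.tendsto.mono_left (nhdsWithin_le_of_mem ?_)
  rw [uIcc_of_le hb.le]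
  exact mem_of_superset (Ioc_mem_nhdsGT hb) Ioc_subset_Icc_self

/-- For a nonnegative integrand, convergence of the truncated integrals already forces
integrability. This turns the limit in the first symmetry condition into an ordinary integral. -/
lemma intervalIntegrable_of_tendsto_integral {f : ℝ → ℝ} {s L : ℝ} (hs : 0 < s)
    (hf0 : ∀ t ∈ Ioc 0 s, 0 ≤ f t) (hf : ContinuousOn f (Ioc 0 s))
    (hL : Tendsto (fun ε => ∫ t in ε..s, f t) (𝓝[>] 0) (𝓝 L)) :
    IntervalIntegrable f volume 0 s ∧ ∫ t in (0 : ℝ)..s, f t = L := by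
  have hi : IntervalIntegrable f volume 0 s := by
    rw [intervalIntegrable_iff_integrableOn_Ioc_of_le hs.le]
    have ha : Tendsto (fun n : ℕ => s / ((n : ℝ) + 1)) atTop (𝓝[>] 0) := by
      refine tendsto_nhdsWithin_iff.2 ⟨?_, Eventually.of_forall fun n => ?_⟩
      · exact tendsto_const_nhds.div_atTop
          (tendsto_atTop_add_const_right _ _ tendsto_natCast_atTop_atTop)
      · exact div_pos hs (by positivity)
    have hle : ∀ n : ℕ, s / ((n : ℝ) + 1) ≤ s := fun n => by
      refine div_le_self hs.le ?_
      have : (0 : ℝ) ≤ n := n.cast_nonneg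
      linarith
    -- Any number above the limit serves as an eventual bound; `L + 1` is one.
    refine integrableOn_Ioc_of_intervalIntegral_norm_bounded_left (I := L + 1)
      (a := fun n : ℕ => s / ((n : ℝ) + 1)) (l := atTop) (fun n => ?_)
      (tendsto_nhds_of_tendsto_nhdsWithin ha) ?_
    · have hp : 0 < s / ((n : ℝ) + 1) := div_pos hs (by positivity)
      refine (ContinuousOn.integrableOn_Icc ?_).mono_set Ioc_subset_Icc_self
      exact hf.mono fun t ht => ⟨hp.trans_le ht.1, ht.2⟩
    · filter_upwards [(hL.comp ha).eventually (gt_mem_nhds (lt_add_one L))] with n hn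
      have hp : 0 < s / ((n : ℝ) + 1) := div_pos hs (by positivity)
      simp only [Function.comp_apply] at hn
      rw [intervalIntegral.integral_of_le (hle n)] at hn
      refine le_of_eq_of_le (setIntegral_congr_fun measurableSet_Ioc fun t ht => ?_) hn.le
      exact Real.norm_of_nonneg (hf0 t ⟨hp.trans ht.1, ht.2⟩)
  exact ⟨hi, tendsto_nhds_unique (tendsto_integral_left hs hi) hL⟩

lemma abs_log_sub_log_le {x y m : ℝ} (hm : 0 < m) (hx : m ≤ x) (hy : m ≤ y) :
    |Real.log x - Real.log y| ≤ |x - y| / m := by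
  have key : ∀ x y : ℝ, m ≤ x → m ≤ y → Real.log x - Real.log y ≤ |x - y| / m := by
    intro x y hx hy
    have hx0 := hm.trans_le hx
    have hy0 := hm.trans_le hy
    rw [← Real.log_div hx0.ne' hy0.ne']
    refine (Real.log_le_sub_one_of_pos (div_pos hx0 hy0)).trans ?_
    rw [div_sub_one hy0.ne']
    calc (x - y) / y ≤ |x - y| / y := by gcongr; exact le_abs_self _
      _ ≤ |x - y| / m := by gcongr
  rw [abs_le]
  refine ⟨?_, key x y hx hy⟩
  have := key y x hy hx
  rw [abs_sub_comm] at this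
  linarith

lemma herglotz_im_ofReal (r t : ℝ) :
    (herglotz r t).im = -(2 * r * Real.sin t) / ‖Complex.exp (t * Complex.I) - r‖ ^ 2 := by
  rw [herglotz, Complex.div_im, ← Complex.sq_norm]
  simp only [Complex.add_im, Complex.add_re, Complex.sub_re, Complex.sub_im,
    Complex.exp_ofReal_mul_I_re, Complex.exp_ofReal_mul_I_im, Complex.ofReal_re, Complex.ofReal_im]
  ring

lemma norm_exp_sub_ofReal_sq (r t : ℝ) :
    ‖Complex.exp (t * Complex.I) - r‖ ^ 2 = (1 - r) ^ 2 + r * chord t ^ 2 := by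
  rw [Complex.sq_norm, Complex.normSq_apply, chord_sq]
  simp only [Complex.sub_re, Complex.sub_im,
    Complex.exp_ofReal_mul_I_re, Complex.exp_ofReal_mul_I_im, Complex.ofReal_re, Complex.ofReal_im]
  linear_combination Real.sin_sq_add_cos_sq t

/-- A point on the circle is at distance at least τ from w, and w is within cτ of 1; so both τ and
the chord are controlled by the distance to w. -/
lemma add_chord_le_of_norm_sub_one_le {w : ℂ} {τ c : ℝ} (hw : ‖w‖ ≤ 1 - τ) (hw1 : ‖w - 1‖ ≤ c * τ)
    (hc : 0 ≤ c) (t : ℝ) : τ + chord t ≤ (2 + c) * ‖Complex.exp (t * Complex.I) - w‖ := by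
  have h1 := norm_sub_norm_le (Complex.exp (t * Complex.I)) w
  rw [Complex.norm_exp_ofReal_mul_I] at h1
  have h2 : chord t ≤ ‖Complex.exp (t * Complex.I) - w‖ + ‖w - 1‖ := by
    rw [chord, show Complex.exp (t * Complex.I) - 1 =
      (Complex.exp (t * Complex.I) - w) + (w - 1) by ring]
    exact norm_add_le _ _
  nlinarith

/-- The difference between the conjugate kernel on the circle and the one at radius `1 - τ`. -/
def conjDiff (τ t : ℝ) : ℝ :=
  (Real.tan (t / 2))⁻¹ + (herglotz ((1 - τ : ℝ) : ℂ) t).im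

lemma inv_tan_half_eq {t : ℝ} (ht : chord t ≠ 0) :
    (Real.tan (t / 2))⁻¹ = 2 * Real.sin t / chord t ^ 2 := by
  have hs : Real.sin (t / 2) ≠ 0 := fun h => ht (by rw [chord_eq, h]; simp)
  rw [chord_eq, mul_pow, sq_abs, Real.tan_eq_sin_div_cos, inv_div,
    show Real.sin t = 2 * Real.sin (t / 2) * Real.cos (t / 2) by rw [← Real.sin_two_mul]; ring_nf]
  field_simp

lemma abs_sin_le_chord (t : ℝ) : |Real.sin t| ≤ chord t := by
  rw [chord_eq, show Real.sin t = 2 * Real.sin (t / 2) * Real.cos (t / 2) by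
    rw [← Real.sin_two_mul]; ring_nf, abs_mul, abs_mul, abs_two]
  exact mul_le_of_le_one_right (by positivity) (Real.abs_cos_le_one _)

/-- Since |e^{it} - r|² = (1-r)² + r d², the two fractions combine to 2 τ² sin t / (d²|e^{it} -
r|²). The gain of τ² makes the kernel cubic for t ≥ τ, while it is still only of order 1/t near 0,
where the first symmetry condition has to enter. -/
lemma abs_conjDiff_le {τ t : ℝ} (hτ : 0 < τ) (hτ1 : τ ≤ 1) (ht : 0 < chord t) :
    |conjDiff τ t| ≤ 18 * τ ^ 2 / (chord t * (τ + chord t) ^ 2) := by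
  have hN := norm_exp_sub_ofReal_sq (1 - τ) t
  set N := ‖Complex.exp (t * Complex.I) - ((1 - τ : ℝ) : ℂ)‖ with hNdef
  have h3 : τ + chord t ≤ 3 * N := by
    have := add_chord_le_of_norm_sub_one_le (w := ((1 - τ : ℝ) : ℂ)) (τ := τ) (c := 1) ?_ ?_
      zero_le_one t
    · linarith
    · rw [Complex.norm_real, Real.norm_of_nonneg (by linarith)]
    · rw [← Complex.ofReal_one, ← Complex.ofReal_sub, Complex.norm_real]
      simp [abs_of_pos hτ]
  have hN0 : 0 < N := by linarith
  have heq : conjDiff τ t = 2 * Real.sin t * τ ^ 2 / (chord t ^ 2 * N ^ 2) := by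
    rw [conjDiff, inv_tan_half_eq ht.ne', herglotz_im_ofReal, ← hNdef]
    field_simp
    rw [hN]
    ring
  rw [heq, abs_div, abs_mul, abs_mul, abs_two, abs_of_pos (by positivity : 0 < τ ^ 2),
    abs_of_pos (by positivity : 0 < chord t ^ 2 * N ^ 2)]
  calc 2 * |Real.sin t| * τ ^ 2 / (chord t ^ 2 * N ^ 2)
      ≤ 2 * chord t * τ ^ 2 / (chord t ^ 2 * ((τ + chord t) / 3) ^ 2) := by
        gcongr
        · exact abs_sin_le_chord t
        · linarith
    _ = _ := by field_simp; norm_num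

lemma abs_conjDiff_le_near {τ t : ℝ} (hτ : 0 < τ) (hτ1 : τ ≤ 1) (ht : 0 < t)
    (htπ : t ≤ Real.pi) : |conjDiff τ t| ≤ 36 / t := by
  have habs : |t| ≤ Real.pi := by rwa [abs_of_pos ht]
  have hd := chord_pos habs ht.ne'
  have h2 := abs_le_two_mul_chord habs
  rw [abs_of_pos ht] at h2
  refine (abs_conjDiff_le hτ hτ1 hd).trans ?_
  rw [div_le_div_iff₀ (by positivity) ht]
  have h3 : τ ^ 2 ≤ (τ + chord t) ^ 2 := by gcongr; linarith
  calc 18 * τ ^ 2 * t ≤ 18 * (τ + chord t) ^ 2 * (2 * chord t) := by gcongr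
    _ = _ := by ring

lemma abs_conjDiff_le_far {τ t : ℝ} (hτ : 0 < τ) (hτ1 : τ ≤ 1) (ht : τ ≤ t)
    (htπ : t ≤ Real.pi) : |conjDiff τ t| ≤ 54 * (τ ^ 2 / (τ + chord t) ^ 3) := by
  have ht0 := hτ.trans_le ht
  have habs : |t| ≤ Real.pi := by rwa [abs_of_pos ht0]
  have hd := chord_pos habs ht0.ne'
  have h2 := abs_le_two_mul_chord habs
  rw [abs_of_pos ht0] at h2
  refine (abs_conjDiff_le hτ hτ1 hd).trans ?_
  rw [← mul_div_assoc, div_le_div_iff₀ (by positivity) (by positivity)]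
  have h3 : τ + chord t ≤ 3 * chord t := by linarith
  calc 18 * τ ^ 2 * (τ + chord t) ^ 3 = 18 * τ ^ 2 * (τ + chord t) ^ 2 * (τ + chord t) := by ring
    _ ≤ 18 * τ ^ 2 * (τ + chord t) ^ 2 * (3 * chord t) := by gcongr
    _ = _ := by ring

lemma inv_tan_half_continuousOn : ContinuousOn (fun t : ℝ => (Real.tan (t / 2))⁻¹)
    (Ioc 0 Real.pi) := by
  have h : ∀ t ∈ Ioc (0 : ℝ) Real.pi, chord t ≠ 0 := fun t ht =>
    (chord_pos (by rw [abs_of_pos ht.1]; exact ht.2) ht.1.ne').ne'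
  refine ContinuousOn.congr (f := fun t => 2 * Real.sin t / chord t ^ 2) ?_
    fun t ht => inv_tan_half_eq (h t ht)
  exact ContinuousOn.div (by fun_prop) (by fun_prop) fun t ht => pow_ne_zero _ (h t ht)

/-! ### The even part of log h and the second symmetry condition. -/

namespace Setting

variable {ψ : ℝ → ℝ} {h : Circle → ℝ} (S : Setting ψ h)
include S

/-- The range is cut at τ and λ. Up to τ the Lipschitz bound suffices, with kernel at most 1/τ.
Between τ and λ the sum g(t) + g(-t) is the logarithm of h(θ+t)h(θ-t)/h(θ)², to which the second
symmetry condition applies. Beyond λ the far integral takes over. -/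
lemma integral_even_le {θ τ c : ℝ} (hθ : h (Circle.exp θ) ≠ 0) (hτ : 0 < τ)
    (hτr : τ ≤ radius ψ h (Circle.exp θ))
    (hsym : 1 / h (Circle.exp θ) * ∫ t in τ..radius ψ h (Circle.exp θ),
      |h (Circle.exp (θ + t)) * h (Circle.exp (θ - t)) - h (Circle.exp θ) ^ 2| / t ^ 2
      ≤ c * (ψ τ / τ)) :
    ∫ t in (0 : ℝ)..Real.pi, |logDev h θ t + logDev h θ (-t)| * (τ / (τ + chord t) ^ 2) ≤
      (20 * lipConst ψ h + 16 * c) * (ψ τ / h (Circle.exp θ)) + τ * farInt ψ h θ := by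
  have hp := S.pos hθ
  have hC := S.lipConst_pos
  obtain ⟨hr, hψr⟩ := S.radius_spec (Circle.exp θ)
  set H := h (Circle.exp θ) with hH
  set lam := radius ψ h (Circle.exp θ) with hlam
  have hlam0 : 0 < lam := hτ.trans_le hτr
  have hlamπ : lam ≤ Real.pi := hr.2.trans (by linarith [Real.pi_gt_three])
  have hψτ := S.modulus.pos hτ (by linarith [hr.2])
  have hπ := Real.pi_pos
  have hgi : IntervalIntegrable (fun t => |logDev h θ t + logDev h θ (-t)| *
      (τ / (τ + chord t) ^ 2)) volume 0 Real.pi := by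
    obtain ⟨i1, i2⟩ := intervalIntegrable_fold hπ.le (S.log.logDev θ (-Real.pi) Real.pi)
    exact (i1.add i2).abs.mul_continuousOn (continuous_const_div_add_chord_pow hτ τ 2).continuousOn
  have sub1 : uIcc 0 τ ⊆ uIcc 0 Real.pi := by
    rw [uIcc_of_le hτ.le, uIcc_of_le hπ.le]; exact Icc_subset_Icc_right (hτr.trans hlamπ)
  have sub2 : uIcc τ lam ⊆ uIcc 0 Real.pi := by
    rw [uIcc_of_le hτr, uIcc_of_le hπ.le]; exact Icc_subset_Icc hτ.le hlamπ
  have sub3 : uIcc lam Real.pi ⊆ uIcc 0 Real.pi := by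
    rw [uIcc_of_le hlamπ, uIcc_of_le hπ.le]; exact Icc_subset_Icc_left hlam0.le
  have hg1 := hgi.mono_set sub1
  have hg2 := hgi.mono_set sub2
  have hg3 := hgi.mono_set sub3
  rw [← intervalIntegral.integral_add_adjacent_intervals (hg1.trans hg2) hg3,
    ← intervalIntegral.integral_add_adjacent_intervals hg1 hg2]
  have hchord_le : ∀ t, 0 ≤ t → chord t ≤ t := fun t ht => by
    have := chord_le_abs t
    rwa [abs_of_nonneg ht] at this
  have b1 : ∫ t in (0 : ℝ)..τ, |logDev h θ t + logDev h θ (-t)| * (τ / (τ + chord t) ^ 2) ≤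
      4 * lipConst ψ h * (ψ τ / H) := by
    have hle : ∀ t ∈ Icc 0 τ, |logDev h θ t + logDev h θ (-t)| * (τ / (τ + chord t) ^ 2) ≤
        4 * lipConst ψ h * (ψ τ / H) / τ := fun t ht => by
      have hct := hchord_le t ht.1
      have hcr : chord t ≤ lam := hct.trans (ht.2.trans hτr)
      have m1 := S.abs_logDev_le hθ hcr
      have m2 := S.abs_logDev_le (t := -t) hθ (by rwa [chord_neg])
      rw [chord_neg] at m2
      have m3 := S.modulus.mono (chord_nonneg t) (hct.trans ht.2) (by linarith [hr.2])
      have m4 : 2 * lipConst ψ h * ψ (chord t) / H ≤ 2 * lipConst ψ h * ψ τ / H := by gcongr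
      have m5 : |logDev h θ t + logDev h θ (-t)| ≤ 4 * lipConst ψ h * (ψ τ / H) := by
        refine (abs_add_le _ _).trans ?_
        calc _ ≤ 2 * lipConst ψ h * ψ τ / H + 2 * lipConst ψ h * ψ τ / H := by linarith
          _ = _ := by ring
      have m6 : τ / (τ + chord t) ^ 2 ≤ 1 / τ := by
        have hcn := chord_nonneg t
        rw [div_le_div_iff₀ (by positivity) hτ, one_mul, ← sq]
        gcongr
        linarith
      calc _ ≤ 4 * lipConst ψ h * (ψ τ / H) * (1 / τ) := by
            have := chord_nonneg t
            gcongr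
        _ = _ := by ring
    have := intervalIntegral.integral_mono_on hτ.le hg1 intervalIntegrable_const hle
    rw [intervalIntegral.integral_const, sub_zero, smul_eq_mul, mul_div_cancel₀ _ hτ.ne'] at this
    exact this
  have b2 : ∫ t in τ..lam, |logDev h θ t + logDev h θ (-t)| * (τ / (τ + chord t) ^ 2) ≤
      16 * c * (ψ τ / H) := by
    have hcont : IntervalIntegrable (fun t => |h (Circle.exp (θ + t)) * h (Circle.exp (θ - t)) -
        H ^ 2| / t ^ 2) volume τ lam := by
      refine ContinuousOn.intervalIntegrable ?_
      rw [uIcc_of_le hτr]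
      have hc1 := S.cont
      refine ContinuousOn.div ?_ (by fun_prop) fun t ht => pow_ne_zero _ (by linarith [ht.1])
      refine Continuous.continuousOn ?_
      exact (((hc1.comp (by fun_prop)).mul (hc1.comp (by fun_prop))).sub continuous_const).abs
    have hle : ∀ t ∈ Icc τ lam, |logDev h θ t + logDev h θ (-t)| * (τ / (τ + chord t) ^ 2) ≤
        16 * τ / H ^ 2 * (|h (Circle.exp (θ + t)) * h (Circle.exp (θ - t)) - H ^ 2| / t ^ 2) := by
      intro t ht
      have ht0 : 0 < t := hτ.trans_le ht.1
      have hct := hchord_le t ht0.le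
      have hcr : chord t ≤ lam := hct.trans ht.2
      have htπ : |t| ≤ Real.pi := by rw [abs_of_pos ht0]; exact ht.2.trans hlamπ
      have p1 := S.half_le hcr
      have p2 := S.half_le (θ := θ) (t := -t) (by rwa [chord_neg])
      rw [← sub_eq_add_neg] at p2
      rw [← hH] at p1 p2
      have p3 : logDev h θ t + logDev h θ (-t) =
          Real.log (h (Circle.exp (θ + t)) * h (Circle.exp (θ - t)) / H ^ 2) := by
        rw [logDev, logDev, ← sub_eq_add_neg, ← hH, Real.log_div (mul_pos (by linarith)
          (by linarith)).ne' (by positivity), Real.log_mul (by linarith) (by linarith),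
          Real.log_pow]
        push_cast
        ring
      -- Both factors are at least H/2, so the quotient stays in the range where the logarithm is
      -- Lipschitz at 1.
      have p4 : 1 / 4 ≤ h (Circle.exp (θ + t)) * h (Circle.exp (θ - t)) / H ^ 2 := by
        rw [le_div_iff₀ (by positivity)]
        have := mul_le_mul p1 p2 (by linarith) (by linarith)
        linarith
      have p5 := abs_log_le_four_mul p4
      rw [← p3, div_sub_one (by positivity), abs_div, abs_of_pos (by positivity : 0 < H ^ 2)] at p5
      have p6 : τ / (τ + chord t) ^ 2 ≤ 4 * τ / t ^ 2 := by
        have hcp := chord_pos htπ ht0.ne'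
        have := abs_le_two_mul_chord htπ
        rw [abs_of_pos ht0] at this
        rw [div_le_div_iff₀ (by positivity) (by positivity)]
        calc τ * t ^ 2 ≤ τ * (2 * (τ + chord t)) ^ 2 := by gcongr; linarith
          _ = _ := by ring
      calc _ ≤ 4 * (|h (Circle.exp (θ + t)) * h (Circle.exp (θ - t)) - H ^ 2| / H ^ 2) *
            (4 * τ / t ^ 2) := by
            have := chord_nonneg t
            gcongr
        _ = _ := by ring
    have := intervalIntegral.integral_mono_on hτr hg2 (hcont.const_mul _) hle
    rw [intervalIntegral.integral_const_mul] at this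
    refine this.trans ?_
    set J := ∫ t in τ..lam, |h (Circle.exp (θ + t)) * h (Circle.exp (θ - t)) - H ^ 2| / t ^ 2
    calc 16 * τ / H ^ 2 * J = 16 * τ / H * (1 / H * J) := by field_simp
      _ ≤ 16 * τ / H * (c * (ψ τ / τ)) := by gcongr
      _ = _ := by field_simp
  have b3 : ∫ t in lam..Real.pi, |logDev h θ t + logDev h θ (-t)| * (τ / (τ + chord t) ^ 2) ≤
      16 * lipConst ψ h * (ψ τ / H) + τ * farInt ψ h θ := by
    have hfi := S.farDev_intervalIntegrable hθ (-Real.pi) Real.pi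
    obtain ⟨i1, i2⟩ := intervalIntegrable_fold hπ.le hfi
    have hf3 := (i1.add i2).mono_set sub3
    have hinv : IntervalIntegrable (fun t : ℝ => 8 * τ * (1 / t ^ 2)) volume lam Real.pi := by
      refine ContinuousOn.intervalIntegrable ?_
      rw [uIcc_of_le hlamπ]
      exact continuousOn_const.mul (ContinuousOn.div continuousOn_const (by fun_prop)
        fun t ht => pow_ne_zero _ (by linarith [ht.1]))
    have hle : ∀ t ∈ Icc lam Real.pi,
        |logDev h θ t + logDev h θ (-t)| * (τ / (τ + chord t) ^ 2) ≤
        8 * τ * (1 / t ^ 2) + τ * (farDev ψ h θ t + farDev ψ h θ (-t)) := by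
      intro t ht
      have ht0 : 0 < t := hlam0.trans_le ht.1
      have htπ : |t| ≤ Real.pi := by rw [abs_of_pos ht0]; exact ht.2
      have hcp := chord_pos htπ ht0.ne'
      have hk : τ / (τ + chord t) ^ 2 ≤ τ / chord t ^ 2 := by gcongr; linarith
      have habs := abs_add_le (logDev h θ t) (logDev h θ (-t))
      -- The chord is shorter than the arc, so t ≥ λ still allows d(t) ≤ λ, where `farDev` vanishes.
      -- There |g| ≤ 1, and the term 8τ/t² pays for it.
      rcases le_or_gt (chord t) lam with hcl | hcl
      · have m1 := S.abs_logDev_le_one hθ hcl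
        have m2 := S.abs_logDev_le_one (t := -t) hθ (by rwa [chord_neg])
        have f1 := farDev_nonneg ψ h θ t
        have f2 := farDev_nonneg ψ h θ (-t)
        have h2 := abs_le_two_mul_chord htπ
        rw [abs_of_pos ht0] at h2
        have h4 : τ / chord t ^ 2 ≤ 4 * τ / t ^ 2 := by
          rw [div_le_div_iff₀ (by positivity) (by positivity)]
          calc τ * t ^ 2 ≤ τ * (2 * chord t) ^ 2 := by gcongr
            _ = _ := by ring
        calc _ ≤ 2 * (4 * τ / t ^ 2) := by
              refine mul_le_mul (by linarith) (hk.trans h4) (by positivity) (by positivity)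
          _ = 8 * τ * (1 / t ^ 2) := by ring
          _ ≤ _ := le_add_of_nonneg_right (by positivity)
      · rw [farDev_of_lt hcl, farDev_of_lt (t := -t) (by rwa [chord_neg]), chord_neg]
        calc _ ≤ (|logDev h θ t| + |logDev h θ (-t)|) * (τ / chord t ^ 2) := by gcongr
          _ = τ * (|logDev h θ t| / chord t ^ 2 + |logDev h θ (-t)| / chord t ^ 2) := by ring
          _ ≤ _ := le_add_of_nonneg_left (by positivity)
    have := intervalIntegral.integral_mono_on hlamπ hg3 (hinv.add (hf3.const_mul τ)) hle
    rw [intervalIntegral.integral_add hinv (hf3.const_mul τ), intervalIntegral.integral_const_mul,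
      intervalIntegral.integral_const_mul] at this
    refine this.trans (add_le_add ?_ ?_)
    · have hd : ∀ t ∈ uIcc lam Real.pi, HasDerivAt (fun t : ℝ => -(1 / t)) (1 / t ^ 2) t := by
        intro t ht
        rw [uIcc_of_le hlamπ] at ht
        have hne : t ≠ 0 := (hlam0.trans_le ht.1).ne'
        refine (((hasDerivAt_const t (1 : ℝ)).div (hasDerivAt_id' t) hne).neg).congr_deriv ?_
        field_simp
        ring
      have hint : IntervalIntegrable (fun t : ℝ => 1 / t ^ 2) volume lam Real.pi := by
        refine ContinuousOn.intervalIntegrable ?_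
        rw [uIcc_of_le hlamπ]
        exact ContinuousOn.div continuousOn_const (by fun_prop)
          fun t ht => pow_ne_zero _ (by linarith [ht.1])
      rw [intervalIntegral.integral_eq_sub_of_hasDerivAt hd hint]
      -- Monotonicity of ψ(t)/t between τ and λ, with ψ(λ) = H/(2L), turns τ/λ into a multiple of
      -- ψ(τ)/H.
      have h1 := S.modulus.mul_le_mul hτ.le hτr (by linarith [hr.2])
      rw [hψr] at h1
      have h2 : 0 ≤ 1 / Real.pi := by positivity
      calc 8 * τ * (-(1 / Real.pi) - -(1 / lam)) ≤ 8 * τ * (1 / lam) := by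
            gcongr; linarith
        _ = 16 * lipConst ψ h / (H * lam) * (H / (2 * lipConst ψ h) * τ) := by field_simp; ring
        _ ≤ 16 * lipConst ψ h / (H * lam) * (ψ τ * lam) := by gcongr
        _ = _ := by field_simp
    · gcongr
      rw [farInt, integral_neg_pos_eq hπ.le hfi]
      refine intervalIntegral.integral_mono_interval hlam0.le hlamπ le_rfl ?_ (i1.add i2)
      exact Eventually.of_forall fun t => add_nonneg (farDev_nonneg ψ h θ t)
        (farDev_nonneg ψ h θ (-t))
  calc _ ≤ 4 * lipConst ψ h * (ψ τ / H) + 16 * c * (ψ τ / H) +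
        (16 * lipConst ψ h * (ψ τ / H) + τ * farInt ψ h θ) := by linarith
    _ = _ := by ring

end Setting

/-! ### The odd part of log h and the boundary conjugate function. -/

/-- The odd part of `logDev`, up to a factor `2`. -/
def oddDev (h : Circle → ℝ) (θ t : ℝ) : ℝ := logDev h θ t - logDev h θ (-t)

lemma herglotz_im_neg (r t : ℝ) : (herglotz r (-t)).im = -(herglotz r t).im := by
  have h1 := norm_exp_sub_ofReal_sq r t
  have h2 := norm_exp_sub_ofReal_sq r (-t)
  rw [chord_neg] at h2
  rw [herglotz_im_ofReal, herglotz_im_ofReal, h1, h2, Real.sin_neg]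
  ring

lemma herglotz_conj_neg (w : ℂ) (t : ℝ) :
    herglotz ((starRingEnd ℂ) w) (-t) = (starRingEnd ℂ) (herglotz w t) := by
  simp only [herglotz, map_div₀, map_add, map_sub, ← Complex.exp_conj, map_mul, Complex.conj_I,
    Complex.conj_ofReal, Complex.ofReal_neg, neg_mul, mul_neg]

lemma norm_herglotz_sub_le {w w' : ℂ} {t δ m : ℝ} (hm : 0 < m)
    (h1 : m ≤ ‖Complex.exp (t * Complex.I) - w‖) (h2 : m ≤ ‖Complex.exp (t * Complex.I) - w'‖)
    (hww : ‖w - w'‖ ≤ δ) : ‖herglotz w t - herglotz w' t‖ ≤ 2 * δ / m ^ 2 := by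
  have n1 : Complex.exp (t * Complex.I) - w ≠ 0 := norm_pos_iff.1 (hm.trans_le h1)
  have n2 : Complex.exp (t * Complex.I) - w' ≠ 0 := norm_pos_iff.1 (hm.trans_le h2)
  have heq : herglotz w t - herglotz w' t = 2 * Complex.exp (t * Complex.I) * (w - w') /
      ((Complex.exp (t * Complex.I) - w) * (Complex.exp (t * Complex.I) - w')) := by
    rw [herglotz, herglotz]
    field_simp
    ring
  rw [heq, norm_div, norm_mul, norm_mul, norm_mul, Complex.norm_exp_ofReal_mul_I, sq]
  norm_num
  have : 0 ≤ δ := (norm_nonneg _).trans hww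
  gcongr

/-- Over a common denominator the numerator contains only w₁ + w₂ - 2w₀ and (w₁ - w₀)(w₂ - w₀), both
of order δ². -/
lemma norm_herglotz_second_diff_le {w₁ w₂ w₀ : ℂ} {t δ m : ℝ} (hm : 0 < m)
    (h1 : m ≤ ‖Complex.exp (t * Complex.I) - w₁‖) (h2 : m ≤ ‖Complex.exp (t * Complex.I) - w₂‖)
    (h0 : m ≤ ‖Complex.exp (t * Complex.I) - w₀‖) (hw₀ : ‖w₀‖ ≤ 1)
    (hd1 : ‖w₁ - w₀‖ ≤ δ) (hd2 : ‖w₂ - w₀‖ ≤ δ) (hdd : ‖w₁ + w₂ - 2 * w₀‖ ≤ δ ^ 2) :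
    ‖herglotz w₁ t + herglotz w₂ t - 2 * herglotz w₀ t‖ ≤ 8 * δ ^ 2 / m ^ 3 := by
  set e := Complex.exp (t * Complex.I)
  have n1 : e - w₁ ≠ 0 := norm_pos_iff.1 (hm.trans_le h1)
  have n2 : e - w₂ ≠ 0 := norm_pos_iff.1 (hm.trans_le h2)
  have n0 : e - w₀ ≠ 0 := norm_pos_iff.1 (hm.trans_le h0)
  have he : ‖e‖ = 1 := Complex.norm_exp_ofReal_mul_I t
  have heq : herglotz w₁ t + herglotz w₂ t - 2 * herglotz w₀ t =
      2 * e * ((w₁ + w₂ - 2 * w₀) * (e - w₀) - 2 * ((w₁ - w₀) * (w₂ - w₀))) /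
      ((e - w₁) * (e - w₂) * (e - w₀)) := by
    change (e + w₁) / (e - w₁) + (e + w₂) / (e - w₂) - 2 * ((e + w₀) / (e - w₀)) = _
    field_simp
    ring
  have hδ : 0 ≤ δ := (norm_nonneg _).trans hd1
  have hnum : ‖(w₁ + w₂ - 2 * w₀) * (e - w₀) - 2 * ((w₁ - w₀) * (w₂ - w₀))‖ ≤ 4 * δ ^ 2 := by
    refine (norm_sub_le _ _).trans ?_
    rw [norm_mul, norm_mul, norm_mul]
    have h3 : ‖e - w₀‖ ≤ 2 := (norm_sub_le _ _).trans (by linarith)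
    have h4 : ‖w₁ + w₂ - 2 * w₀‖ * ‖e - w₀‖ ≤ δ ^ 2 * 2 := by gcongr
    have h5 : ‖w₁ - w₀‖ * ‖w₂ - w₀‖ ≤ δ * δ := by gcongr
    norm_num
    nlinarith
  rw [heq, norm_div, norm_mul, norm_mul, norm_mul, norm_mul, he]
  norm_num
  calc _ ≤ 2 * (4 * δ ^ 2) / (m * m * m) := by gcongr
    _ = _ := by ring

namespace Setting

variable {ψ : ℝ → ℝ} {h : Circle → ℝ} (S : Setting ψ h)
include S

lemma oddDev_intervalIntegrable (θ : ℝ) : IntervalIntegrable (oddDev h θ) volume 0 Real.pi := by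
  obtain ⟨i1, i2⟩ := intervalIntegrable_fold Real.pi_pos.le (S.log.logDev θ (-Real.pi) Real.pi)
  exact i1.sub i2

lemma symmetryFirst_integral {θ s C : ℝ} (hs : 0 < s)
    (hsym : ∃ L : ℝ, Tendsto
      (fun ε : ℝ => ∫ t in ε..s, |h (Circle.exp (θ + t)) - h (Circle.exp (θ - t))| / t)
      (𝓝[>] 0) (𝓝 L) ∧ L ≤ C * ψ s) :
    IntervalIntegrable (fun t => |h (Circle.exp (θ + t)) - h (Circle.exp (θ - t))| / t)
      volume 0 s ∧
    ∫ t in (0 : ℝ)..s, |h (Circle.exp (θ + t)) - h (Circle.exp (θ - t))| / t ≤ C * ψ s := by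
  obtain ⟨L, hL, hLC⟩ := hsym
  have := intervalIntegrable_of_tendsto_integral hs (fun t ht => div_nonneg (abs_nonneg _) ht.1.le)
    ?_ hL
  · exact ⟨this.1, this.2.trans_le hLC⟩
  · refine ContinuousOn.div (Continuous.continuousOn ?_) continuousOn_id fun t ht => ht.1.ne'
    exact ((S.cont.comp (by fun_prop)).sub (S.cont.comp (by fun_prop))).abs

lemma abs_oddDev_div_le {θ s t : ℝ} (hθ : h (Circle.exp θ) ≠ 0)
    (hsr : s ≤ radius ψ h (Circle.exp θ)) (ht : t ∈ Ioc 0 s) :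
    |oddDev h θ t| / t ≤ 2 / h (Circle.exp θ) *
      (|h (Circle.exp (θ + t)) - h (Circle.exp (θ - t))| / t) := by
  have hp := S.pos hθ
  have hct : chord t ≤ radius ψ h (Circle.exp θ) := by
    have := chord_le_abs t
    rw [abs_of_pos ht.1] at this
    exact this.trans (ht.2.trans hsr)
  have p1 := S.half_le hct
  have p2 := S.half_le (θ := θ) (t := -t) (by rwa [chord_neg])
  have h1 := abs_log_sub_log_le (half_pos hp) p1 p2
  rw [oddDev, logDev, logDev, sub_sub_sub_cancel_right, sub_eq_add_neg θ]
  have ht0 := ht.1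
  calc _ ≤ |h (Circle.exp (θ + t)) - h (Circle.exp (θ + -t))| / (h (Circle.exp θ) / 2) / t := by
        gcongr
    _ = _ := by field_simp

lemma oddDev_div_integral {θ s C : ℝ} (hθ : h (Circle.exp θ) ≠ 0) (hs : 0 < s)
    (hsr : s ≤ radius ψ h (Circle.exp θ))
    (hsym : ∃ L : ℝ, Tendsto
      (fun ε : ℝ => ∫ t in ε..s, |h (Circle.exp (θ + t)) - h (Circle.exp (θ - t))| / t)
      (𝓝[>] 0) (𝓝 L) ∧ L ≤ C * ψ s) :
    IntervalIntegrable (fun t => |oddDev h θ t| / t) volume 0 s ∧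
    ∫ t in (0 : ℝ)..s, |oddDev h θ t| / t ≤ 2 * C * (ψ s / h (Circle.exp θ)) := by
  have hp := S.pos hθ
  obtain ⟨hi, hle⟩ := S.symmetryFirst_integral hs hsym
  have hsπ : s ≤ Real.pi := by
    linarith [(S.radius_spec (Circle.exp θ)).1.2, Real.pi_gt_three]
  have hodd : IntervalIntegrable (oddDev h θ) volume 0 s :=
    (S.oddDev_intervalIntegrable θ).mono_set (by
      rw [uIcc_of_le hs.le, uIcc_of_le Real.pi_pos.le]; exact Icc_subset_Icc_right hsπ)
  have hi2 : IntervalIntegrable (fun t => |oddDev h θ t| / t) volume 0 s := by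
    refine (hi.const_mul (2 / h (Circle.exp θ))).mono_fun ?_ ?_
    · exact AEStronglyMeasurable.mul (f := fun t => |oddDev h θ t|) (g := fun t : ℝ => t⁻¹)
        (intervalIntegrable_iff.1 hodd.norm).aestronglyMeasurable
        measurable_inv.aestronglyMeasurable
    · rw [uIoc_of_le hs.le]
      filter_upwards [ae_restrict_mem measurableSet_Ioc] with t ht
      rw [Real.norm_of_nonneg (div_nonneg (abs_nonneg _) ht.1.le)]
      exact (S.abs_oddDev_div_le hθ hsr ht).trans (le_abs_self _)
  refine ⟨hi2, ?_⟩
  have := intervalIntegral.integral_mono_on_of_le_Ioo hs.le hi2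
    (hi.const_mul (2 / h (Circle.exp θ)))
    fun t ht => S.abs_oddDev_div_le hθ hsr ⟨ht.1, ht.2.le⟩
  rw [intervalIntegral.integral_const_mul] at this
  refine this.trans ?_
  calc _ ≤ 2 / h (Circle.exp θ) * (C * ψ s) := by gcongr
    _ = _ := by ring

/-- Near 0 the cotangent is at most 4/t, so integrability of |odd part|/t suffices; away from 0 it
is continuous. -/
lemma oddDev_mul_inv_tan_intervalIntegrable {θ s : ℝ} (hs : 0 < s) (hsπ : s ≤ Real.pi)
    (hi : IntervalIntegrable (fun t => |oddDev h θ t| / t) volume 0 s) :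
    IntervalIntegrable (fun t => oddDev h θ t * (Real.tan (t / 2))⁻¹) volume 0 Real.pi := by
  have hodd := S.oddDev_intervalIntegrable θ
  have sub1 : uIcc 0 s ⊆ uIcc 0 Real.pi := by
    rw [uIcc_of_le hs.le, uIcc_of_le Real.pi_pos.le]; exact Icc_subset_Icc_right hsπ
  have sub2 : uIcc s Real.pi ⊆ uIcc 0 Real.pi := by
    rw [uIcc_of_le hsπ, uIcc_of_le Real.pi_pos.le]; exact Icc_subset_Icc_left hs.le
  have hct : ContinuousOn (fun t : ℝ => (Real.tan (t / 2))⁻¹) (Ioc 0 s) :=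
    inv_tan_half_continuousOn.mono (Ioc_subset_Ioc_right hsπ)
  refine IntervalIntegrable.trans (b := s) ?_ ?_
  · refine (hi.const_mul 4).mono_fun ?_ ?_
    · rw [uIoc_of_le hs.le]
      refine AEStronglyMeasurable.mul ?_ (hct.aestronglyMeasurable measurableSet_Ioc)
      exact ((intervalIntegrable_iff_integrableOn_Ioc_of_le hs.le).1
        (hodd.mono_set sub1)).aestronglyMeasurable
    · rw [uIoc_of_le hs.le]
      filter_upwards [ae_restrict_mem measurableSet_Ioc] with t ht
      have ht0 := ht.1
      have htπ : |t| ≤ Real.pi := by rw [abs_of_pos ht0]; exact ht.2.trans hsπ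
      have hc := chord_pos htπ ht0.ne'
      have h2 := abs_le_two_mul_chord htπ
      rw [abs_of_pos ht0] at h2
      have h3 : |(Real.tan (t / 2))⁻¹| ≤ 4 / t := by
        rw [inv_tan_half_eq hc.ne', abs_div, abs_mul, abs_two, abs_of_pos (by positivity :
          0 < chord t ^ 2), div_le_div_iff₀ (by positivity) ht0]
        calc 2 * |Real.sin t| * t ≤ 2 * chord t * (2 * chord t) := by
              gcongr; exact abs_sin_le_chord t
          _ = _ := by ring
      rw [norm_mul, Real.norm_of_nonneg (by positivity : 0 ≤ 4 * (|oddDev h θ t| / t)),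
        Real.norm_eq_abs, Real.norm_eq_abs]
      calc _ ≤ |oddDev h θ t| * (4 / t) := by gcongr
        _ = _ := by ring
  · refine (hodd.mono_set sub2).mul_continuousOn (inv_tan_half_continuousOn.mono ?_)
    rw [uIcc_of_le hsπ]
    exact fun t ht => ⟨hs.trans_le ht.1, ht.2⟩

/-- The principal value defining `v_h` on the circle, as a convergent integral. -/
lemma vBoundary_eq {θ : ℝ}
    (hi : IntervalIntegrable (fun t => oddDev h θ t * (Real.tan (t / 2))⁻¹) volume 0 Real.pi) :
    vBoundary h θ =
      -(1 / (2 * Real.pi) * ∫ t in (0 : ℝ)..Real.pi, oddDev h θ t * (Real.tan (t / 2))⁻¹) := by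
  have hπ := Real.pi_pos
  rw [vBoundary]
  congr 1
  refine Tendsto.limUnder_eq ?_
  refine ((tendsto_integral_left hπ hi).const_mul (1 / (2 * Real.pi))).congr' ?_
  filter_upwards [Ioc_mem_nhdsGT hπ] with ε hε
  congr 1
  have hsubset : uIcc ε Real.pi ⊆ Ioc 0 Real.pi := by
    rw [uIcc_of_le hε.2]; exact fun t ht => ⟨hε.1.trans_le ht.1, ht.2⟩
  have hct := inv_tan_half_continuousOn.mono hsubset
  have hi1 : IntervalIntegrable (fun t => Real.log (h (Circle.exp (θ + t))) *
      (Real.tan (t / 2))⁻¹) volume ε Real.pi :=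
    (S.log.intervalIntegrable_shift θ ε Real.pi).mul_continuousOn hct
  have hi2 : IntervalIntegrable (fun t => Real.log (h (Circle.exp (θ + -t))) *
      (Real.tan (t / 2))⁻¹) volume ε Real.pi := by
    refine IntervalIntegrable.mul_continuousOn ?_ hct
    have := (S.log.intervalIntegrable_shift θ (-ε) (-Real.pi)).comp_mul_left (c := -1)
    simpa using this
  -- Reflecting the negative half leaves only the odd part of log h against the cotangent, and the
  -- constant log h(e^{iθ}) cancels.
  have e1 : ∫ t in (-Real.pi)..(-ε), Real.log (h (Circle.exp (θ + t))) / Real.tan (t / 2) =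
      ∫ t in ε..Real.pi, -(Real.log (h (Circle.exp (θ + -t))) * (Real.tan (t / 2))⁻¹) := by
    rw [← intervalIntegral.integral_comp_neg]
    refine intervalIntegral.integral_congr fun t _ => ?_
    simp only [neg_div, Real.tan_neg]
    rw [div_neg, div_eq_mul_inv]
  rw [e1, add_comm, intervalIntegral.integral_neg]
  simp_rw [div_eq_mul_inv (Real.log _)]
  rw [← sub_eq_add_neg, ← intervalIntegral.integral_sub hi1 hi2]
  refine intervalIntegral.integral_congr fun t _ => ?_
  simp only [oddDev, logDev]
  ring

lemma v_real_eq {r : ℝ} (hr : |r| < 1) (θ : ℝ) :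
    v h (Circle.exp θ * r) = 1 / (2 * Real.pi) *
      ∫ t in (0 : ℝ)..Real.pi, oddDev h θ t * (herglotz r t).im := by
  have hr' : ‖(r : ℂ)‖ < 1 := by rwa [Complex.norm_real]
  rw [S.log.v_rotate hr', integral_neg_pos_eq Real.pi_pos.le]
  · congr 1
    refine intervalIntegral.integral_congr fun t _ => ?_
    simp only [herglotz_im_neg, oddDev]
    ring
  · exact (S.log.logDev θ _ _).continuousOn_mul
      (Complex.continuous_im.comp (continuous_herglotz hr')).continuousOn

/-- Both sides integrate the odd part, against kernels whose difference is `conjDiff`. Up to τ its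
bound 36/t meets the first symmetry condition; beyond τ it is cubic. The odd part is unchanged by
subtracting a constant from g, so `c` is free; this permits recentring at another boundary point. -/
lemma abs_v_sub_vBoundary_le {θ τ C : ℝ} (hθ : h (Circle.exp θ) ≠ 0) (hτ : 0 < τ)
    (hτr : τ ≤ radius ψ h (Circle.exp θ))
    (hsym : ∃ L : ℝ, Tendsto
      (fun ε : ℝ => ∫ t in ε..τ, |h (Circle.exp (θ + t)) - h (Circle.exp (θ - t))| / t)
      (𝓝[>] 0) (𝓝 L) ∧ L ≤ C * ψ τ) (c : ℝ) :
    |v h (Circle.exp θ * ((1 - τ : ℝ) : ℂ)) - vBoundary h θ| ≤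
      72 * C * (ψ τ / h (Circle.exp θ)) +
      54 * ∫ t in (-Real.pi)..Real.pi, |logDev h θ t - c| * (τ ^ 2 / (τ + chord t) ^ 3) := by
  have hπ := Real.pi_pos
  have hτ1 : τ ≤ 1 := hτr.trans (S.radius_spec _).1.2
  have hτπ : τ ≤ Real.pi := hτ1.trans (by linarith [Real.pi_gt_three])
  obtain ⟨i1, b1⟩ := S.oddDev_div_integral hθ hτ hτr hsym
  have i2 := S.oddDev_mul_inv_tan_intervalIntegrable hτ hτπ i1
  have hr1 : |1 - τ| < 1 := by rw [abs_lt]; constructor <;> linarith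
  have hr' : ‖((1 - τ : ℝ) : ℂ)‖ < 1 := by rwa [Complex.norm_real]
  have hodd := S.oddDev_intervalIntegrable θ
  have hcK : Continuous fun t => (herglotz ((1 - τ : ℝ) : ℂ) t).im :=
    Complex.continuous_im.comp (continuous_herglotz hr')
  have i3 := hodd.mul_continuousOn hcK.continuousOn
  have hdiff : v h (Circle.exp θ * ((1 - τ : ℝ) : ℂ)) - vBoundary h θ =
      1 / (2 * Real.pi) * ∫ t in (0 : ℝ)..Real.pi, oddDev h θ t * conjDiff τ t := by
    rw [S.v_real_eq hr1, S.vBoundary_eq i2, sub_neg_eq_add, ← mul_add, add_comm,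
      ← intervalIntegral.integral_add i2 i3]
    simp only [conjDiff, mul_add]
  have i4 : IntervalIntegrable (fun t => |oddDev h θ t * conjDiff τ t|) volume 0 Real.pi := by
    have := (i2.add i3).abs
    refine this.congr fun t _ => ?_
    simp only [conjDiff, mul_add]
  have sub1 : uIcc 0 τ ⊆ uIcc 0 Real.pi := by
    rw [uIcc_of_le hτ.le, uIcc_of_le hπ.le]; exact Icc_subset_Icc_right hτπ
  have sub2 : uIcc τ Real.pi ⊆ uIcc 0 Real.pi := by
    rw [uIcc_of_le hτπ, uIcc_of_le hπ.le]; exact Icc_subset_Icc_left hτ.le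
  have hk := continuous_const_div_add_chord_pow hτ (τ ^ 2) 3
  have i5 : IntervalIntegrable (fun t => |oddDev h θ t| * (τ ^ 2 / (τ + chord t) ^ 3))
      volume 0 Real.pi := hodd.abs.mul_continuousOn hk.continuousOn
  have near : ∫ t in (0 : ℝ)..τ, |oddDev h θ t * conjDiff τ t| ≤
      72 * C * (ψ τ / h (Circle.exp θ)) := by
    have := intervalIntegral.integral_mono_on_of_le_Ioo hτ.le (i4.mono_set sub1) (i1.const_mul 36)
      fun t ht => by
        rw [abs_mul]
        calc |oddDev h θ t| * |conjDiff τ t| ≤ |oddDev h θ t| * (36 / t) := by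
              gcongr
              exact abs_conjDiff_le_near hτ hτ1 ht.1 (ht.2.le.trans hτπ)
          _ = 36 * (|oddDev h θ t| / t) := by ring
    rw [intervalIntegral.integral_const_mul] at this
    linarith
  have far : ∫ t in τ..Real.pi, |oddDev h θ t * conjDiff τ t| ≤
      54 * ∫ t in (0 : ℝ)..Real.pi, |oddDev h θ t| * (τ ^ 2 / (τ + chord t) ^ 3) := by
    have := intervalIntegral.integral_mono_on hτπ (i4.mono_set sub2)
      ((i5.mono_set sub2).const_mul 54) fun t ht => by
        rw [abs_mul]
        calc |oddDev h θ t| * |conjDiff τ t| ≤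
              |oddDev h θ t| * (54 * (τ ^ 2 / (τ + chord t) ^ 3)) := by
              gcongr
              exact abs_conjDiff_le_far hτ hτ1 ht.1 ht.2
          _ = 54 * (|oddDev h θ t| * (τ ^ 2 / (τ + chord t) ^ 3)) := by ring
    rw [intervalIntegral.integral_const_mul] at this
    refine this.trans (mul_le_mul_of_nonneg_left ?_ (by norm_num))
    refine intervalIntegral.integral_mono_interval hτ.le hτπ le_rfl
      (Eventually.of_forall fun t => ?_) i5
    have := chord_nonneg t
    positivity
  have fold : ∫ t in (0 : ℝ)..Real.pi, |oddDev h θ t| * (τ ^ 2 / (τ + chord t) ^ 3) ≤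
      ∫ t in (-Real.pi)..Real.pi, |logDev h θ t - c| * (τ ^ 2 / (τ + chord t) ^ 3) := by
    have i6 : IntervalIntegrable (fun t => |logDev h θ t - c| * (τ ^ 2 / (τ + chord t) ^ 3))
        volume (-Real.pi) Real.pi :=
      ((S.log.logDev θ _ _).sub intervalIntegrable_const).abs.mul_continuousOn hk.continuousOn
    rw [integral_neg_pos_eq hπ.le i6]
    obtain ⟨i7, i8⟩ := intervalIntegrable_fold hπ.le i6
    refine intervalIntegral.integral_mono_on hπ.le i5 (i7.add i8) fun t _ => ?_
    rw [chord_neg, ← add_mul]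
    have hcn := chord_nonneg t
    gcongr
    rw [oddDev, show logDev h θ t - logDev h θ (-t) =
      (logDev h θ t - c) - (logDev h θ (-t) - c) by ring]
    exact abs_sub _ _
  have tot : |∫ t in (0 : ℝ)..Real.pi, oddDev h θ t * conjDiff τ t| ≤
      72 * C * (ψ τ / h (Circle.exp θ)) +
      54 * ∫ t in (-Real.pi)..Real.pi, |logDev h θ t - c| * (τ ^ 2 / (τ + chord t) ^ 3) := by
    refine (intervalIntegral.abs_integral_le_integral_abs hπ.le).trans ?_
    rw [← intervalIntegral.integral_add_adjacent_intervals (i4.mono_set sub1) (i4.mono_set sub2)]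
    linarith
  rw [hdiff, abs_mul, abs_of_pos (by positivity)]
  refine (mul_le_of_le_one_left (abs_nonneg _) ?_).trans tot
  rw [div_le_one (by positivity)]
  linarith [Real.pi_gt_three]

/-- A shift by at most τ changes τ + d by a factor of at most 2, hence the cubic kernel by at most
2³. -/
lemma integral_logDev_shift_le {θ σ τ : ℝ} (hτ : 0 < τ) (hστ : chord σ ≤ τ) :
    ∫ t in (-Real.pi)..Real.pi, |logDev h θ (σ + t)| * (τ ^ 2 / (τ + chord t) ^ 3) ≤
      8 * ∫ t in (-Real.pi)..Real.pi, |logDev h θ t| * (τ ^ 2 / (τ + chord t) ^ 3) := by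
  have hπ := Real.pi_pos
  have hk := continuous_const_div_add_chord_pow hτ (τ ^ 2) 3
  set f : ℝ → ℝ := fun t => |logDev h θ t| * (τ ^ 2 / (τ + chord t) ^ 3) with hf
  have hper : Function.Periodic f (2 * Real.pi) := fun t => by
    simp only [hf, logDev_periodic h θ t, chord_periodic t]
  have hfi : ∀ a b, IntervalIntegrable f volume a b := fun a b =>
    (S.log.logDev θ a b).abs.mul_continuousOn hk.continuousOn
  have hshift : ∀ a b, IntervalIntegrable (fun t => |logDev h θ (σ + t)|) volume a b := fun a b => by
    have := ((S.log.logDev θ (σ + a) (σ + b)).comp_add_left σ).abs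
    simpa using this
  have h1 := hper.intervalIntegral_add_eq (-Real.pi) (σ + -Real.pi)
  rw [show -Real.pi + 2 * Real.pi = Real.pi by ring,
    show σ + -Real.pi + 2 * Real.pi = σ + Real.pi by ring,
    ← intervalIntegral.integral_comp_add_left] at h1
  rw [h1, ← intervalIntegral.integral_const_mul]
  have hfs : IntervalIntegrable (fun t => 8 * f (σ + t)) volume (-Real.pi) Real.pi := by
    have := ((hfi (σ + -Real.pi) (σ + Real.pi)).comp_add_left σ).const_mul 8
    simpa using this
  refine intervalIntegral.integral_mono_on (by linarith)
    ((hshift _ _).mul_continuousOn hk.continuousOn) hfs fun t _ => ?_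
  have d0 := chord_nonneg t
  have d1 := chord_nonneg (σ + t)
  have d2 := chord_add_le σ t
  have : τ ^ 2 / (τ + chord t) ^ 3 ≤ 8 * (τ ^ 2 / (τ + chord (σ + t)) ^ 3) := by
    rw [← mul_div_assoc, div_le_div_iff₀ (by positivity) (by positivity)]
    calc τ ^ 2 * (τ + chord (σ + t)) ^ 3 ≤ τ ^ 2 * (2 * (τ + chord t)) ^ 3 := by
          gcongr; linarith
      _ = _ := by ring
  calc _ ≤ |logDev h θ (σ + t)| * (8 * (τ ^ 2 / (τ + chord (σ + t)) ^ 3)) := by gcongr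
    _ = _ := by simp only [hf]; ring

/-- Averaging over the conjugate points w₁ = re^{iσ} and w₂ = re^{-iσ} splits the kernel difference
between w₁ and w₀ = r into half a first difference, which is even in t and so sees only g(t) +
g(-t), and half a second difference, of cubic decay. -/
lemma abs_v_rotate_sub_le {θ σ τ : ℝ} (hτ : 0 < τ) (hτ1 : τ ≤ 1) (hστ : chord σ ≤ τ) :
    |v h (Circle.exp (θ + σ) * ((1 - τ : ℝ) : ℂ)) - v h (Circle.exp θ * ((1 - τ : ℝ) : ℂ))| ≤
      32 * (∫ t in (0 : ℝ)..Real.pi, |logDev h θ t + logDev h θ (-t)| *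
        (τ / (τ + chord t) ^ 2)) +
      256 * ∫ t in (-Real.pi)..Real.pi, |logDev h θ t| * (τ ^ 2 / (τ + chord t) ^ 3) := by
  have hπ := Real.pi_pos
  set r : ℝ := 1 - τ with hr
  have hr0 : 0 ≤ r := by linarith
  set w₀ : ℂ := (r : ℂ) with hw₀
  set w₁ : ℂ := r * Complex.exp (σ * Complex.I) with hw₁
  set w₂ : ℂ := (starRingEnd ℂ) w₁ with hw₂
  have hw₂' : w₂ = r * Complex.exp ((-σ : ℝ) * Complex.I) := by
    rw [hw₂, hw₁, map_mul, Complex.conj_ofReal, ← Complex.exp_conj, map_mul, Complex.conj_I,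
      Complex.conj_ofReal]
    push_cast
    ring_nf
  have n0 : ‖w₀‖ = r := by rw [hw₀, Complex.norm_real, Real.norm_of_nonneg hr0]
  have n1 : ‖w₁‖ = r := by
    rw [hw₁, norm_mul, Complex.norm_exp_ofReal_mul_I, mul_one]; exact n0
  have n2 : ‖w₂‖ = r := by rw [hw₂, Complex.norm_conj, n1]
  have hr1 : r < 1 := by linarith
  have d10 : ‖w₁ - w₀‖ ≤ τ := by
    rw [hw₁, hw₀, ← mul_sub_one, norm_mul, n0, ← chord]
    nlinarith [chord_nonneg σ]
  have d20 : ‖w₂ - w₀‖ ≤ τ := by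
    rw [hw₂', hw₀, ← mul_sub_one, norm_mul, n0, ← chord, chord_neg]
    nlinarith [chord_nonneg σ]
  have d12 : ‖w₁ - w₂‖ ≤ 2 * τ := by
    rw [show w₁ - w₂ = (w₁ - w₀) - (w₂ - w₀) by ring]
    exact (norm_sub_le _ _).trans (by linarith)
  -- The first-order terms cancel by conjugate symmetry: the sum equals -r d(σ)².
  have ddd : ‖w₁ + w₂ - 2 * w₀‖ ≤ τ ^ 2 := by
    have : w₁ + w₂ - 2 * w₀ = ((-(r * chord σ ^ 2) : ℝ) : ℂ) := by
      rw [hw₂, Complex.add_conj, chord_sq, hw₁, Complex.re_ofReal_mul,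
        Complex.exp_ofReal_mul_I_re, hw₀]
      push_cast
      ring
    rw [this, Complex.norm_real, norm_neg, Real.norm_of_nonneg (by positivity)]
    have : chord σ ^ 2 ≤ τ ^ 2 := by
      have := chord_nonneg σ
      gcongr
    nlinarith [sq_nonneg (chord σ)]
  have d0 : ‖w₀ - 1‖ ≤ τ := by
    rw [hw₀, ← Complex.ofReal_one, ← Complex.ofReal_sub, Complex.norm_real, hr]
    simp [abs_of_pos hτ]
  have key : ∀ w : ℂ, ‖w‖ = r → ‖w - w₀‖ ≤ τ → ∀ t : ℝ,
      (τ + chord t) / 4 ≤ ‖Complex.exp (t * Complex.I) - w‖ := by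
    intro w hw hww t
    have := add_chord_le_of_norm_sub_one_le (τ := τ) (c := 2) hw.le (by
      rw [show w - 1 = (w - w₀) + (w₀ - 1) by ring]
      exact (norm_add_le _ _).trans (by linarith)) zero_le_two t
    linarith
  have k0 := key w₀ n0 (by simp [hτ.le])
  have k1 := key w₁ n1 d10
  have k2 := key w₂ n2 d20
  have m : ∀ t, 0 < (τ + chord t) / 4 := fun t => by linarith [chord_nonneg t]
  set ev : ℝ → ℝ := fun t => ((herglotz w₁ t).im - (herglotz w₂ t).im) / 2 with hev
  set od : ℝ → ℝ := fun t =>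
    ((herglotz w₁ t).im + (herglotz w₂ t).im - 2 * (herglotz w₀ t).im) / 2 with hod
  have hevb : ∀ t, |ev t| ≤ 32 * (τ / (τ + chord t) ^ 2) := fun t => by
    have h1 := norm_herglotz_sub_le (m t) (k1 t) (k2 t) d12
    have h2 := (Complex.abs_im_le_norm _).trans h1
    rw [Complex.sub_im] at h2
    rw [hev, abs_div, abs_two]
    have h3 : 2 * (2 * τ) / ((τ + chord t) / 4) ^ 2 = 64 * (τ / (τ + chord t) ^ 2) := by
      have := m t
      field_simp
      norm_num
    linarith
  have hodb : ∀ t, |od t| ≤ 256 * (τ ^ 2 / (τ + chord t) ^ 3) := fun t => by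
    have h1 := norm_herglotz_second_diff_le (m t) (k1 t) (k2 t) (k0 t) (by linarith) d10 d20 ddd
    have h2 := (Complex.abs_im_le_norm _).trans h1
    rw [Complex.sub_im, Complex.add_im,
      show (2 : ℂ) = ((2 : ℝ) : ℂ) by norm_num, Complex.im_ofReal_mul] at h2
    rw [hod, abs_div, abs_two]
    have h3 : 8 * τ ^ 2 / ((τ + chord t) / 4) ^ 3 = 512 * (τ ^ 2 / (τ + chord t) ^ 3) := by
      have := m t
      field_simp
      norm_num
    linarith
  -- Conjugating w and reflecting t conjugates the kernel, so its imaginary part changes sign; this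
  -- makes `ev` even.
  have hconj1 : ∀ t, (herglotz w₂ (-t)).im = -(herglotz w₁ t).im := fun t => by
    rw [hw₂, herglotz_conj_neg, Complex.conj_im]
  have hconj2 : ∀ t, (herglotz w₁ (-t)).im = -(herglotz w₂ t).im := fun t => by
    rw [← Complex.conj_conj w₁, ← hw₂, herglotz_conj_neg, Complex.conj_im]
  have hev_even : ∀ t, ev (-t) = ev t := fun t => by
    simp only [hev, hconj1, hconj2]; ring
  have c0 : Continuous fun t => (herglotz w₀ t).im :=
    Complex.continuous_im.comp (continuous_herglotz (by linarith))
  have c1 : Continuous fun t => (herglotz w₁ t).im :=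
    Complex.continuous_im.comp (continuous_herglotz (by linarith))
  have c2 : Continuous fun t => (herglotz w₂ t).im :=
    Complex.continuous_im.comp (continuous_herglotz (by linarith))
  have cev : Continuous ev := (c1.sub c2).div_const 2
  have cod : Continuous od := ((c1.add c2).sub (c0.const_mul 2)).div_const 2
  have hg := S.log.logDev θ (-Real.pi) Real.pi
  have i1 := hg.continuousOn_mul c1.continuousOn
  have i0 := hg.continuousOn_mul c0.continuousOn
  have ie := hg.continuousOn_mul cev.continuousOn
  have io := hg.continuousOn_mul cod.continuousOn
  have hv : v h (Circle.exp (θ + σ) * (r : ℂ)) - v h (Circle.exp θ * (r : ℂ)) =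
      1 / (2 * Real.pi) * ((∫ t in (0 : ℝ)..Real.pi, ev t * (logDev h θ t + logDev h θ (-t))) +
        ∫ t in (-Real.pi)..Real.pi, od t * logDev h θ t) := by
    have e1 : (Circle.exp (θ + σ) : ℂ) * r = Circle.exp θ * w₁ := by
      rw [Circle.exp_add, Circle.coe_mul, Circle.coe_exp σ, hw₁]; ring
    rw [e1, S.log.v_rotate (by linarith), S.log.v_rotate (w := (r : ℂ)) (by rw [← hw₀]; linarith),
      ← mul_sub, ← intervalIntegral.integral_sub i1 i0]
    have e2 : ∫ t in (0 : ℝ)..Real.pi, ev t * (logDev h θ t + logDev h θ (-t)) =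
        ∫ t in (-Real.pi)..Real.pi, ev t * logDev h θ t := by
      rw [integral_neg_pos_eq hπ.le ie]
      refine intervalIntegral.integral_congr fun t _ => ?_
      simp only [hev_even]
      ring
    rw [e2, ← intervalIntegral.integral_add ie io]
    congr 1
    refine intervalIntegral.integral_congr fun t _ => ?_
    simp only [hev, hod]
    ring
  have b1 : |∫ t in (0 : ℝ)..Real.pi, ev t * (logDev h θ t + logDev h θ (-t))| ≤
      32 * ∫ t in (0 : ℝ)..Real.pi, |logDev h θ t + logDev h θ (-t)| *
        (τ / (τ + chord t) ^ 2) := by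
    obtain ⟨j1, j2⟩ := intervalIntegrable_fold hπ.le hg
    have j3 := (j1.add j2).continuousOn_mul cev.continuousOn
    refine (intervalIntegral.abs_integral_le_integral_abs hπ.le).trans ?_
    rw [← intervalIntegral.integral_const_mul]
    refine intervalIntegral.integral_mono_on hπ.le j3.abs (((j1.add j2).abs.mul_continuousOn
      (continuous_const_div_add_chord_pow hτ τ 2).continuousOn).const_mul 32) fun t _ => ?_
    rw [abs_mul]
    calc _ ≤ 32 * (τ / (τ + chord t) ^ 2) * |logDev h θ t + logDev h θ (-t)| := by
          gcongr; exact hevb t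
      _ = _ := by ring
  have b2 : |∫ t in (-Real.pi)..Real.pi, od t * logDev h θ t| ≤
      256 * ∫ t in (-Real.pi)..Real.pi, |logDev h θ t| * (τ ^ 2 / (τ + chord t) ^ 3) := by
    refine (intervalIntegral.abs_integral_le_integral_abs (by linarith)).trans ?_
    rw [← intervalIntegral.integral_const_mul]
    refine intervalIntegral.integral_mono_on (by linarith) io.abs ((hg.abs.mul_continuousOn
      (continuous_const_div_add_chord_pow hτ (τ ^ 2) 3).continuousOn).const_mul 256) fun t _ => ?_
    rw [abs_mul]
    calc _ ≤ 256 * (τ ^ 2 / (τ + chord t) ^ 3) * |logDev h θ t| := by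
          gcongr; exact hodb t
      _ = _ := by ring
  rw [hv, abs_mul, abs_of_pos (by positivity)]
  refine (mul_le_of_le_one_left (abs_nonneg _) ?_).trans
    ((abs_add_le _ _).trans (add_le_add b1 b2))
  rw [div_le_one (by positivity)]
  linarith [Real.pi_gt_three]

/-- The boundary conjugate function at two nearby points. -/
theorem abs_vBoundary_sub_le {θ φ C c : ℝ} (hC : 0 < C)
    (hsym₁ : ∀ θ s : ℝ, h (Circle.exp θ) ≠ 0 → 0 < s → s ≤ radius ψ h (Circle.exp θ) →
      ∃ L : ℝ, Tendsto
        (fun ε : ℝ => ∫ t in ε..s, |h (Circle.exp (θ + t)) - h (Circle.exp (θ - t))| / t)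
        (𝓝[>] 0) (𝓝 L) ∧ L ≤ C * ψ s)
    (hsym₂ : ∀ θ s : ℝ, h (Circle.exp θ) ≠ 0 → 0 < s → s ≤ radius ψ h (Circle.exp θ) →
      1 / h (Circle.exp θ) * ∫ t in s..radius ψ h (Circle.exp θ),
        |h (Circle.exp (θ + t)) * h (Circle.exp (θ - t)) - h (Circle.exp θ) ^ 2| / t ^ 2
      ≤ c * (ψ s / s))
    (hθ : h (Circle.exp θ) ≠ 0) (hτ : 0 < chord (φ - θ))
    (hτθ : chord (φ - θ) ≤ radius ψ h (Circle.exp θ))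
    (hτφ : chord (φ - θ) ≤ radius ψ h (Circle.exp φ))
    (hφ : h (Circle.exp θ) / 2 ≤ h (Circle.exp φ)) :
    |vBoundary h φ - vBoundary h θ| ≤
      (216 * C + 6576 * lipConst ψ h + 512 * c) * (ψ (chord (φ - θ)) / h (Circle.exp θ)) +
      774 * (chord (φ - θ) * farInt ψ h θ) := by
  have hp := S.pos hθ
  have hφ0 : h (Circle.exp φ) ≠ 0 := by linarith
  set σ := φ - θ with hσ
  set τ := chord σ with hτd
  have hφσ : φ = θ + σ := by rw [hσ]; ring
  have hτ1 : τ ≤ 1 := hτθ.trans (S.radius_spec _).1.2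
  have hψτ := S.modulus.pos hτ (by linarith)
  have e1 := S.integral_logDev_cube_le hθ hτ (by linarith)
  have e2 := S.integral_even_le hθ hτ hτθ (hsym₂ θ τ hθ hτ hτθ)
  have e3 := S.abs_v_sub_vBoundary_le hθ hτ hτθ (hsym₁ θ τ hθ hτ hτθ) 0
  -- With this constant the deviation from φ becomes the shifted deviation from θ, so that every
  -- integral refers to the base point θ.
  have e4 := S.abs_v_sub_vBoundary_le hφ0 hτ hτφ (hsym₁ φ τ hφ0 hτ hτφ) (-logDev h θ σ)
  have e5 := S.abs_v_rotate_sub_le (θ := θ) hτ hτ1 (le_refl (chord σ))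
  have e6 := S.integral_logDev_shift_le (θ := θ) hτ (le_refl (chord σ))
  rw [← hφσ] at e5
  have e7 : ∀ t, logDev h φ t - -logDev h θ σ = logDev h θ (σ + t) := fun t => by
    simp only [logDev, ← hφσ, ← add_assoc]; ring
  simp only [e7, sub_zero] at e3 e4
  have e8 : 72 * C * (ψ τ / h (Circle.exp φ)) ≤ 144 * C * (ψ τ / h (Circle.exp θ)) := by
    calc 72 * C * (ψ τ / h (Circle.exp φ)) ≤ 72 * C * (ψ τ / (h (Circle.exp θ) / 2)) := by
          gcongr
      _ = _ := by field_simp; norm_num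
  -- The cubic integral occurs 54 + 54·8 + 256 = 742 times and the even one 32 times. This gives 72
  -- + 144 = 216, 742·8 + 32·20 = 6576, 32·16 = 512 and 742 + 32 = 774.
  rw [abs_le] at e3 e4 e5 ⊢
  constructor <;> nlinarith

end Setting

/-! ### Poisson kernel estimates, radial limits and the bound for a_h. -/

lemma tendsto_one_sub_nhdsLT : Tendsto (fun r : ℝ => 1 - r) (𝓝[<] 1) (𝓝[>] 0) := by
  refine tendsto_nhdsWithin_iff.2 ⟨?_, ?_⟩
  · have : Tendsto (fun r : ℝ => 1 - r) (𝓝 1) (𝓝 (1 - 1)) := tendsto_const_nhds.sub tendsto_id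
    rw [sub_self] at this
    exact this.mono_left nhdsWithin_le_nhds
  · filter_upwards [self_mem_nhdsWithin] with r hr
    exact sub_pos.2 (mem_Iio.1 hr)

lemma norm_one_sub_lt {τ : ℝ} (h0 : 0 < τ) (h1 : τ ≤ 1) : ‖((1 - τ : ℝ) : ℂ)‖ < 1 := by
  rw [Complex.norm_real, Real.norm_of_nonneg (by linarith)]
  linarith

lemma add_chord_le_three_mul {τ : ℝ} (h0 : 0 < τ) (h1 : τ ≤ 1) (t : ℝ) :
    τ + chord t ≤ 3 * ‖Complex.exp (t * Complex.I) - ((1 - τ : ℝ) : ℂ)‖ := by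
  have := add_chord_le_of_norm_sub_one_le (w := ((1 - τ : ℝ) : ℂ)) (τ := τ) (c := 1) ?_ ?_
    zero_le_one t
  · linarith
  · rw [Complex.norm_real, Real.norm_of_nonneg (by linarith)]
  · rw [← Complex.ofReal_one, ← Complex.ofReal_sub, Complex.norm_real]
    simp [abs_of_pos h0]

lemma herglotz_re_le {τ : ℝ} (h0 : 0 < τ) (h1 : τ ≤ 1) (t : ℝ) :
    (herglotz ((1 - τ : ℝ) : ℂ) t).re ≤ 18 * (τ / (τ + chord t) ^ 2) := by
  have h3 := add_chord_le_three_mul h0 h1 t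
  have hd := chord_nonneg t
  rw [herglotz_re, Complex.norm_real, Real.norm_of_nonneg (by linarith), ← mul_div_assoc,
    div_le_div_iff₀ (by nlinarith) (by positivity)]
  calc (1 - (1 - τ) ^ 2) * (τ + chord t) ^ 2
      ≤ (2 * τ) * (3 * ‖Complex.exp (t * Complex.I) - ((1 - τ : ℝ) : ℂ)‖) ^ 2 := by
        gcongr
        nlinarith
    _ = _ := by ring

lemma herglotz_re_nonneg {w : ℂ} (hw : ‖w‖ < 1) (t : ℝ) : 0 ≤ (herglotz w t).re := by
  rw [herglotz_re]
  have : ‖w‖ ^ 2 ≤ 1 := pow_le_one₀ (norm_nonneg _) hw.le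
  exact div_nonneg (by linarith) (by positivity)

lemma le_herglotz_re {τ t : ℝ} (h0 : 0 < τ) (h1 : τ ≤ 1) (ht : τ ≤ chord t) :
    τ / chord t ^ 2 ≤ 4 * (herglotz ((1 - τ : ℝ) : ℂ) t).re := by
  have h3 := add_chord_le_three_mul h0 h1 t
  have hN : ‖Complex.exp (t * Complex.I) - ((1 - τ : ℝ) : ℂ)‖ ≤ 2 * chord t := by
    rw [show Complex.exp (t * Complex.I) - ((1 - τ : ℝ) : ℂ) =
      (Complex.exp (t * Complex.I) - 1) + (τ : ℂ) by push_cast; ring]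
    refine (norm_add_le _ _).trans ?_
    rw [← chord, Complex.norm_real, Real.norm_of_nonneg h0.le]
    linarith
  have hd : 0 < chord t := h0.trans_le ht
  have h5 : τ ≤ 1 - (1 - τ) ^ 2 := by nlinarith
  rw [herglotz_re, Complex.norm_real, Real.norm_of_nonneg (by linarith), ← mul_div_assoc,
    div_le_div_iff₀ (by positivity) (by nlinarith)]
  calc τ * ‖Complex.exp (t * Complex.I) - ((1 - τ : ℝ) : ℂ)‖ ^ 2
      ≤ (1 - (1 - τ) ^ 2) * (2 * chord t) ^ 2 := by gcongr; linarith
    _ = _ := by ring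

lemma continuous_herglotz_re {w : ℂ} (hw : ‖w‖ < 1) : Continuous fun t => (herglotz w t).re :=
  Complex.continuous_re.comp (continuous_herglotz hw)

lemma integral_herglotz_re {w : ℂ} (hw : ‖w‖ < 1) :
    ∫ t in (-Real.pi)..Real.pi, (herglotz w t).re = 2 * Real.pi := by
  have hre := Complex.reCLM.intervalIntegral_comp_comm
    ((continuous_herglotz hw).intervalIntegrable (μ := volume) (-Real.pi) Real.pi)
  simp only [Complex.reCLM_apply] at hre
  rw [hre, integral_herglotz hw, show (2 * Real.pi : ℂ) = ((2 * Real.pi : ℝ) : ℂ) by push_cast; rfl,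
    Complex.ofReal_re]

/-- A continuous majorant for the positive part of `log (h / h(e^{iθ}))` against the Poisson
kernel. -/
def logMajorant (r l t : ℝ) : ℝ :=
  144 * r * (Real.log (2 * max |t| l / l) / max |t| l ^ 2)

lemma continuous_logMajorant {r l : ℝ} (hl : 0 < l) : Continuous (logMajorant r l) := by
  have hm : ∀ t, 0 < max |t| l := fun t => hl.trans_le (le_max_right _ _)
  have hc : Continuous fun t : ℝ => max |t| l := continuous_abs.max continuous_const
  refine continuous_const.mul (Continuous.div (Continuous.log ?_ fun t => ?_) (hc.pow 2)
    fun t => (pow_pos (hm t) 2).ne')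
  · exact (continuous_const.mul hc).div_const _
  · have := hm t
    positivity

lemma logMajorant_nonneg {r l : ℝ} (hr : 0 ≤ r) (hl : 0 < l) (t : ℝ) : 0 ≤ logMajorant r l t := by
  have h1 : 1 ≤ 2 * max |t| l / l := by
    rw [le_div_iff₀ hl]
    linarith [le_max_right |t| l]
  have := Real.log_nonneg h1
  rw [logMajorant]
  positivity

/-- The part beyond l integrates to at most 144(r/l)(log 2 + 1) and the part below to 144(r/l) log
2, so r ≤ l makes the bound absolute: 2(144 + 288) = 864. -/
lemma integral_logMajorant_le {r l : ℝ} (hr : 0 ≤ r) (hrl : r ≤ l) (hl : 0 < l)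
    (hlπ : l ≤ Real.pi) : ∫ t in (-Real.pi)..Real.pi, logMajorant r l t ≤ 864 := by
  have hc := continuous_logMajorant (r := r) hl
  have hπ := Real.pi_pos
  have heven : ∀ t, logMajorant r l (-t) = logMajorant r l t := fun t => by
    simp only [logMajorant, abs_neg]
  have hlog2 : Real.log 2 ≤ 1 := by
    have := Real.log_le_sub_one_of_pos (x := 2) two_pos
    linarith
  have hlog2' : 0 ≤ Real.log 2 := Real.log_nonneg one_le_two
  have hrl1 : r / l ≤ 1 := (div_le_one hl).2 hrl
  have e1 : ∫ t in (0 : ℝ)..l, logMajorant r l t ≤ 144 := by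
    have : ∀ t ∈ uIcc 0 l, logMajorant r l t = 144 * r * (Real.log 2 / l ^ 2) := fun t ht => by
      rw [uIcc_of_le hl.le] at ht
      rw [logMajorant, max_eq_right (by rw [abs_of_nonneg ht.1]; exact ht.2),
        mul_div_cancel_right₀ _ hl.ne']
    rw [intervalIntegral.integral_congr this, intervalIntegral.integral_const, sub_zero,
      smul_eq_mul]
    calc l * (144 * r * (Real.log 2 / l ^ 2)) = 144 * (r / l) * Real.log 2 := by field_simp
      _ ≤ 144 * 1 * 1 := by gcongr
      _ = 144 := by norm_num
  have e2 : ∫ t in l..Real.pi, logMajorant r l t ≤ 288 := by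
    have hd : ∀ t ∈ uIcc l Real.pi, HasDerivAt
        (fun t => 144 * r * -((Real.log (2 * t / l) + 1) / t)) (logMajorant r l t) t := by
      intro t ht
      rw [uIcc_of_le hlπ] at ht
      have ht0 : 0 < t := hl.trans_le ht.1
      rw [logMajorant, max_eq_left (by rw [abs_of_pos ht0]; exact ht.1), abs_of_pos ht0]
      have h1 : HasDerivAt (fun t : ℝ => 2 * t / l) (2 / l) t := by
        simpa using ((hasDerivAt_id' t).const_mul 2).div_const l
      have h2 := (h1.log (by positivity)).add_const 1
      refine (((h2.div (hasDerivAt_id' t) ht0.ne').neg).const_mul (144 * r)).congr_deriv ?_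
      field_simp
      ring
    rw [intervalIntegral.integral_eq_sub_of_hasDerivAt hd (hc.intervalIntegrable _ _),
      mul_div_cancel_right₀ _ hl.ne']
    have h3 : 0 ≤ Real.log (2 * Real.pi / l) := by
      refine Real.log_nonneg ?_
      rw [le_div_iff₀ hl]; linarith
    have h4 : 0 ≤ 144 * r * ((Real.log (2 * Real.pi / l) + 1) / Real.pi) := by positivity
    calc _ ≤ 144 * (r / l) * (Real.log 2 + 1) := by
          have : 144 * r * ((Real.log 2 + 1) / l) = 144 * (r / l) * (Real.log 2 + 1) := by ring
          linarith
      _ ≤ 144 * 1 * (1 + 1) := by gcongr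
      _ = 288 := by norm_num
  have e3 := intervalIntegral.integral_add_adjacent_intervals
    (hc.intervalIntegrable (μ := volume) 0 l) (hc.intervalIntegrable l Real.pi)
  rw [integral_neg_pos_eq hπ.le (hc.intervalIntegrable _ _)]
  simp_rw [heven, ← two_mul]
  rw [intervalIntegral.integral_const_mul]
  linarith

namespace Setting

variable {ψ : ℝ → ℝ} {h : Circle → ℝ} (S : Setting ψ h)
include S

lemma tendsto_v_radial {θ C : ℝ} (hθ : h (Circle.exp θ) ≠ 0)
    (hsym₁ : ∀ s : ℝ, 0 < s → s ≤ radius ψ h (Circle.exp θ) →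
      ∃ L : ℝ, Tendsto
        (fun ε : ℝ => ∫ t in ε..s, |h (Circle.exp (θ + t)) - h (Circle.exp (θ - t))| / t)
        (𝓝[>] 0) (𝓝 L) ∧ L ≤ C * ψ s) :
    Tendsto (fun r : ℝ => v h (r * Circle.exp θ)) (𝓝[<] 1) (𝓝 (vBoundary h θ)) := by
  have key : Tendsto (fun τ : ℝ => v h (Circle.exp θ * ((1 - τ : ℝ) : ℂ))) (𝓝[>] 0)
      (𝓝 (vBoundary h θ)) := by
    rw [tendsto_iff_norm_sub_tendsto_zero]
    have hid : Tendsto (fun τ : ℝ => τ) (𝓝[>] 0) (𝓝 0) := tendsto_id.mono_left nhdsWithin_le_nhds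
    have hψ0 := (S.modulus.tendsto_zero.div_const (h (Circle.exp θ)))
    have hlim := (hψ0.const_mul (72 * C)).add
      (((hψ0.const_mul (8 * lipConst ψ h)).add (hid.mul_const (farInt ψ h θ))).const_mul 54)
    simp only [zero_div, mul_zero, zero_mul, add_zero] at hlim
    refine squeeze_zero' (Eventually.of_forall fun _ => norm_nonneg _) ?_ hlim
    filter_upwards [Ioc_mem_nhdsGT (S.radius_pos hθ)] with τ hτ
    have hτ1 := hτ.2.trans (S.radius_spec _).1.2
    have e3 := S.abs_v_sub_vBoundary_le hθ hτ.1 hτ.2 (hsym₁ τ hτ.1 hτ.2) 0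
    simp only [sub_zero] at e3
    have e1 := S.integral_logDev_cube_le hθ hτ.1 (by linarith)
    rw [Real.norm_eq_abs]
    linarith
  refine (key.comp tendsto_one_sub_nhdsLT).congr fun r => ?_
  simp only [Function.comp_apply, sub_sub_cancel, mul_comm]

/-- The deviation is uniformly small on a short arc about e^{iθ}; off it the Poisson kernel is O(τ),
and log h is integrable. -/
lemma tendsto_u_radial {θ : ℝ} (hθ : h (Circle.exp θ) ≠ 0) :
    Tendsto (fun r : ℝ => u h (r * Circle.exp θ)) (𝓝[<] 1)
      (𝓝 (Real.log (h (Circle.exp θ)))) := by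
  have hp := S.pos hθ
  have hC := S.lipConst_pos
  have hπ := Real.pi_pos
  have key : Tendsto (fun τ : ℝ => u h (Circle.exp θ * ((1 - τ : ℝ) : ℂ))) (𝓝[>] 0)
      (𝓝 (Real.log (h (Circle.exp θ)))) := by
    rw [Metric.tendsto_nhds]
    intro ε hε
    -- The arc contributes at most 18·4·η, which is ε/2.
    set η := ε / 144 with hη
    have hη0 : 0 < η := by positivity
    have hψ0 := (S.modulus.tendsto_zero.const_mul (2 * lipConst ψ h)).div_const (h (Circle.exp θ))
    simp only [mul_zero, zero_div] at hψ0
    obtain ⟨δ, hδψ, hδ⟩ := ((hψ0.eventually (gt_mem_nhds hη0)).and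
      (Ioc_mem_nhdsGT (S.radius_pos hθ))).exists
    have hδ1 := hδ.2.trans (S.radius_spec _).1.2
    set G := ∫ t in (-Real.pi)..Real.pi, |logDev h θ t| with hG
    have hlim : Tendsto (fun τ : ℝ => 18 * (τ / δ ^ 2 * G)) (𝓝[>] 0) (𝓝 0) := by
      have hid : Tendsto (fun τ : ℝ => τ) (𝓝[>] 0) (𝓝 0) :=
        tendsto_id.mono_left nhdsWithin_le_nhds
      simpa using ((hid.div_const (δ ^ 2)).mul_const G).const_mul 18
    filter_upwards [Ioc_mem_nhdsGT one_pos, hlim.eventually (gt_mem_nhds (half_pos hε))]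
      with τ hτ hsmall
    have hw := norm_one_sub_lt hτ.1 hτ.2
    have hg := S.log.logDev θ (-Real.pi) Real.pi
    have i1 := hg.continuousOn_mul (continuous_herglotz_re hw).continuousOn
    have i2 := (continuous_const_div_add_chord_pow hτ.1 τ 2).intervalIntegrable (μ := volume)
      (-Real.pi) Real.pi
    have hbd : |∫ t in (-Real.pi)..Real.pi, (herglotz ((1 - τ : ℝ) : ℂ) t).re * logDev h θ t| ≤
        18 * (η * 4 + τ / δ ^ 2 * G) := by
      refine (intervalIntegral.abs_integral_le_integral_abs (by linarith)).trans ?_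
      have hle : ∀ t ∈ Icc (-Real.pi) Real.pi,
          |(herglotz ((1 - τ : ℝ) : ℂ) t).re * logDev h θ t| ≤
          18 * (η * (τ / (τ + chord t) ^ 2) + τ / δ ^ 2 * |logDev h θ t|) := by
        intro t _
        have hP0 := herglotz_re_nonneg hw t
        have hP1 := herglotz_re_le hτ.1 hτ.2 t
        have hd := chord_nonneg t
        have hτ0 := hτ.1
        rw [abs_mul, abs_of_nonneg hP0]
        have h1 : (herglotz ((1 - τ : ℝ) : ℂ) t).re * |logDev h θ t| ≤
            18 * (τ / (τ + chord t) ^ 2) * |logDev h θ t| := by gcongr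
        refine h1.trans ?_
        rw [mul_assoc]
        refine mul_le_mul_of_nonneg_left ?_ (by norm_num)
        rcases le_or_gt (chord t) δ with hcl | hcl
        · have m1 := S.abs_logDev_le hθ (hcl.trans hδ.2)
          have m2 := S.modulus.mono hd hcl (by linarith)
          have m3 : |logDev h θ t| ≤ η := by
            refine m1.trans (le_trans ?_ hδψ.le)
            gcongr
          calc _ ≤ τ / (τ + chord t) ^ 2 * η := by gcongr
            _ = η * (τ / (τ + chord t) ^ 2) := mul_comm _ _
            _ ≤ _ := le_add_of_nonneg_right (by positivity)
        · have hδ0 := hδ.1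
          calc _ ≤ τ / δ ^ 2 * |logDev h θ t| := by
                gcongr
                linarith
            _ ≤ _ := le_add_of_nonneg_left (by positivity)
      have i3 := ((i2.const_mul η).add (hg.abs.const_mul (τ / δ ^ 2))).const_mul 18
      have := intervalIntegral.integral_mono_on (by linarith) i1.abs i3 hle
      rw [intervalIntegral.integral_const_mul, intervalIntegral.integral_add (i2.const_mul η)
        (hg.abs.const_mul (τ / δ ^ 2)), intervalIntegral.integral_const_mul,
        intervalIntegral.integral_const_mul] at this
      refine this.trans ?_
      gcongr
      exact integral_div_add_chord_sq_le hτ.1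
    rw [S.log.u_rotate hw, Real.dist_eq, add_sub_cancel_left, abs_mul,
      abs_of_pos (by positivity)]
    refine (mul_le_of_le_one_left (abs_nonneg _) ?_).trans_lt (hbd.trans_lt ?_)
    · rw [div_le_one (by positivity)]
      linarith [Real.pi_gt_three]
    · rw [hη]; linarith
  refine (key.comp tendsto_one_sub_nhdsLT).congr fun r => ?_
  simp only [Function.comp_apply, sub_sub_cancel, mul_comm]

lemma u_le {z : ℂ} (hz : ‖z‖ < 1) : u h z ≤ Real.log (2 * lipConst ψ h) := by
  have hπ := Real.pi_pos
  have hg := S.log.logDev 0 (-Real.pi) Real.pi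
  have h1 := S.log.u_rotate hz 0
  simp only [Circle.exp_zero, Circle.coe_one, one_mul] at h1
  set D := Real.log (2 * lipConst ψ h) - Real.log (h 1) with hD
  have hc := continuous_herglotz_re hz
  have h2 : ∫ t in (-Real.pi)..Real.pi, (herglotz z t).re * logDev h 0 t ≤
      ∫ t in (-Real.pi)..Real.pi, (herglotz z t).re * D := by
    refine intervalIntegral.integral_mono_ae (by linarith) (hg.continuousOn_mul hc.continuousOn)
      ((hc.mul continuous_const).intervalIntegrable _ _) ?_
    filter_upwards [S.log.ae_ne_zero 0] with t ht
    refine mul_le_mul_of_nonneg_left ?_ (herglotz_re_nonneg hz t)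
    rw [logDev, hD, Circle.exp_zero]
    exact sub_le_sub_right (Real.log_le_log (S.pos ht) (S.le_two_mul_lipConst _)) _
  rw [intervalIntegral.integral_mul_const, integral_herglotz_re hz] at h2
  rw [h1]
  calc _ ≤ Real.log (h 1) + 1 / (2 * Real.pi) * (2 * Real.pi * D) := by gcongr
    _ = _ := by rw [hD]; field_simp; ring

/-- The hypothesis bounds the Poisson integral of g from below, the Lipschitz condition bounds that
of g⁺ from above, and together they bound that of |g|. On the far set the Poisson kernel is at least
r/(4d²). The summands 2πM, 864 and 2π come from -g, the majorant of 2g⁺, and the kernel mass. -/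
lemma mul_farInt_le {θ r M : ℝ} (hθ : h (Circle.exp θ) ≠ 0) (hr : 0 < r)
    (hrr : r ≤ radius ψ h (Circle.exp θ))
    (hM : |u h (Circle.exp θ * ((1 - r : ℝ) : ℂ)) - Real.log (h (Circle.exp θ))| ≤ M) :
    r * farInt ψ h θ ≤ 4 * (2 * Real.pi * M + 864 + 2 * Real.pi) := by
  have hp := S.pos hθ
  have hC := S.lipConst_pos
  have hπ := Real.pi_pos
  obtain ⟨hl, hψl⟩ := S.radius_spec (Circle.exp θ)
  set l := radius ψ h (Circle.exp θ) with hldef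
  have hl0 : 0 < l := hr.trans_le hrr
  have hr1 : r ≤ 1 := hrr.trans hl.2
  have hw := norm_one_sub_lt hr hr1
  have hg := S.log.logDev θ (-Real.pi) Real.pi
  have hc := continuous_herglotz_re hw
  have i1 := hg.continuousOn_mul hc.continuousOn
  have i2 := hc.intervalIntegrable (μ := volume) (-Real.pi) Real.pi
  have i3 := (continuous_logMajorant (r := r) hl0).intervalIntegrable (μ := volume)
    (-Real.pi) Real.pi
  have i4 := S.farDev_intervalIntegrable hθ (-Real.pi) Real.pi
  have hint : -(2 * Real.pi * M) ≤
      ∫ t in (-Real.pi)..Real.pi, (herglotz ((1 - r : ℝ) : ℂ) t).re * logDev h θ t := by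
    rw [S.log.u_rotate hw, add_sub_cancel_left, abs_mul, abs_of_pos (by positivity),
      one_div, inv_mul_le_iff₀ (by positivity)] at hM
    exact (abs_le.1 hM).1
  -- The added kernel term keeps the right side nonnegative within the radius, where g ≤ 1 while
  -- `farDev` vanishes. The alternative `Real.pi < |t|` is there because arc and chord are
  -- comparable only up to π.
  have hle : ∀ᵐ t : ℝ, r * farDev ψ h θ t ≤
      4 * (-((herglotz ((1 - r : ℝ) : ℂ) t).re * logDev h θ t) + logMajorant r l t +
        (herglotz ((1 - r : ℝ) : ℂ) t).re) ∨ Real.pi < |t| := by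
    filter_upwards [S.log.ae_ne_zero θ] with t ht
    rcases lt_or_ge Real.pi |t| with hgt | htπ
    · exact Or.inr hgt
    refine Or.inl ?_
    have hP0 := herglotz_re_nonneg hw t
    have hW0 := logMajorant_nonneg hr.le hl0 t
    rcases le_or_gt (chord t) l with hcl | hcl
    · have hfd : farDev ψ h θ t = 0 := by
        refine indicator_of_notMem ?_ _
        simpa using hcl
      have := (abs_le.1 (S.abs_logDev_le_one hθ hcl)).2
      rw [hfd]
      nlinarith
    · rw [farDev_of_lt hcl]
      have hd : 0 < chord t := hl0.trans hcl
      have hP1 := herglotz_re_le hr hr1 t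
      have hP2 := le_herglotz_re hr hr1 (hrr.trans hcl.le)
      set P := (herglotz ((1 - r : ℝ) : ℂ) t).re
      have hta : l < |t| := hcl.trans_le (chord_le_abs t)
      have ht0 : 0 < |t| := hl0.trans hta
      have htc := abs_le_two_mul_chord htπ
      have hlog0 : 0 ≤ Real.log (2 * |t| / l) := by
        refine Real.log_nonneg ?_
        rw [le_div_iff₀ hl0]; linarith
      have hgle : logDev h θ t ≤ Real.log (2 * |t| / l) := by
        rw [logDev_eq hθ ht]
        refine Real.log_le_log (div_pos (S.pos ht) hp) ?_
        have hd1 := S.abs_sub_le (Circle.exp (θ + t)) (Circle.exp θ)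
        rw [dist_circleExp, add_sub_cancel_left] at hd1
        have hd2 := S.modulus.le_mul_one_add hd.le (chord_le_two t) hl0 (by linarith [hl.2])
        rw [hψl] at hd2
        have hd3 : lipConst ψ h * ψ (chord t) ≤ h (Circle.exp θ) * ((1 + chord t / l) / 2) := by
          calc lipConst ψ h * ψ (chord t)
              ≤ lipConst ψ h * (h (Circle.exp θ) / (2 * lipConst ψ h) * (1 + chord t / l)) := by
                gcongr
            _ = _ := by field_simp
        rw [div_le_iff₀ hp]
        -- With X = |t|/l ≥ 1 this reads 3/2 + X/2 ≤ 2X.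
        have hd4 : 1 + (1 + chord t / l) / 2 ≤ 2 * |t| / l := by
          have a1 : 1 ≤ |t| / l := by rw [le_div_iff₀ hl0]; linarith
          have a2 : chord t / l ≤ |t| / l := by gcongr; exact chord_le_abs t
          rw [mul_div_assoc]
          linarith
        have hd5 := (le_abs_self _).trans hd1
        nlinarith
      have hW : 2 * P * Real.log (2 * |t| / l) ≤ logMajorant r l t := by
        rw [logMajorant, max_eq_left hta.le]
        have hk : r / (r + chord t) ^ 2 ≤ 4 * r / |t| ^ 2 := by
          rw [div_le_div_iff₀ (by positivity) (by positivity)]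
          calc r * |t| ^ 2 ≤ r * (2 * (r + chord t)) ^ 2 := by gcongr; linarith
            _ = _ := by ring
        calc 2 * P * Real.log (2 * |t| / l)
            ≤ 2 * (18 * (4 * r / |t| ^ 2)) * Real.log (2 * |t| / l) := by
              gcongr; linarith
          _ = _ := by ring
      have habs : P * |logDev h θ t| ≤ 2 * P * Real.log (2 * |t| / l) - P * logDev h θ t := by
        rcases abs_cases (logDev h θ t) with ⟨e, _⟩ | ⟨e, _⟩ <;> rw [e]
        · nlinarith
        · have : 0 ≤ P * Real.log (2 * |t| / l) := mul_nonneg hP0 hlog0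
          linarith
      calc r * (|logDev h θ t| / chord t ^ 2) = r / chord t ^ 2 * |logDev h θ t| := by ring
        _ ≤ 4 * P * |logDev h θ t| := by gcongr
        _ ≤ _ := by linarith
  have hmono := intervalIntegral.integral_mono_ae_restrict (show -Real.pi ≤ Real.pi by linarith)
    (i4.const_mul r) (((i1.neg.add i3).add i2).const_mul 4) (by
      filter_upwards [ae_restrict_of_ae hle, ae_restrict_mem measurableSet_Icc] with t h1 h2
      exact h1.resolve_right (not_lt.2 (abs_le.2 h2)))
  rw [intervalIntegral.integral_const_mul, intervalIntegral.integral_const_mul,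
    intervalIntegral.integral_add (i1.neg.add i3) i2, intervalIntegral.integral_add i1.neg i3,
    integral_herglotz_re hw] at hmono
  have hneg : ∫ t in (-Real.pi)..Real.pi, (-fun t => (herglotz ((1 - r : ℝ) : ℂ) t).re *
      logDev h θ t) t =
      -∫ t in (-Real.pi)..Real.pi, (herglotz ((1 - r : ℝ) : ℂ) t).re * logDev h θ t :=
    intervalIntegral.integral_neg
  rw [hneg] at hmono
  have hW := integral_logMajorant_le hr.le hrr hl0 (by linarith [hl.2, Real.pi_gt_three])
  rw [farInt]
  linarith

end Setting

/-! ### Outer functions and their powers on the closed disk. -/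

lemma circleExp_arg {z : ℂ} (hz : ‖z‖ = 1) : (Circle.exp z.arg : ℂ) = z := by
  rw [Circle.coe_exp]
  have := Complex.norm_mul_exp_arg_mul_I z
  rwa [hz, Complex.ofReal_one, one_mul] at this

lemma circleExp_arg_coe (t : ℝ) : Circle.exp (Circle.exp t : ℂ).arg = Circle.exp t :=
  Circle.exp_arg _

lemma circleMap_eq_circleExp (t : ℝ) : circleMap 0 1 t = (Circle.exp t : ℂ) := by
  simp [circleMap]

lemma dist_eq_chord {z w : ℂ} (hz : ‖z‖ = 1) (hw : ‖w‖ = 1) : dist z w = chord (z.arg - w.arg) := by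
  rw [← norm_exp_sub_exp, ← Circle.coe_exp, ← Circle.coe_exp, circleExp_arg hz, circleExp_arg hw,
    dist_eq_norm]

lemma dist_closedBall_le_two {z w : ℂ} (hz : z ∈ closedBall (0 : ℂ) 1)
    (hw : w ∈ closedBall (0 : ℂ) 1) : dist z w ≤ 2 := by
  rw [mem_closedBall_zero_iff] at hz hw
  rw [dist_eq_norm]
  linarith [norm_sub_le z w]

/-- The points of the circle at which `h` does not vanish. -/
def nonzeroSet (h : Circle → ℝ) : Set ℂ := {ξ | ‖ξ‖ = 1 ∧ h (Circle.exp ξ.arg) ≠ 0}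

lemma nonzeroSet_subset_sphere (h : Circle → ℝ) : nonzeroSet h ⊆ sphere 0 1 :=
  fun _ hξ => mem_sphere_zero_iff_norm.2 hξ.1

lemma circleExp_mem_nonzeroSet {h : Circle → ℝ} {t : ℝ} :
    (Circle.exp t : ℂ) ∈ nonzeroSet h ↔ h (Circle.exp t) ≠ 0 := by
  rw [nonzeroSet, mem_ofPred_eq, circleExp_arg_coe]
  simp

section OuterPow

variable {h : Circle → ℝ} {ρ : ℝ}

lemma outerPow_of_norm_lt {z : ℂ} (hz : ‖z‖ < 1) :
    outerPow h ρ z = Complex.exp (ρ * (u h z + Complex.I * v h z)) := if_pos hz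

lemma outerPow_of_mem {z : ℂ} (hz : z ∈ nonzeroSet h) : outerPow h ρ z =
    ((h (Circle.exp z.arg) ^ ρ : ℝ) : ℂ) *
      Complex.exp (Complex.I * (ρ * vBoundary h z.arg)) := by
  rw [outerPow, if_neg (by rw [hz.1]; exact lt_irrefl 1), if_pos (show ‖z‖ = 1 ∧ h (Circle.exp z.arg) ≠ 0 from hz)]

lemma outerPow_of_eq_zero {z : ℂ} (hz : ‖z‖ = 1) (h0 : h (Circle.exp z.arg) = 0) :
    outerPow h ρ z = 0 := by
  rw [outerPow, if_neg (by rw [hz]; exact lt_irrefl 1), if_neg fun h' => h'.2 h0]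

lemma norm_outerPow_of_norm_lt {z : ℂ} (hz : ‖z‖ < 1) :
    ‖outerPow h ρ z‖ = Real.exp (ρ * u h z) := by
  rw [outerPow_of_norm_lt hz, Complex.norm_exp, Complex.re_ofReal_mul]
  simp

lemma norm_outerPow_of_norm_eq (hh : ∀ ξ, 0 ≤ h ξ) (hρ : ρ ≠ 0) {z : ℂ} (hz : ‖z‖ = 1) :
    ‖outerPow h ρ z‖ = h (Circle.exp z.arg) ^ ρ := by
  by_cases h0 : h (Circle.exp z.arg) = 0
  · rw [outerPow_of_eq_zero hz h0, h0, Real.zero_rpow hρ, norm_zero]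
  · rw [outerPow_of_mem ⟨hz, h0⟩, norm_mul, mul_comm Complex.I, ← Complex.ofReal_mul,
      Complex.norm_exp_ofReal_mul_I, mul_one, Complex.norm_real,
      Real.norm_of_nonneg (Real.rpow_nonneg (hh _) _)]

lemma norm_outer_of_norm_lt {z : ℂ} (hz : ‖z‖ < 1) : ‖outer h z‖ = Real.exp (u h z) := by
  rw [outer, if_pos hz, Complex.norm_exp]
  simp

lemma norm_outer_of_norm_eq (hh : ∀ ξ, 0 ≤ h ξ) {z : ℂ} (hz : ‖z‖ = 1) :
    ‖outer h z‖ = h (Circle.exp z.arg) := by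
  by_cases h0 : h (Circle.exp z.arg) = 0
  · rw [outer, if_neg (by rw [hz]; exact lt_irrefl 1), if_neg fun h' => h'.2 h0, h0, norm_zero]
  · rw [outer, if_neg (by rw [hz]; exact lt_irrefl 1), if_pos ⟨hz, h0⟩, norm_mul,
      mul_comm Complex.I, Complex.norm_exp_ofReal_mul_I, mul_one, Complex.norm_real,
      Real.norm_of_nonneg (hh _)]

lemma norm_outerPow_eq (hh : ∀ ξ, 0 ≤ h ξ) (hρ : ρ ≠ 0) {z : ℂ} (hz : ‖z‖ ≤ 1) :
    ‖outerPow h ρ z‖ = ‖outer h z‖ ^ ρ := by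
  rcases hz.lt_or_eq with hz | hz
  · rw [norm_outerPow_of_norm_lt hz, norm_outer_of_norm_lt hz, ← Real.exp_mul, mul_comm]
  · rw [norm_outerPow_of_norm_eq hh hρ hz, norm_outer_of_norm_eq hh hz]

end OuterPow

/-- Collects all that is used of min(1, 1/A) as a real number, including A = 0, where the inverse is
∞ and the minimum is 1. -/
lemma exists_toReal_min_one_inv {A : ℝ} (hA : 0 ≤ A) :
    let m := (min 1 (ENNReal.ofReal A)⁻¹).toReal
    0 ≤ m ∧ m ≤ 1 ∧ m * A ≤ 1 ∧ ∀ r N : ℝ, r ≤ 1 → 1 ≤ N → r * A ≤ N → r / N ≤ m := by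
  intro m
  rcases hA.eq_or_lt with rfl | hA
  · have hm : m = 1 := by simp [m]
    rw [hm]
    refine ⟨zero_le_one, le_rfl, by simp, fun r N h1 h2 _ => ?_⟩
    rw [div_le_one (by linarith)]
    linarith
  · have hm : m = min 1 A⁻¹ := by
      simp only [m]
      rw [← ENNReal.ofReal_inv_of_pos hA, ← ENNReal.ofReal_one, ← ENNReal.ofReal_min,
        ENNReal.toReal_ofReal (by positivity)]
    rw [hm]
    refine ⟨by positivity, min_le_left _ _, ?_, fun r N h1 h2 h3 => le_min ?_ ?_⟩
    · calc min 1 A⁻¹ * A ≤ A⁻¹ * A := by gcongr; exact min_le_right _ _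
        _ = 1 := inv_mul_cancel₀ hA.ne'
    · rw [div_le_one (by linarith)]
      linarith
    · rw [div_le_iff₀ (by linarith), inv_mul_eq_div, le_div_iff₀ hA]
      exact h3

lemma abs_rpow_sub_rpow_le {ρ b x y : ℝ} (hρ : 1 ≤ ρ) (hx0 : 0 ≤ x) (hxb : x ≤ b) (hy0 : 0 ≤ y)
    (hyb : y ≤ b) : |x ^ ρ - y ^ ρ| ≤ ρ * b ^ (ρ - 1) * |x - y| := by
  have := Convex.norm_image_sub_le_of_norm_hasDerivWithin_le (f := fun x : ℝ => x ^ ρ)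
    (f' := fun x => ρ * x ^ (ρ - 1)) (s := Icc 0 b) (C := ρ * b ^ (ρ - 1))
    (fun z _ => (Real.hasDerivAt_rpow_const (Or.inr hρ)).hasDerivWithinAt) (fun z hz => ?_)
    (convex_Icc 0 b) ⟨hy0, hyb⟩ ⟨hx0, hxb⟩
  · simpa using this
  · have hz0 := hz.1
    have h1 : 0 ≤ ρ - 1 := by linarith
    rw [Real.norm_of_nonneg (by positivity)]
    gcongr
    exact hz.2

lemma eventually_norm_mul_lt_one {z : ℂ} (hz : ‖z‖ = 1) : ∀ᶠ r : ℝ in 𝓝[<] 1, ‖(r : ℂ) * z‖ < 1 := by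
  filter_upwards [Ioo_mem_nhdsLT (show (0 : ℝ) < 1 by norm_num)] with r hr
  rw [norm_mul, hz, mul_one, Complex.norm_real, Real.norm_of_nonneg hr.1.le]
  exact hr.2

lemma norm_exp_I_mul_sub_le (x y : ℝ) :
    ‖Complex.exp (Complex.I * x) - Complex.exp (Complex.I * y)‖ ≤ |x - y| := by
  rw [mul_comm, mul_comm Complex.I, norm_exp_sub_exp]
  exact chord_le_abs _

/-! ### The implications between the four assertions. -/

namespace Setting

variable {ψ : ℝ → ℝ} {h : Circle → ℝ} (S : Setting ψ h)
include S

lemma ae_mem_nonzeroSet : ∀ᵐ t : ℝ, circleMap 0 1 t ∈ nonzeroSet h := by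
  filter_upwards [S.log.1] with t ht
  rwa [circleMap_eq_circleExp, circleExp_mem_nonzeroSet]

/-- Zeros of `h` are limits of points where `h ≠ 0`, also in the graph of a function which vanishes
along with `h`. -/
lemma mem_closure_graph {E : Type*} [NormedAddCommGroup E] {f : ℂ → E} {ρ : ℝ} (hρ : 0 < ρ)
    (hf : ∀ z : ℂ, ‖z‖ = 1 → ‖f z‖ = h (Circle.exp z.arg) ^ ρ) {z : ℂ} (hz : ‖z‖ = 1)
    (h0 : h (Circle.exp z.arg) = 0) :
    (z, f z) ∈ closure ((fun z => (z, f z)) '' nonzeroSet h) := by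
  set D : Set ℝ := {t | h (Circle.exp t) ≠ 0} with hD
  -- The complement of a Lebesgue null set is dense.
  have hdense : Dense D := Measure.dense_of_ae S.log.1
  have hne : (𝓝[D] z.arg).NeBot := mem_closure_iff_nhdsWithin_neBot.1 (hdense z.arg)
  have hfz : f z = 0 := by
    rw [← norm_eq_zero, hf z hz, h0, Real.zero_rpow hρ.ne']
  have hc : Continuous fun t : ℝ => (Circle.exp t : ℂ) := by
    simp only [Circle.coe_exp]; fun_prop
  have t1 : Tendsto (fun t : ℝ => (Circle.exp t : ℂ)) (𝓝[D] z.arg) (𝓝 z) := by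
    have := hc.tendsto z.arg
    rw [circleExp_arg hz] at this
    exact this.mono_left nhdsWithin_le_nhds
  have t2 : Tendsto (fun t : ℝ => f (Circle.exp t : ℂ)) (𝓝[D] z.arg) (𝓝 (f z)) := by
    rw [hfz, tendsto_zero_iff_norm_tendsto_zero]
    have e : ∀ t : ℝ, ‖f (Circle.exp t : ℂ)‖ = h (Circle.exp t) ^ ρ := fun t => by
      rw [hf _ (Circle.norm_coe _), circleExp_arg_coe]
    simp_rw [e]
    have hc2 : Continuous fun t : ℝ => h (Circle.exp t) ^ ρ :=
      (S.cont.comp (by fun_prop)).rpow_const fun _ => Or.inr hρ.le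
    have := hc2.tendsto z.arg
    simp only [h0, Real.zero_rpow hρ.ne'] at this
    exact this.mono_left nhdsWithin_le_nhds
  refine mem_closure_of_tendsto (t1.prodMk_nhds t2) ?_
  filter_upwards [self_mem_nhdsWithin] with t ht
  exact ⟨_, circleExp_mem_nonzeroSet.2 ht, rfl⟩

/-- Nonzero boundary points are reached radially; zeros of `h` are reached through nonzero boundary
points, so no radial limit is needed at them. -/
lemma mem_closure_graph_ball {E : Type*} [NormedAddCommGroup E] {f : ℂ → E} {ρ : ℝ} (hρ : 0 < ρ)
    (hf : ∀ z : ℂ, ‖z‖ = 1 → ‖f z‖ = h (Circle.exp z.arg) ^ ρ)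
    (hrad : ∀ z ∈ nonzeroSet h, Tendsto (fun r : ℝ => f (r * z)) (𝓝[<] 1) (𝓝 (f z)))
    {z : ℂ} (hz : z ∈ closedBall (0 : ℂ) 1) :
    (z, f z) ∈ closure ((fun z => (z, f z)) '' ball (0 : ℂ) 1) := by
  have hcl : ∀ z ∈ nonzeroSet h, (z, f z) ∈ closure ((fun z => (z, f z)) '' ball (0 : ℂ) 1) := by
    intro z hz
    have t1 : Tendsto (fun r : ℝ => (r : ℂ) * z) (𝓝[<] 1) (𝓝 z) := by
      have hc : Continuous fun r : ℝ => (r : ℂ) * z := by fun_prop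
      have := hc.tendsto 1
      simp only [Complex.ofReal_one, one_mul] at this
      exact this.mono_left nhdsWithin_le_nhds
    refine mem_closure_of_tendsto (t1.prodMk_nhds (hrad z hz)) ?_
    filter_upwards [eventually_norm_mul_lt_one hz.1] with r hr
    exact ⟨_, mem_ball_zero_iff.2 hr, rfl⟩
  rcases (mem_closedBall_zero_iff.1 hz).lt_or_eq with hz1 | hz1
  · exact subset_closure ⟨z, mem_ball_zero_iff.2 hz1, rfl⟩
  by_cases h0 : h (Circle.exp z.arg) = 0
  · refine closure_minimal ?_ isClosed_closure (S.mem_closure_graph hρ hf hz1 h0)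
    rintro _ ⟨w, hw, rfl⟩
    exact hcl w hw
  · exact hcl z ⟨hz1, h0⟩

lemma rpow_le {ρ : ℝ} (hρ : 1 ≤ ρ) (ξ : Circle) :
    h ξ ^ ρ ≤ (2 * lipConst ψ h) ^ (ρ - 1) * h ξ := by
  have h1 : 0 ≤ ρ - 1 := by linarith
  have hn := S.nonneg ξ
  have hle := S.le_two_mul_lipConst ξ
  rcases hn.eq_or_lt with h0 | hp
  · rw [← h0, Real.zero_rpow (by linarith), mul_zero]
  · calc h ξ ^ ρ = h ξ ^ (ρ - 1) * h ξ := by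
          rw [← Real.rpow_add_one hp.ne', sub_add_cancel]
      _ ≤ _ := by gcongr

/-- The bound on the open disk extends to the closed one through the graph. On 𝔻_ξ the modulus then
stays within half of h^ρ(ξ), so ρ|log(|O_h|/h)| ≤ 1. -/
lemma logComparable_of_modulus_abs {ω : ℝ → ℝ} (hω : IsModulus ω) {ρ : ℝ} (hρ : 1 ≤ ρ)
    (hf : seminorm ω (ball (0 : ℂ) 1) (fun z => ‖outerPow h ρ z‖) < ⊤) :
    LogComparable ω h ρ := by
  have hC := S.lipConst_pos
  have hρ0 : 0 < ρ := by linarith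
  set f : ℂ → ℝ := fun z => ‖outerPow h ρ z‖ with hfdef
  set K := (seminorm ω (ball (0 : ℂ) 1) f).toReal with hK
  have hK0 : 0 ≤ K := ENNReal.toReal_nonneg
  have hball : ball (0 : ℂ) 1 ⊆ closedBall 0 1 := ball_subset_closedBall
  have hlip0 : ∀ z ∈ ball (0 : ℂ) 1, ∀ w ∈ ball (0 : ℂ) 1, ‖f z - f w‖ ≤ K * ω (dist z w) :=
    fun z hz w hw => norm_sub_le_of_seminorm_lt_top hω
      (fun z hz w hw => dist_closedBall_le_two (hball hz) (hball hw)) hf hz hw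
  have hbd : ∀ z : ℂ, ‖z‖ = 1 → ‖f z‖ = h (Circle.exp z.arg) ^ ρ := fun z hz => by
    rw [hfdef, norm_norm, norm_outerPow_of_norm_eq S.nonneg hρ0.ne' hz]
  have hrad : ∀ z ∈ nonzeroSet h, Tendsto (fun r : ℝ => f (r * z)) (𝓝[<] 1) (𝓝 (f z)) := by
    intro z hz
    have e1 : f z = Real.exp (ρ * Real.log (h (Circle.exp z.arg))) := by
      rw [hfdef]
      simp only
      rw [norm_outerPow_of_norm_eq S.nonneg hρ0.ne' hz.1, Real.rpow_def_of_pos (S.pos hz.2),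
        mul_comm]
    rw [e1]
    have := S.tendsto_u_radial hz.2
    rw [circleExp_arg hz.1] at this
    refine ((Real.continuous_exp.tendsto _).comp (this.const_mul ρ)).congr' ?_
    filter_upwards [eventually_norm_mul_lt_one hz.1] with r hr
    simp only [Function.comp_apply, hfdef]
    rw [norm_outerPow_of_norm_lt hr]
  have hcl := fun z hz => S.mem_closure_graph_ball hρ0 hbd hrad (z := z) hz
  have hlip := modulus_bound_of_mem_closure_graph hω
    (fun z hz w hw => dist_closedBall_le_two hz hw) hball hlip0 hcl
  have hB : 0 < (2 * lipConst ψ h) ^ ρ := by positivity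
  -- The first entry gives Kδ ≤ 1/2, the second δh^ρ ≤ 1.
  set δ := min (1 / (2 * (K + 1))) (1 / (2 * lipConst ψ h) ^ ρ) with hδ
  have hδ0 : 0 < δ := by positivity
  have hδ1 : ∀ ξ, δ * h ξ ^ ρ ≤ 1 := fun ξ => by
    have hn := S.nonneg ξ
    have hle := S.le_two_mul_lipConst ξ
    calc δ * h ξ ^ ρ ≤ 1 / (2 * lipConst ψ h) ^ ρ * (2 * lipConst ψ h) ^ ρ := by
          gcongr; exact min_le_right _ _
      _ = 1 := by field_simp
  refine ⟨δ, hδ0, hδ1, 1, fun ξ hξ z hz => ?_⟩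
  obtain ⟨hz1, hz2⟩ := hz
  have hp := S.pos hξ
  have hpρ : 0 < h ξ ^ ρ := by positivity
  obtain ⟨hs1, hs2⟩ := hω.star_spec (by positivity) (hδ1 ξ)
  have hξ1 : (ξ : ℂ) ∈ closedBall (0 : ℂ) 1 := by
    rw [mem_closedBall_zero_iff, Circle.norm_coe]
  have hfξ : f ξ = h ξ ^ ρ := by
    rw [hfdef]
    simp only
    rw [norm_outerPow_of_norm_eq S.nonneg hρ0.ne' (Circle.norm_coe ξ), Circle.exp_arg]
  have h1 := hlip z hz1 ξ hξ1
  have h2 := hω.mono (s := dist z (ξ : ℂ)) dist_nonneg (by rwa [dist_eq_norm]) (hs1.2.trans one_le_two)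
  rw [hs2] at h2
  have hKδ : K * δ ≤ 1 / 2 := by
    calc K * δ ≤ K * (1 / (2 * (K + 1))) := by gcongr; exact min_le_left _ _
      _ ≤ 1 / 2 := by
        rw [mul_one_div, div_le_div_iff₀ (by positivity) two_pos]; linarith
  have h3 : |f z - h ξ ^ ρ| ≤ h ξ ^ ρ / 2 := by
    rw [← hfξ, ← Real.norm_eq_abs, hfξ]
    rw [hfξ] at h1
    calc _ ≤ K * (δ * h ξ ^ ρ) := h1.trans (by gcongr)
      _ = K * δ * h ξ ^ ρ := by ring
      _ ≤ 1 / 2 * h ξ ^ ρ := by gcongr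
      _ = _ := by ring
  have hfz : f z = ‖outer h z‖ ^ ρ :=
    norm_outerPow_eq S.nonneg hρ0.ne' (mem_closedBall_zero_iff.1 hz1)
  have h4 : 0 < ‖outer h z‖ := by
    refine (norm_nonneg _).lt_of_ne fun h0 => ?_
    rw [hfz, ← h0, Real.zero_rpow hρ0.ne', zero_sub, abs_neg, abs_of_pos hpρ] at h3
    linarith
  refine ⟨norm_pos_iff.1 h4, ?_⟩
  have h5 : |Real.log ((‖outer h z‖ / h ξ) ^ ρ)| ≤ 2 * |(‖outer h z‖ / h ξ) ^ ρ - 1| := by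
    refine abs_log_le_two_mul ?_
    rw [Real.div_rpow h4.le hp.le, ← hfz, le_div_iff₀ hpρ]
    linarith [(abs_le.1 h3).1]
  rw [Real.log_rpow (div_pos h4 hp), Real.div_rpow h4.le hp.le, ← hfz, div_sub_one hpρ.ne',
    abs_div, abs_mul, abs_of_pos hpρ, abs_of_pos hρ0] at h5
  have h6 : 2 * (|f z - h ξ ^ ρ| / h ξ ^ ρ) ≤ 1 := by
    rw [← mul_div_assoc, div_le_one hpρ]; linarith
  have h7 := abs_nonneg (Real.log (‖outer h z‖ / h ξ))
  nlinarith

lemma quotientBounded_of_logComparable {ω : ℝ → ℝ} (hω : IsModulus ω)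
    (hψω : ∀ t ∈ Icc (0 : ℝ) 2, ψ t ≤ ω t) {ρ : ℝ} (hρ : 1 ≤ ρ) (hL : LogComparable ω h ρ) :
    QuotientBounded ψ ω h ρ := by
  have hC := S.lipConst_pos
  obtain ⟨δ, hδ, hδ1, M, hM⟩ := hL
  have hB : 0 < (2 * lipConst ψ h) ^ (ρ - 1) := by positivity
  -- The second entry makes δ'h^ρ ≤ h/(2L) = ψ(λ) ≤ ω(λ), hence r ≤ λ, as `mul_farInt_le` requires.
  set δ' := min δ (1 / (2 * lipConst ψ h * (2 * lipConst ψ h) ^ (ρ - 1))) with hδ'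
  have hδ'0 : 0 < δ' := by positivity
  set N := max 1 (4 * (2 * Real.pi * M + 864 + 2 * Real.pi)) with hN
  refine ⟨N / δ', fun ξ hξ => ?_⟩
  obtain ⟨θ, rfl⟩ : ∃ θ, Circle.exp θ = ξ := ⟨_, Circle.exp_arg ξ⟩
  have hp := S.pos hξ
  have hpρ : 0 < h (Circle.exp θ) ^ ρ := by positivity
  have hle : δ' * h (Circle.exp θ) ^ ρ ≤ δ * h (Circle.exp θ) ^ ρ := by
    gcongr; exact min_le_left _ _
  obtain ⟨hr1, hr2⟩ := hω.star_spec (by positivity) (hle.trans (hδ1 _))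
  have hr0 := hω.star_pos (by positivity) (hle.trans (hδ1 _))
  obtain ⟨hs1, hs2⟩ := hω.star_spec (by positivity) (hδ1 (Circle.exp θ))
  have hrs := hω.star_le (x := δ' * h (Circle.exp θ) ^ ρ) (by positivity) hs1 (by rwa [hs2])
  set r := star ω (δ' * h (Circle.exp θ) ^ ρ) with hr
  obtain ⟨hl1, hl2⟩ := S.radius_spec (Circle.exp θ)
  have hrl : r ≤ radius ψ h (Circle.exp θ) := by
    refine hω.star_le (by positivity) hl1 ?_
    refine le_trans ?_ (hψω _ ⟨hl1.1, hl1.2.trans one_le_two⟩)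
    rw [hl2]
    have := S.rpow_le hρ (Circle.exp θ)
    calc δ' * h (Circle.exp θ) ^ ρ
        ≤ 1 / (2 * lipConst ψ h * (2 * lipConst ψ h) ^ (ρ - 1)) *
          ((2 * lipConst ψ h) ^ (ρ - 1) * h (Circle.exp θ)) := by
          gcongr; exact min_le_right _ _
      _ = _ := by field_simp
  have hw := norm_one_sub_lt hr0 hr1.2
  have hz1 : ‖(Circle.exp θ : ℂ) * ((1 - r : ℝ) : ℂ)‖ < 1 := by
    rwa [norm_mul, Circle.norm_coe, one_mul]
  obtain ⟨_, hlog⟩ := hM (Circle.exp θ) hξ (Circle.exp θ * ((1 - r : ℝ) : ℂ)) ⟨by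
    rw [mem_closedBall_zero_iff]; exact hz1.le, by
    rw [show (Circle.exp θ : ℂ) * ((1 - r : ℝ) : ℂ) - Circle.exp θ =
      Circle.exp θ * ((-r : ℝ) : ℂ) by push_cast; ring, norm_mul, Circle.norm_coe, one_mul,
      Complex.norm_real, norm_neg, Real.norm_of_nonneg hr0.le]
    exact hrs⟩
  rw [norm_outer_of_norm_lt hz1, Real.log_div (Real.exp_pos _).ne' hξ, Real.log_exp] at hlog
  have hrA := S.mul_farInt_le hξ hr0 hrl hlog
  obtain ⟨m0, m1, _, hm⟩ := exists_toReal_min_one_inv (farInt_nonneg ψ h θ)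
  rw [S.a_eq hξ]
  set m := (min 1 (ENNReal.ofReal (farInt ψ h θ))⁻¹).toReal
  have hN1 : 1 ≤ N := le_max_left _ _
  have hmr := hm r N hr1.2 hN1 (hrA.trans (le_max_right _ _))
  have e1 := hω.le_mul_div hr0.le (hr1.2.trans one_le_two) hN1
  have e2 := hω.mono (by positivity) hmr (m1.trans one_le_two)
  rw [hr2] at e1
  rw [div_mul_eq_mul_div, le_div_iff₀ hδ'0]
  calc h (Circle.exp θ) ^ ρ * δ' = δ' * h (Circle.exp θ) ^ ρ := mul_comm _ _
    _ ≤ N * ω (r / N) := e1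
    _ ≤ N * ω m := by gcongr

/-- When τ is large compared with h^ρ(ξ) or with min(1, 1/a_h(ξ)), the trivial bound 2h^ρ(ξ) is
enough. Otherwise moduli and phases are compared separately, the phases by `abs_vBoundary_sub_le`.
-/
lemma exists_modulus_bound_boundary {ω : ℝ → ℝ} (hω : IsModulus ω)
    (hψω : ∀ t ∈ Icc (0 : ℝ) 2, ψ t ≤ ω t) {ρ : ℝ} (hρ : 1 ≤ ρ)
    (hsym₁ : SymmetryFirst ψ h) (hsym₂ : SymmetrySecond ψ h) (hQ : QuotientBounded ψ ω h ρ) :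
    ∃ K, 0 ≤ K ∧ ∀ ξ ∈ nonzeroSet h, ∀ ζ ∈ nonzeroSet h,
      ‖outerPow h ρ ξ - outerPow h ρ ζ‖ ≤ K * ω (dist ξ ζ) := by
  have hC := S.lipConst_pos
  obtain ⟨C, hCp, hsym₁⟩ := hsym₁
  obtain ⟨c, hcp, hsym₂⟩ := hsym₂
  obtain ⟨Q₀, hQ₀⟩ := hQ
  set B := (2 * lipConst ψ h) ^ (ρ - 1) with hBdef
  have hB : 0 < B := by positivity
  have hρ0 : 0 < ρ := by linarith
  set Q := max Q₀ 0 with hQdef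
  have hQ0 : 0 ≤ Q := le_max_right _ _
  set T := 216 * C + 6576 * lipConst ψ h + 512 * c with hT
  have hT0 : 0 < T := by positivity
  -- If ω(τ) < c₀x^ρ then ψ(τ) < x/(4L). This gives y ≥ 3x/4 and puts τ below the radii at both
  -- points.
  set c₀ := 1 / (4 * lipConst ψ h * B) with hc₀
  have hc₀0 : 0 < c₀ := by positivity
  set K := 2 / c₀ + 2 * Q + ρ * (T * B + 774 * Q) + ρ * B * lipConst ψ h with hK
  have hK0 : 0 ≤ K := by positivity
  have main : ∀ ξ ∈ nonzeroSet h, ∀ ζ ∈ nonzeroSet h, ξ ≠ ζ →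
      h (Circle.exp ζ.arg) ≤ h (Circle.exp ξ.arg) →
      ‖outerPow h ρ ξ - outerPow h ρ ζ‖ ≤ K * ω (dist ξ ζ) := by
    intro ξ hξ ζ hζ hne hle
    set τ := dist ξ ζ with hτdef
    have hτ0 : 0 < τ := dist_pos.2 hne
    have hτchord : τ = chord (ζ.arg - ξ.arg) := by
      rw [hτdef, dist_comm, dist_eq_chord hζ.1 hξ.1]
    have hτ2 : τ ≤ 2 := hτchord ▸ chord_le_two _
    have hωτ := hω.pos hτ0 hτ2
    set θ := ξ.arg
    set φ := ζ.arg
    set x := h (Circle.exp θ) with hx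
    set y := h (Circle.exp φ) with hy
    have hx0 : 0 < x := S.pos hξ.2
    have hy0 : 0 < y := S.pos hζ.2
    have hxρ : 0 < x ^ ρ := by positivity
    have htriv : ‖outerPow h ρ ξ - outerPow h ρ ζ‖ ≤ 2 * x ^ ρ := by
      refine (norm_sub_le _ _).trans ?_
      rw [norm_outerPow_of_norm_eq S.nonneg hρ0.ne' hξ.1,
        norm_outerPow_of_norm_eq S.nonneg hρ0.ne' hζ.1]
      have : y ^ ρ ≤ x ^ ρ := by gcongr
      linarith
    have p1 : 0 ≤ 2 / c₀ := by positivity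
    have p2 : 0 ≤ ρ * (T * B + 774 * Q) := by positivity
    have p3 : 0 ≤ ρ * B * lipConst ψ h := by positivity
    rcases le_or_gt (c₀ * x ^ ρ) (ω τ) with hA | hA
    · have : 2 * x ^ ρ ≤ 2 / c₀ * ω τ := by
        rw [div_mul_eq_mul_div, le_div_iff₀ hc₀0]; linarith
      refine htriv.trans (this.trans ?_)
      gcongr
      linarith
    have hψτ : ψ τ < x / (4 * lipConst ψ h) := by
      calc ψ τ ≤ ω τ := hψω τ ⟨hτ0.le, hτ2⟩
        _ < c₀ * x ^ ρ := hA
        _ ≤ c₀ * (B * x) := by gcongr; exact S.rpow_le hρ _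
        _ = _ := by rw [hc₀]; field_simp
    have hψτ0 := S.modulus.pos hτ0 hτ2
    have hdiff : |x - y| ≤ lipConst ψ h * ψ τ := by
      have := S.abs_sub_le (Circle.exp θ) (Circle.exp φ)
      rwa [dist_circleExp, ← chord_neg, neg_sub, ← hτchord] at this
    have hCψ : lipConst ψ h * ψ τ < x / 4 := by
      calc lipConst ψ h * ψ τ < lipConst ψ h * (x / (4 * lipConst ψ h)) := by gcongr
        _ = x / 4 := by field_simp
    have hyx : 3 * x / 4 ≤ y := by linarith [(abs_le.1 hdiff).2]
    have hτξ : τ < radius ψ h (Circle.exp θ) := by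
      refine S.lt_radius hτ2 (hψτ.trans_le ?_)
      rw [← hx]
      gcongr
      norm_num
    have hτζ : τ < radius ψ h (Circle.exp φ) := by
      refine S.lt_radius hτ2 (hψτ.trans_le ?_)
      rw [← hy, div_le_div_iff₀ (by positivity) (by positivity)]
      nlinarith
    have hQx : x ^ ρ ≤ Q * ω (min 1 (a ψ h (Circle.exp θ))⁻¹).toReal := by
      obtain ⟨m0, m1, _, _⟩ := exists_toReal_min_one_inv (farInt_nonneg ψ h θ)
      have h1 := hQ₀ (Circle.exp θ) hξ.2
      rw [S.a_eq hξ.2] at h1 ⊢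
      have h2 := hω.nonneg m0 (m1.trans one_le_two)
      refine h1.trans ?_
      gcongr
      exact le_max_left _ _
    rw [S.a_eq hξ.2] at hQx
    obtain ⟨m0, m1, mA, _⟩ := exists_toReal_min_one_inv (farInt_nonneg ψ h θ)
    set m := (min 1 (ENNReal.ofReal (farInt ψ h θ))⁻¹).toReal
    set A := farInt ψ h θ with hAdef
    have hA0 : 0 ≤ A := farInt_nonneg ψ h θ
    rcases le_or_gt m τ with hmτ | hmτ
    · have h1 := hω.mono m0 hmτ hτ2
      have : 2 * x ^ ρ ≤ 2 * Q * ω τ := by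
        calc 2 * x ^ ρ ≤ 2 * (Q * ω m) := by gcongr
          _ ≤ 2 * (Q * ω τ) := by gcongr
          _ = _ := by ring
      refine htriv.trans (this.trans ?_)
      gcongr
      linarith
    have hv := S.abs_vBoundary_sub_le hCp hsym₁ hsym₂ hξ.2 (hτchord ▸ hτ0) (hτchord ▸ hτξ.le)
      (hτchord ▸ hτζ.le) (by linarith)
    rw [← hτchord, ← hx, ← hAdef] at hv
    have hterm1 : x ^ ρ * (ψ τ / x) ≤ B * ω τ := by
      calc x ^ ρ * (ψ τ / x) ≤ B * x * (ψ τ / x) := by gcongr; exact S.rpow_le hρ _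
        _ = B * ψ τ := by field_simp
        _ ≤ B * ω τ := by gcongr; exact hψω τ ⟨hτ0.le, hτ2⟩
    -- Assertion 4 enters here: ω(m)τ ≤ ω(τ)m trades ω(m) for ω(τ), and the leftover m A is at most
    -- 1.
    have hterm2 : x ^ ρ * (τ * A) ≤ Q * ω τ := by
      have h1 := hω.mul_le_mul hτ0.le hmτ.le (m1.trans one_le_two)
      calc x ^ ρ * (τ * A) ≤ Q * ω m * (τ * A) := by gcongr
        _ = Q * (ω m * τ) * A := by ring
        _ ≤ Q * (ω τ * m) * A := by gcongr
        _ = Q * ω τ * (m * A) := by ring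
        _ ≤ Q * ω τ * 1 := by gcongr
        _ = _ := mul_one _
    have hvx : x ^ ρ * |vBoundary h θ - vBoundary h φ| ≤ (T * B + 774 * Q) * ω τ := by
      rw [abs_sub_comm]
      calc _ ≤ x ^ ρ * (T * (ψ τ / x) + 774 * (τ * A)) := by gcongr
        _ = T * (x ^ ρ * (ψ τ / x)) + 774 * (x ^ ρ * (τ * A)) := by ring
        _ ≤ T * (B * ω τ) + 774 * (Q * ω τ) := by gcongr
        _ = _ := by ring
    have hxy : |x ^ ρ - y ^ ρ| ≤ ρ * B * lipConst ψ h * ω τ := by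
      refine (abs_rpow_sub_rpow_le hρ hx0.le (S.le_two_mul_lipConst _) hy0.le
        (S.le_two_mul_lipConst _)).trans ?_
      calc ρ * B * |x - y| ≤ ρ * B * (lipConst ψ h * ω τ) := by
            gcongr
            refine hdiff.trans ?_
            gcongr
            exact hψω τ ⟨hτ0.le, hτ2⟩
        _ = _ := by ring
    rw [outerPow_of_mem hξ, outerPow_of_mem hζ]
    have hsplit : ((x ^ ρ : ℝ) : ℂ) * Complex.exp (Complex.I * (ρ * vBoundary h θ)) -
        ((y ^ ρ : ℝ) : ℂ) * Complex.exp (Complex.I * (ρ * vBoundary h φ)) =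
        ((x ^ ρ : ℝ) : ℂ) * (Complex.exp (Complex.I * ((ρ * vBoundary h θ : ℝ) : ℂ)) -
          Complex.exp (Complex.I * ((ρ * vBoundary h φ : ℝ) : ℂ))) +
        ((x ^ ρ - y ^ ρ : ℝ) : ℂ) * Complex.exp (((ρ * vBoundary h φ : ℝ) : ℂ) * Complex.I) := by
      push_cast
      rw [mul_comm (_ * _) Complex.I]
      ring
    rw [hsplit]
    refine (norm_add_le _ _).trans ?_
    rw [norm_mul, norm_mul, Complex.norm_exp_ofReal_mul_I, mul_one, Complex.norm_real,
      Complex.norm_real, Real.norm_of_nonneg hxρ.le, Real.norm_eq_abs]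
    have he := norm_exp_I_mul_sub_le (ρ * vBoundary h θ) (ρ * vBoundary h φ)
    rw [← mul_sub, abs_mul, abs_of_pos hρ0] at he
    calc _ ≤ x ^ ρ * (ρ * |vBoundary h θ - vBoundary h φ|) +
          ρ * B * lipConst ψ h * ω τ := by gcongr
      _ = ρ * (x ^ ρ * |vBoundary h θ - vBoundary h φ|) + ρ * B * lipConst ψ h * ω τ := by ring
      _ ≤ ρ * ((T * B + 774 * Q) * ω τ) + ρ * B * lipConst ψ h * ω τ := by gcongr
      _ = (ρ * (T * B + 774 * Q) + ρ * B * lipConst ψ h) * ω τ := by ring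
      _ ≤ K * ω τ := by
        gcongr
        linarith
  refine ⟨K, hK0, fun ξ hξ ζ hζ => ?_⟩
  rcases eq_or_ne ξ ζ with rfl | hne
  · simp [hω.map_zero]
  rcases le_total (h (Circle.exp ζ.arg)) (h (Circle.exp ξ.arg)) with hle | hle
  · exact main ξ hξ ζ hζ hne hle
  · rw [norm_sub_rev, dist_comm]
    exact main ζ hζ ξ hξ hne.symm hle

lemma memLambda_of_quotientBounded {ω : ℝ → ℝ} (hω : IsModulus ω)
    (hψω : ∀ t ∈ Icc (0 : ℝ) 2, ψ t ≤ ω t) {ρ : ℝ} (hρ : 1 ≤ ρ)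
    (hsym₁ : SymmetryFirst ψ h) (hsym₂ : SymmetrySecond ψ h) (hQ : QuotientBounded ψ ω h ρ) :
    MemLambda ω (outerPow h ρ) := by
  have hρ0 : 0 < ρ := by linarith
  set F := outerPow h ρ with hF
  obtain ⟨K, hK0, hK⟩ := S.exists_modulus_bound_boundary hω hψω hρ hsym₁ hsym₂ hQ
  obtain ⟨C, hCp, hsym₁⟩ := hsym₁
  have hdiff : DifferentiableOn ℂ F (ball 0 1) :=
    ((S.log.differentiableOn.const_mul (ρ : ℂ)).cexp).congr fun z hz =>
      outerPow_of_norm_lt (mem_ball_zero_iff.1 hz)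
  have hbound : ∀ z ∈ ball (0 : ℂ) 1,
      ‖F z‖ ≤ Real.exp (ρ * Real.log (2 * lipConst ψ h)) := fun z hz => by
    have hz' := mem_ball_zero_iff.1 hz
    rw [hF, norm_outerPow_of_norm_lt hz']
    gcongr
    exact S.u_le hz'
  have hrad : ∀ ξ ∈ nonzeroSet h,
      Tendsto (fun r : ℝ => F (r * ξ)) (𝓝[<] 1) (𝓝 (F ξ)) := by
    intro ξ hξ
    have hu := S.tendsto_u_radial hξ.2
    have hv := S.tendsto_v_radial hξ.2 (fun s => hsym₁ ξ.arg s hξ.2)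
    rw [circleExp_arg hξ.1] at hu hv
    have hlim := (Complex.continuous_exp.tendsto _).comp
      ((((Complex.continuous_ofReal.tendsto _).comp hu).add
      (((Complex.continuous_ofReal.tendsto _).comp hv).const_mul Complex.I)).const_mul (ρ : ℂ))
    have hval : F ξ = Complex.exp (ρ * ((Real.log (h (Circle.exp ξ.arg)) : ℂ) +
        Complex.I * (vBoundary h ξ.arg : ℂ))) := by
      rw [hF, outerPow_of_mem hξ, Real.rpow_def_of_pos (S.pos hξ.2), Complex.ofReal_exp,
        ← Complex.exp_add]
      congr 1
      push_cast
      ring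
    rw [hval]
    refine hlim.congr' ?_
    filter_upwards [eventually_norm_mul_lt_one hξ.1] with r hr1
    rw [hF, outerPow_of_norm_lt hr1]
    rfl
  -- Continuity on the closed disk is not yet known: the argument uses only boundedness, radial
  -- limits at almost every boundary point and the estimate between those points.
  have hdisk := modulus_bound_ball_of_boundary hω hdiff hbound (nonzeroSet_subset_sphere h)
    S.ae_mem_nonzeroSet hrad hK0 hK
  have hball : ball (0 : ℂ) 1 ⊆ closedBall 0 1 := ball_subset_closedBall
  have hbd : ∀ z : ℂ, ‖z‖ = 1 → ‖F z‖ = h (Circle.exp z.arg) ^ ρ := fun z hz =>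
    norm_outerPow_of_norm_eq S.nonneg hρ0.ne' hz
  have hcl := fun z hz => S.mem_closure_graph_ball hρ0 hbd hrad (z := z) hz
  have hΓ : ∀ z ∈ closedBall (0 : ℂ) 1, ∀ w ∈ closedBall (0 : ℂ) 1, dist z w ≤ 2 :=
    fun z hz w hw => dist_closedBall_le_two hz hw
  have hlip := modulus_bound_of_mem_closure_graph hω hΓ hball hdisk hcl
  exact ⟨hdiff, continuousOn_of_modulus_bound hω hΓ hlip, seminorm_lt_top hω hΓ hlip⟩

end Setting

lemma modulus_abs_of_memLambda {ω : ℝ → ℝ} (hω : IsModulus ω) {f : ℂ → ℂ} (hf : MemLambda ω f) :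
    seminorm ω (ball (0 : ℂ) 1) (fun z => ‖f z‖) < ⊤ := by
  have hball : ball (0 : ℂ) 1 ⊆ closedBall 0 1 := ball_subset_closedBall
  refine seminorm_lt_top hω (K := (seminorm ω (closedBall (0 : ℂ) 1) f).toReal)
    (fun z hz w hw => dist_closedBall_le_two (hball hz) (hball hw)) fun z hz w hw => ?_
  exact (abs_norm_sub_norm_le _ _).trans (norm_sub_le_of_seminorm_lt_top hω
    (fun z hz w hw => dist_closedBall_le_two hz hw) hf.lipschitz (hball hz) (hball hw))

end OuterLip

end

theorem theorem1p1 (ψ ω : ℝ → ℝ) (hψ : OuterLip.IsModulus ψ) (hω : OuterLip.IsModulus ω)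
    (hψω : ∀ t ∈ Set.Icc (0 : ℝ) 2, ψ t ≤ ω t)
    (ρ : ℝ) (hρ : 1 ≤ ρ)
    (h : Circle → ℝ) (hcont : Continuous h) (hnonneg : ∀ ξ, 0 ≤ h ξ)
    (hzero : ∃ ξ, h ξ = 0)
    (hlog : OuterLip.LogIntegrable h)
    (hlip : OuterLip.seminorm ψ Set.univ h < ⊤)
    (hsym₁ : OuterLip.SymmetryFirst ψ h)
    (hsym₂ : OuterLip.SymmetrySecond ψ h) :
    List.TFAE [
      OuterLip.MemLambda ω (OuterLip.outerPow h ρ),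
      OuterLip.seminorm ω (Metric.ball (0 : ℂ) 1) (fun z => ‖OuterLip.outerPow h ρ z‖) < ⊤,
      OuterLip.LogComparable ω h ρ,
      OuterLip.QuotientBounded ψ ω h ρ] := by
  have S : OuterLip.Setting ψ h := ⟨hψ, hcont, hnonneg, hzero, hlog, hlip⟩
  tfae_have 1 → 2 := OuterLip.modulus_abs_of_memLambda hω
  tfae_have 2 → 3 := S.logComparable_of_modulus_abs hω hρ
  tfae_have 3 → 4 := S.quotientBounded_of_logComparable hω hψω hρ
  tfae_have 4 → 1 := S.memLambda_of_quotientBounded hω hψω hρ hsym₁ hsym₂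
  tfae_finish
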